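/- Let $\overline{\mathbb R}=(\mathbb R\cup\{\infty\},\min,+)$ be the tropical semiring, let $\mathbb B=\{0,\infty\}\subseteq\overline{\mathbb R}$ be the Boolean semiring, and let $K$ be $\overline{\mathbb R}$ or $\mathbb B$. For $f=\bigoplus_{u} c_u x^u$ with coefficients in $K$ and $w\in\mathbb R^n$ let $f(w)=\min_u(c_u+u\cdot w)$, let $\mathrm{in}_w(f)=\bigoplus_{c_u\neq\infty,\ c_u+u\cdot w=f(w)}x^u$, a polynomial with coefficients in $\mathbb B$, and for an ideal $I$ let $\mathrm{in}_w(I)$ be the ideal (with coefficients in $\mathbb B$) generated by all $\mathrm{in}_w(f)$, $f\in I$. For an ideal $I$ of a Laurent polynomial semiring let $V(I)\subseteq\mathbb R^n$ be the set of $w$ such that, for every $f\in I$ other than $\infty$, the minimum in $f(w)$ is attained at least twice. An ideal $I\subseteq K[x_1^{\pm1},\dots,x_n^{\pm1}]$ is a tropical ideal if for all $f,g\in I$ and every monomial $x^u$ whose coefficients in $f$ and $g$ are equal and not $\infty$ there is $h\in I$ in which $x^u$ has coefficient $\infty$ and every monomial $x^v$ has a coefficient $\ge\min([f]_{x^v},[g]_{x^v})$,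 with equality if $[f]_{x^v}\neq[g]_{x^v}$. Let $I^h\subseteq K[x_0,\dots,x_n]$ be the ideal generated by the homogenizations of the polynomials in $I\cap K[x_1,\dots,x_n]$. For a homogeneous ideal $H\subseteq K[x_0,\dots,x_n]$ and a point $w\in\mathbb R^n$, the Gröbner cell of $H$ at $w$ is the closure of $\{w'\in\mathbb R^n:\mathrm{in}_{(0,w')}(H)=\mathrm{in}_{(0,w)}(H)\}$. The Gröbner complex structure of $V(I)$ consists of the Gröbner cells of $I^h$ at the points $w\in V(I)$. For a maximal cell $\tau$ of it, let $S_0\subseteq\mathbb B[x_1^{\pm1},\dots,x_n^{\pm1}]$ consist of the polynomials all of whose exponents are orthogonal to $\mathrm{span}(\tau)=\mathrm{span}\{x-y:x,y\in\tau\}$. The weight (multiplicity) of $\tau$ is the degree of $\mathrm{in}_u(I)\cap S_0$ for $u\in\mathrm{relint}(\tau)$, that is, the supremum of the sizes of the finite sets of monomials of $S_0$ that do not contain the support of a polynomial $\ne\infty$ of $\mathrm{in}_u(I)$. For a polyhedral complex $\Sigma$ and a point $w$ in the relative interior of a cell $\sigma\in\Sigma$, the star $\mathrm{star}_\Sigma(w)$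 consists of the cones $\overline\tau=\{v\in\mathbb R^n: w+\epsilon v\in\tau\text{ for all sufficiently small }\epsilon>0\}$ of the cells $\tau\in\Sigma$ with $\sigma\subseteq\tau$; it is empty if $w$ is not in the support of $\Sigma$. If $\Sigma$ is weighted, the cone $\overline\tau$ of a maximal cell $\tau$ gets the weight of $\tau$. Proposition. Let $I\subseteq K[x_1^{\pm1},\dots,x_n^{\pm1}]$ be a tropical ideal and $w\in\mathbb R^n$. (1) For every $v\in\mathbb R^n$ there is $\epsilon_0>0$ such that $\mathrm{in}_v(\mathrm{in}_w(I))=\mathrm{in}_{w+\epsilon v}(I)$ for all $0<\epsilon<\epsilon_0$. (2) $V(\mathrm{in}_w(I))$ is the star of $V(I)$ at $w$: it is the set of all $v$ such that $w+\epsilon v\in V(I)$ for all sufficiently small $\epsilon>0$, and it is the support of $\mathrm{star}_\Sigma(w)$ for every finite polyhedral complex $\Sigma$ with support $V(I)$. (3) This is an equality of weighted polyhedral fans. Let $\Sigma$ be the Gröbner complex structure of $V(I)$. The cones of $\mathrm{star}_\Sigma(w)$ are exactly the Gröbner cells of $\mathrm{in}_{(0,w)}(I^h)$ at the points $v\in V(\mathrm{in}_w(I))$.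 If $\tau$ is a maximal cell of $\Sigma$ containing $w$, then for all $u\in\mathrm{relint}(\tau)$ and $v\in\mathrm{relint}(\overline\tau)$ the multiplicity of $V(\mathrm{in}_w(I))$ at the point $v$ of the cone $\overline\tau$ equals the multiplicity of $V(I)$ at the point $u$ of $\tau$. Moreover, if $\rho$ is a maximal cell of the Gröbner complex structure of $V(\mathrm{in}_w(I))$ itself (defined by the homogenization of $\mathrm{in}_w(I)$) whose relative interior meets that of $\overline\tau$, then $\mathrm{span}(\rho)=\mathrm{span}(\tau)$ and the multiplicity at every point of $\mathrm{relint}(\rho)$ equals the multiplicity at every point of $\mathrm{relint}(\tau)$; that is, the two weighted fan structures agree up to refinement. -/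

import Mathlib

open Set

noncomputable section

/-- The tropical semiring `ℝ ∪ {∞}`: addition is `min`, multiplication is `+`. -/
abbrev TropicalReal : Type := Tropical (WithTop ℝ)

/-- The Boolean semiring `{0, ∞}`, inside the tropical semiring. In the semiring language its two
elements are the tropical `1` (the real number `0`) and the tropical `0` (which is `∞`). -/
def booleanSemiring : Subsemiring TropicalReal where
  carrier := {0, 1}
  zero_mem' := by simp
  one_mem' := by simp
  add_mem' := by
    rintro a b (rfl | rfl) (rfl | rfl) <;> simp
  mul_mem' := by
    rintro a b (rfl | rfl) (rfl | rfl) <;> simp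

/-- Polynomials with coefficients in a semiring `K` of tropical numbers and exponents in `M`. -/
abbrev TropPoly (K : Subsemiring TropicalReal) (M : Type) : Type := AddMonoidAlgebra K M

/-- Laurent polynomials in `n` variables. -/
abbrev Laurent (K : Subsemiring TropicalReal) (n : ℕ) : Type := TropPoly K (Fin n → ℤ)

/-- Ordinary polynomials in `n` variables. -/
abbrev OrdPoly (K : Subsemiring TropicalReal) (n : ℕ) : Type := TropPoly K (Fin n →₀ ℕ)

section General

variable {K : Subsemiring TropicalReal} {M : Type}

/-- The coefficient of `x^u` in `f`, as an element of `ℝ ∪ {∞}`. -/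
def tropCoeff (f : TropPoly K M) (u : M) : WithTop ℝ :=
  Tropical.untrop (f.coeff u : TropicalReal)

/-- The value `min_u (c_u + wt u)` of `f = ⊕ c_u x^u`, where `wt u` is the value of the monomial
`x^u`; it is `∞` for the polynomial `∞`. -/
def tropEval (wt : M → ℝ) (f : TropPoly K M) : WithTop ℝ :=
  f.coeff.support.inf fun u => tropCoeff f u + (wt u : WithTop ℝ)

open Classical in
/-- The monomials of `f` at which the minimum in the value of `f` is attained. -/
def minTerms (wt : M → ℝ) (f : TropPoly K M) : Finset M :=
  f.coeff.support.filter fun u => tropCoeff f u + (wt u : WithTop ℝ) = tropEval wt f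

/-- The initial form of `f`: the sum, with coefficients in the Boolean semiring, of the monomials
at which the minimum is attained. -/
def initialForm (wt : M → ℝ) (f : TropPoly K M) : TropPoly booleanSemiring M :=
  ∑ u ∈ minTerms wt f, AddMonoidAlgebra.single u 1

/-- The initial ideal: the ideal generated by the initial forms of the elements. -/
def initialIdealWt [AddCommMonoid M] (wt : M → ℝ) (I : Ideal (TropPoly K M)) :
    Ideal (TropPoly booleanSemiring M) :=
  Ideal.span (initialForm wt '' (I : Set (TropPoly K M)))

/-- The monomial elimination axiom. -/
def IsTropicalIdeal [AddCommMonoid M] (I : Ideal (TropPoly K M)) : Prop :=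
  ∀ f ∈ I, ∀ g ∈ I, ∀ u : M, tropCoeff f u = tropCoeff g u → tropCoeff f u ≠ ⊤ →
    ∃ h ∈ I, tropCoeff h u = ⊤ ∧
      ∀ v : M, min (tropCoeff f v) (tropCoeff g v) ≤ tropCoeff h v ∧
        (tropCoeff f v ≠ tropCoeff g v →
          tropCoeff h v = min (tropCoeff f v) (tropCoeff g v))

end General

section LaurentIdeals

variable {K : Subsemiring TropicalReal} {n : ℕ}

/-- The value `u · w` of the Laurent monomial `x^u` at `w`. -/
def dotWt (w : Fin n → ℝ) (u : Fin n → ℤ) : ℝ := ∑ i, (u i : ℝ) * w i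

/-- `in_w(I)` for an ideal `I` of the Laurent polynomial semiring. -/
def initialIdeal (w : Fin n → ℝ) (I : Ideal (Laurent K n)) : Ideal (Laurent booleanSemiring n) :=
  initialIdealWt (dotWt w) I

/-- The variety of an ideal of the Laurent polynomial semiring: the points at which every `f ∈ I`
different from the polynomial `∞` attains its minimum at least twice. -/
def tropVariety (I : Ideal (Laurent K n)) : Set (Fin n → ℝ) :=
  {w | ∀ f ∈ I, f ≠ 0 → ∃ u ∈ minTerms (dotWt w) f, ∃ u' ∈ minTerms (dotWt w) f, u ≠ u'}

/-- The value at `(0, w)` of a monomial in `x₀, x₁, …, xₙ`. -/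
def homWt (w : Fin n → ℝ) (u : Fin (n + 1) →₀ ℕ) : ℝ :=
  ∑ i, (u i : ℝ) * (Fin.cons 0 w : Fin (n + 1) → ℝ) i

/-- The inclusion of the polynomial semiring in the Laurent polynomial semiring. -/
def toLaurent (K : Subsemiring TropicalReal) (n : ℕ) : OrdPoly K n →+* Laurent K n :=
  AddMonoidAlgebra.mapDomainRingHom K
    ({ toFun := fun u i => (u i : ℤ)
       map_zero' := by ext; simp
       map_add' := by intros; ext; simp } : (Fin n →₀ ℕ) →+ (Fin n → ℤ))

/-- The total degree of a polynomial. -/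
def tropDegree (f : OrdPoly K n) : ℕ := f.coeff.support.sup fun u => ∑ i, u i

/-- The homogenization `⊕ c_u x₀^(d - |u|) x^u` of `f = ⊕ c_u x^u`, with `d` the degree of `f`. -/
def homogenizePoly (f : OrdPoly K n) : OrdPoly K (n + 1) :=
  ∑ u ∈ f.coeff.support,
    AddMonoidAlgebra.single (Finsupp.cons (tropDegree f - ∑ i, u i) u) (f.coeff u)

/-- The ideal `(I ∩ K[x₁, …, xₙ])^h` of `K[x₀, …, xₙ]` generated by the homogenizations of the
polynomials in `I`. -/
def homogenization (I : Ideal (Laurent K n)) : Ideal (OrdPoly K (n + 1)) :=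
  Ideal.span (homogenizePoly '' (I.comap (toLaurent K n) : Set (OrdPoly K n)))

/-- The cell containing `w` in its relative interior of the Gröbner complex of a homogeneous ideal
`H` of `K[x₀, …, xₙ]`, where `ℝⁿ` is identified with the slice `w₀ = 0` of `ℝⁿ⁺¹`. -/
def groebnerCell (H : Ideal (OrdPoly K (n + 1))) (w : Fin n → ℝ) : Set (Fin n → ℝ) :=
  closure {w' | initialIdealWt (homWt w') H = initialIdealWt (homWt w) H}

/-- The cells of the Gröbner complex of `H` whose relative interiors lie in the set `X`
(in use, `X` is a union of such relative interiors). -/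
def groebnerComplexOn (H : Ideal (OrdPoly K (n + 1))) (X : Set (Fin n → ℝ)) :
    Set (Set (Fin n → ℝ)) :=
  groebnerCell H '' X

/-- The Gröbner complex structure of `V(I)`. -/
def groebnerComplex (I : Ideal (Laurent K n)) : Set (Set (Fin n → ℝ)) :=
  groebnerComplexOn (homogenization I) (tropVariety I)

/-- Exponents of the Laurent monomials of degree zero for the grading induced by the linear span
`span {x - y : x, y ∈ C}` of a cell `C`. -/
def degreeZeroExponents (C : Set (Fin n → ℝ)) : Set (Fin n → ℤ) :=
  {u | ∀ v ∈ vectorSpan ℝ C, dotWt v u = 0}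

/-- The degree of the ideal `J ∩ S₀`, where `S₀` consists of the polynomials with exponents in `S`:
the largest size of a finite set of monomials of `S₀` which does not contain the support of a
(nonzero) polynomial of `J`. -/
def degreeOn (J : Ideal (Laurent booleanSemiring n)) (S : Set (Fin n → ℤ)) : ℕ∞ :=
  ⨆ E ∈ {E : Finset (Fin n → ℤ) | (E : Set (Fin n → ℤ)) ⊆ S ∧
    ∀ f ∈ J, f ≠ 0 → ¬ f.coeff.support ⊆ E}, (E.card : ℕ∞)

/-- The multiplicity of `V(I)` at a point `u` of the relative interior of a maximal cell `C`. -/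
def tropMultiplicity (I : Ideal (Laurent K n)) (C : Set (Fin n → ℝ)) (u : Fin n → ℝ) : ℕ∞ :=
  degreeOn (initialIdeal u I) (degreeZeroExponents C)

end LaurentIdeals

section Polyhedral

variable {n : ℕ}

/-- The set of all `v` with `w + ε v ∈ X` for all sufficiently small `ε > 0`. -/
def starCone (w : Fin n → ℝ) (X : Set (Fin n → ℝ)) : Set (Fin n → ℝ) :=
  {v | ∃ ε₀ > (0 : ℝ), ∀ ε : ℝ, 0 < ε → ε < ε₀ → w + ε • v ∈ X}

/-- The star at `w` of a polyhedral complex `Γ`: the cones of the cells `τ` containing the cell `σ`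
which has `w` in its relative interior. It has no cones when `w` is not in the support of `Γ`. -/
def polyStar (Γ : Set (Set (Fin n → ℝ))) (w : Fin n → ℝ) : Set (Set (Fin n → ℝ)) :=
  {C | ∃ σ ∈ Γ, w ∈ intrinsicInterior ℝ σ ∧ ∃ τ ∈ Γ, σ ⊆ τ ∧ C = starCone w τ}

/-- A polyhedron: an intersection of finitely many closed half-spaces. -/
def IsPolyhedron (P : Set (Fin n → ℝ)) : Prop :=
  ∃ A : Finset ((Fin n → ℝ) × ℝ), P = {x | ∀ a ∈ A, ∑ i, a.1 i * x i ≤ a.2}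

/-- A finite polyhedral complex, given by its nonempty cells. -/
structure IsPolyhedralComplex (Γ : Set (Set (Fin n → ℝ))) : Prop where
  finite : Γ.Finite
  nonempty : ∀ P ∈ Γ, P.Nonempty
  polyhedron : ∀ P ∈ Γ, IsPolyhedron P
  face_mem : ∀ P ∈ Γ, ∀ F : Set (Fin n → ℝ), F.Nonempty → IsExposed ℝ P F → F ∈ Γ
  inter_face : ∀ P ∈ Γ, ∀ Q ∈ Γ, IsExposed ℝ P (P ∩ Q)

end Polyhedral

end

/-!
The proof rests on two facts about a homogeneous tropical ideal `H` of `K[x₀, …, xₙ]`: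

* for all `w` and `v` there is one `ε₀ > 0` with `in_v(in_w(H)) = in_{w+εv}(H)` for all
  `0 < ε < ε₀` (`IsGradedTropical.exists_homWt`);
* the set of all `w'` with `in_{w'}(H) = in_w(H)` is convex (`IsGradedTropical.convex_homWt`).

Both are proved with matroids. By the elimination axiom the supports of the polynomials of a
tropical ideal with exponents in a finite set `E` are vectors of a matroid on `E`, and the initial
ideal, which is again tropical, has a matroid on the same set. Every basis of the initial matroid is
a basis of the matroid (`IsTropicalIdeal.isBase_of_initialMatroid`: if each fundamental circuit has
its off-basis monomial as initial term, then eliminating these monomials from one another never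
cancels a leading one). So all initial matroids have the same rank, and an inclusion between their
closure operators is an equality. For each `f`, `in_v(in_w(f)) = in_{w+εv}(f)` for small `ε`, which
gives such an inclusion on each finite `E` and thereby the first fact in a single degree. A basis
common to the initial matroids at two weights makes every basis at an inner point of the segment a
basis at both ends (`IsTropicalIdeal.isBase_endpoints`: an affine function which is nonnegative at
the ends of a segment and vanishes inside it is zero). This gives the second fact, and also shows
that the initial matroid is constant on an open segment over which one set stays a basis. Such a set
exists in all degrees at once: the lexicographic leading monomials of `in_v(in_w(H))` are closed
under multiplication by monomials, hence finitely generated by Dickson's lemma, so for small `ε` the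
monomials outside them are a basis for `in_{w+εv}(H)` in every degree. This makes `ε₀` independent
of the degree.

An ideal `I` of Laurent polynomials is recovered from `H = I^h` by setting `x₀ = 1`, and so is
`in_w(I)` from `in_{(0,w)}(H)` (`initialIdeal_eq_map`), which transfers the first fact to `I`.
Membership of `w` in `V(I)` depends on `in_w(I)` only, so `V(in_w(I))` is the star of `V(I)`.

The geometric assertions follow from the two facts without knowing that the Gröbner complex is
finite or that its cells are polyhedra. The set of the `w'` with `in_{w'}(H) = in_w(H)` is convex,
and by the first fact every segment in it can be prolonged within it; hence it is the relative
interior of its closure, the Gröbner cell. If `in_v(in_w(H)) = in_u(H)`, the cell of `in_w(H)` at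
`v` is the cone at `w` of the cell of `H` at `u` (`groebnerCell_initialIdealWt`). The multiplicities
agree because the initial ideals and the spans of the cells do. For the complex defined by
`in_w(I)` alone the spans agree because near a relative interior point of a maximal cell the variety
lies in the affine span of that cell (`mem_vectorSpan_of_maximal`).
-/

noncomputable section

/-! ### Matroids from families of vectors -/

/-- A family of finite sets with the weak elimination property of the vectors of a matroid: an
element `u` common to `F` and `G` can be eliminated while keeping a given element `v` of `F` that
does not lie in `G`. The members are unions of circuits, and the empty set may be one of them. -/
def IsVectorFamily {α : Type*} (𝒱 : Set (Finset α)) : Prop :=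
  ∀ F ∈ 𝒱, ∀ G ∈ 𝒱, ∀ u ∈ F, u ∈ G → ∀ v ∈ F, v ∉ G →
    ∃ H ∈ 𝒱, v ∈ H ∧ u ∉ H ∧ ∀ x ∈ H, x ∈ F ∨ x ∈ G

section VectorMatroid

variable {α : Type*} {𝒱 : Set (Finset α)}

/-- Steinitz exchange: a set `J` without nonempty vectors is at most as large as a finite set `I`
that spans it. The induction is on `|I \ J|`; each step replaces an element of `I \ J` by one of
`J`. -/
theorem IsVectorFamily.ncard_le_of_spans (h𝒱 : IsVectorFamily 𝒱) {J : Set α}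
    (hJ : ∀ G ∈ 𝒱, (G : Set α) ⊆ J → G = ∅) (m : ℕ) :
    ∀ I : Set α, I.Finite → (I \ J).ncard = m →
      (∀ e ∈ J, e ∉ I → ∃ G ∈ 𝒱, e ∈ G ∧ (G : Set α) ⊆ insert e I) → J.ncard ≤ I.ncard := by
  induction m with
  | zero =>
    intro I hI hm hs
    have hIJ : I ⊆ J := by
      rw [Set.ncard_eq_zero (hI.sdiff)] at hm
      exact Set.sdiff_eq_empty.mp hm
    refine Set.ncard_le_ncard (fun e he => ?_) hI
    by_contra heI
    obtain ⟨G, hG, heG, hGI⟩ := hs e he heI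
    have := hJ G hG (hGI.trans (Set.insert_subset he hIJ))
    simp [this] at heG
  | succ m ih =>
    intro I hI hm hs
    by_cases hJI : J ⊆ I
    · exact Set.ncard_le_ncard hJI hI
    obtain ⟨e, heJ, heI⟩ := Set.not_subset.mp hJI
    obtain ⟨G, hG, heG, hGI⟩ := hs e heJ heI
    have hGJ : ¬ (G : Set α) ⊆ J := fun h => by
      have := hJ G hG h
      simp [this] at heG
    obtain ⟨b, hbG, hbJ⟩ := Set.not_subset.mp hGJ
    have hbe : b ≠ e := fun h => hbJ (h ▸ heJ)
    have hbI : b ∈ I := (hGI hbG).resolve_left hbe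
    have heb : e ∉ I \ {b} := fun h => heI h.1
    have hcard : (insert e (I \ {b})).ncard = I.ncard := by
      rw [Set.ncard_insert_of_notMem heb hI.sdiff]
      exact Set.ncard_sdiff_singleton_add_one hbI hI
    rw [← hcard]
    refine ih _ (hI.sdiff.insert e) ?_ ?_
    · have : insert e (I \ {b}) \ J = (I \ J) \ {b} := by
        ext x
        simp only [Set.mem_sdiff, Set.mem_insert_iff, Set.mem_singleton_iff]
        constructor
        · rintro ⟨rfl | h, h'⟩
          · exact absurd heJ h'
          · exact ⟨⟨h.1, h'⟩, h.2⟩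
        · rintro ⟨⟨h, h'⟩, h''⟩
          exact ⟨Or.inr ⟨h, h''⟩, h'⟩
      rw [this]
      have := Set.ncard_sdiff_singleton_add_one (show b ∈ I \ J from ⟨hbI, hbJ⟩) hI.sdiff
      omega
    · intro x hxJ hx
      have hxe : x ≠ e := fun h => hx (h ▸ Set.mem_insert _ _)
      have hxb : x ≠ b := fun h => hbJ (h ▸ hxJ)
      have hxI : x ∉ I := fun h => hx (Set.mem_insert_of_mem _ ⟨h, hxb⟩)
      obtain ⟨G', hG', hxG', hG'I⟩ := hs x hxJ hxI
      by_cases hbG' : b ∈ G'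
      · have hxG : x ∉ G := fun h => (hGI h).elim hxe hxI
        obtain ⟨H, hH, hxH, hbH, hHsub⟩ := h𝒱 G' hG' G hG b hbG' hbG x hxG' hxG
        refine ⟨H, hH, hxH, fun y hy => ?_⟩
        have hyb : y ≠ b := fun h => hbH (h ▸ hy)
        rcases hHsub y hy with h | h
        · rcases hG'I h with h | h
          · exact Or.inl h
          · exact Or.inr (Or.inr ⟨h, hyb⟩)
        · rcases hGI h with h | h
          · exact Or.inr (Or.inl h)
          · exact Or.inr (Or.inr ⟨h, hyb⟩)
      · refine ⟨G', hG', hxG', fun y hy => ?_⟩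
        have hyb : y ≠ b := fun h => hbG' (h ▸ hy)
        rcases hG'I hy with h | h
        · exact Or.inl h
        · exact Or.inr (Or.inr ⟨h, hyb⟩)

/-- The matroid on a finite set `E` whose dependent sets are those containing a nonempty vector.
Vectors that are not contained in `E` play no role. -/
def vectorMatroid (h𝒱 : IsVectorFamily 𝒱) (E : Finset α) : Matroid α :=
  (IndepMatroid.ofFinite (E := (E : Set α)) E.finite_toSet
    (fun X => X ⊆ E ∧ ∀ G ∈ 𝒱, (G : Set α) ⊆ X → G = ∅)
    ⟨Set.empty_subset _, fun G _ h => by simpa using h⟩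
    (fun _ _ hJ hIJ => ⟨hIJ.trans hJ.1, fun G hG h => hJ.2 G hG (h.trans hIJ)⟩)
    (fun I J hI hJ hlt => by
      by_contra! hcon
      refine absurd (h𝒱.ncard_le_of_spans hJ.2 _ I
        (E.finite_toSet.subset hI.1) rfl fun e heJ heI => ?_) (not_le.mpr hlt)
      obtain ⟨G, hG, hGI, hne⟩ := hcon e heJ heI (Set.insert_subset (hJ.1 heJ) hI.1)
      refine ⟨G, hG, ?_, hGI⟩
      by_contra heG
      exact hne.ne_empty
        (hI.2 G hG fun x hx => (hGI hx).resolve_left fun h => heG (h ▸ hx)))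
    (fun _ h => h.1)).matroid

theorem vectorMatroid_indep (h𝒱 : IsVectorFamily 𝒱) (E : Finset α) {X : Set α} :
    (vectorMatroid h𝒱 E).Indep X ↔ X ⊆ E ∧ ∀ G ∈ 𝒱, (G : Set α) ⊆ X → G = ∅ := Iff.rfl

theorem mem_closure_of_vector (h𝒱 : IsVectorFamily 𝒱) {E : Finset α} {X : Set α}
    (hX : X ⊆ E) {e : α} (he : e ∈ E) {G : Finset α} (hG : G ∈ 𝒱) (heG : e ∈ G)
    (hGX : (G : Set α) ⊆ insert e X) : e ∈ (vectorMatroid h𝒱 E).closure X := by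
  classical
  set M := vectorMatroid h𝒱 E
  obtain ⟨I, hI⟩ := M.exists_isBasis X hX
  rw [← hI.closure_eq_closure]
  by_contra hcl
  have heI : e ∉ I := fun h => hcl (M.mem_closure_of_mem h (hI.subset.trans hX))
  have hind : M.Indep (insert e I) := (hI.indep.notMem_closure_iff_of_notMem heI he).mp hcl
  -- Replace the elements of the vector outside `I` one after the other.
  have key : ∀ m : ℕ, ∀ G ∈ 𝒱, e ∈ G → (G : Set α) ⊆ insert e X →
      (G.filter fun x => x ∉ insert e I).card ≤ m → False := by
    intro m
    induction m with
    | zero =>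
      intro G hG heG _ hm
      rw [Nat.le_zero, Finset.card_eq_zero, Finset.filter_eq_empty_iff] at hm
      have := hind.2 G hG fun x hx => not_not.mp (hm hx)
      simp [this] at heG
    | succ m ih =>
      intro G hG heG hGX hm
      by_cases hempty : (G.filter fun x => x ∉ insert e I).card ≤ m
      · exact ih G hG heG hGX hempty
      obtain ⟨x, hx⟩ : (G.filter fun x => x ∉ insert e I).Nonempty := by
        rw [← Finset.card_pos]; omega
      rw [Finset.mem_filter] at hx
      have hxe : x ≠ e := fun h => hx.2 (h ▸ Set.mem_insert _ _)
      have hxI : x ∉ I := fun h => hx.2 (Set.mem_insert_of_mem _ h)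
      have hxX : x ∈ X := (hGX hx.1).resolve_left hxe
      have hxcl : x ∈ M.closure I := hI.subset_closure hxX
      have hdep : ¬ M.Indep (insert x I) :=
        ((hI.indep.mem_closure_iff_of_notMem hxI).mp hxcl).not_indep
      rw [vectorMatroid_indep] at hdep
      simp only [not_and, not_forall] at hdep
      obtain ⟨G', hG', hG'I, hne⟩ := hdep (Set.insert_subset (hX hxX) (hI.subset.trans hX))
      have hxG' : x ∈ G' := by
        by_contra hxG'
        exact hne (hI.indep.2 G' hG' fun y hy => (hG'I hy).resolve_left fun h => hxG' (h ▸ hy))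
      have heG' : e ∉ G' := fun h => (hG'I h).elim (fun h => hxe h.symm) heI
      obtain ⟨H, hH, heH, hxH, hHsub⟩ := h𝒱 G hG G' hG' x hx.1 hxG' e heG heG'
      have hH1 : (H : Set α) ⊆ insert e X := fun y hy => by
        rcases hHsub y hy with h | h
        · exact hGX h
        · rcases hG'I h with h | h
          · exact Or.inr (h ▸ hxX)
          · exact Or.inr (hI.subset h)
      have hlt : (H.filter fun x => x ∉ insert e I).card <
          (G.filter fun x => x ∉ insert e I).card := by
        refine Finset.card_lt_card (Finset.ssubset_iff_of_subset ?_ |>.mpr ⟨x, ?_, ?_⟩)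
        · intro y hy
          rw [Finset.mem_filter] at hy ⊢
          refine ⟨(hHsub y hy.1).resolve_right fun h => ?_, hy.2⟩
          rcases hG'I h with h | h
          · exact hxH (h ▸ hy.1)
          · exact hy.2 (Or.inr h)
        · exact Finset.mem_filter.mpr hx
        · exact fun h => hxH (Finset.mem_filter.mp h).1
      exact ih H hH heH hH1 (by omega)
  exact key _ G hG heG hGX le_rfl

theorem exists_vector_of_mem_closure (h𝒱 : IsVectorFamily 𝒱) {E : Finset α} {X : Set α}
    (hX : X ⊆ E) {e : α} (he : e ∈ (vectorMatroid h𝒱 E).closure X) (heX : e ∉ X) :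
    ∃ G ∈ 𝒱, e ∈ G ∧ (G : Set α) ⊆ insert e X := by
  set M := vectorMatroid h𝒱 E
  obtain ⟨I, hI⟩ := M.exists_isBasis X hX
  rw [← hI.closure_eq_closure] at he
  have heI : e ∉ I := fun h => heX (hI.subset h)
  have hdep : ¬ M.Indep (insert e I) :=
    ((hI.indep.mem_closure_iff_of_notMem heI).mp he).not_indep
  have heE : e ∈ (E : Set α) := M.mem_ground_of_mem_closure he
  rw [vectorMatroid_indep] at hdep
  simp only [not_and, not_forall] at hdep
  obtain ⟨G, hG, hGI, hne⟩ := hdep (Set.insert_subset heE (hI.subset.trans hX))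
  refine ⟨G, hG, ?_, hGI.trans (Set.insert_subset_insert hI.subset)⟩
  by_contra heG
  exact hne (hI.indep.2 G hG fun y hy => (hGI hy).resolve_left fun h => heG (h ▸ hy))

/-- The greedy basis for an injective order `κ`: the elements of `E` that are not the largest
element of a vector contained in `E` form a basis. -/
theorem isBase_of_not_leading {β : Type*} [LinearOrder β] {κ : α → β}
    (hκ : Function.Injective κ) (h𝒱 : IsVectorFamily 𝒱) (E : Finset α) :
    (vectorMatroid h𝒱 E).IsBase
      {e | e ∈ E ∧ ¬ ∃ G ∈ 𝒱, G ⊆ E ∧ e ∈ G ∧ ∀ x ∈ G, κ x ≤ κ e} := by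
  classical
  set M := vectorMatroid h𝒱 E
  set S : Set α := {e | e ∈ E ∧ ¬ ∃ G ∈ 𝒱, G ⊆ E ∧ e ∈ G ∧ ∀ x ∈ G, κ x ≤ κ e}
  have hSE : S ⊆ E := fun e he => he.1
  have hind : M.Indep S := by
    refine ⟨hSE, fun G hG hGS => ?_⟩
    by_contra hne
    obtain ⟨m, hm, hmax⟩ := G.exists_max_image κ (Finset.nonempty_iff_ne_empty.mpr hne)
    exact (hGS hm).2 ⟨G, hG, fun x hx => (hGS hx).1, hm, hmax⟩
  refine hind.isBase_of_ground_subset_closure ?_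
  intro e he
  by_contra hcl
  -- the smallest element of `E` outside the closure is the largest element of no vector
  obtain ⟨a, ha, hmin⟩ := (E.filter fun x => x ∉ M.closure S).exists_min_image κ
    ⟨e, Finset.mem_filter.mpr ⟨he, hcl⟩⟩
  obtain ⟨hm1, hm2⟩ := Finset.mem_filter.mp ha
  have hlow : ∀ x ∈ E, κ x < κ a → x ∈ M.closure S := fun x hx hxa => by
    by_contra h
    exact absurd (hmin x (Finset.mem_filter.mpr ⟨hx, h⟩)) (not_le.mpr hxa)
  have haS : a ∉ S := fun h => hm2 (M.mem_closure_of_mem h hSE)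
  have : ∃ G ∈ 𝒱, G ⊆ E ∧ a ∈ G ∧ ∀ x ∈ G, κ x ≤ κ a := by
    by_contra h
    exact haS ⟨hm1, h⟩
  obtain ⟨G, hG, hGE, haG, hGa⟩ := this
  have hX : {x | x ∈ E ∧ κ x < κ a} ⊆ (E : Set α) := fun x hx => hx.1
  have h1 := mem_closure_of_vector h𝒱 hX hm1 hG haG fun x hx =>
    (hGa x hx).eq_or_lt.imp (fun h => hκ h) fun h => ⟨hGE hx, h⟩
  have h2 : {x | x ∈ E ∧ κ x < κ a} ⊆ M.closure S := fun x hx => hlow x hx.1 hx.2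
  exact hm2 (M.closure_subset_closure_of_subset_closure h2 h1)

/-- Two matroids for which every basis of the first is a basis of the second have the same rank, so
an inclusion between their closure operators is an equality. -/
theorem Matroid.closure_subset_of_isBase_of_closure_le {M₁ M₂ : Matroid α} (hE : M₁.E = M₂.E)
    (hB : ∀ B, M₁.IsBase B → M₂.IsBase B)
    (hcl : ∀ X, M₁.closure X ⊆ M₂.closure X) {X : Set α} (hX : X ⊆ M₁.E) :
    M₂.closure X ⊆ M₁.closure X := by
  intro e he
  by_contra hne
  have heE : e ∈ M₁.E := hE ▸ M₂.mem_ground_of_mem_closure he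
  obtain ⟨I, hI⟩ := M₁.exists_isBasis X hX
  rw [← hI.closure_eq_closure] at hne
  have heI : e ∉ I := fun h => hne (M₁.mem_closure_of_mem h (hI.subset.trans hX))
  have hind : M₁.Indep (insert e I) := (hI.indep.notMem_closure_iff_of_notMem heI heE).mp hne
  obtain ⟨B, hB1, hIB⟩ := hind.exists_isBase_superset
  have hB2 := hB B hB1
  have heB : e ∈ B := hIB (Set.mem_insert _ _)
  refine hB2.indep.notMem_closure_sdiff_of_mem heB ?_
  have hXI : X ⊆ M₂.closure I := hI.subset_closure.trans (hcl I)
  refine M₂.closure_subset_closure_of_subset_closure (hXI.trans ?_) he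
  exact M₂.closure_subset_closure fun x hx =>
    ⟨hIB (Set.mem_insert_of_mem _ hx), fun h => heI (h ▸ hx)⟩

end VectorMatroid

/-! ### Coefficients, supports and initial forms -/

section Coefficients

variable {K : Subsemiring TropicalReal} {M : Type}

theorem tropCoeff_eq_top {f : TropPoly K M} {u : M} : tropCoeff f u = ⊤ ↔ f.coeff u = 0 := by
  unfold tropCoeff
  rw [Tropical.untrop_eq_iff_eq_trop, Tropical.trop_top]
  exact ZeroMemClass.coe_eq_zero

theorem mem_support_iff_tropCoeff {f : TropPoly K M} {u : M} :
    u ∈ f.coeff.support ↔ tropCoeff f u ≠ ⊤ := by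
  rw [Finsupp.mem_support_iff, ne_eq, ne_eq, tropCoeff_eq_top]

theorem tropCoeff_of_notMem {f : TropPoly K M} {u : M} (hu : u ∉ f.coeff.support) :
    tropCoeff f u = ⊤ :=
  not_not.mp fun h => hu (mem_support_iff_tropCoeff.mpr h)

theorem tropCoeff_add (f g : TropPoly K M) (u : M) :
    tropCoeff (f + g) u = min (tropCoeff f u) (tropCoeff g u) := rfl

theorem tropPoly_ext {f g : TropPoly K M} (h : ∀ u, tropCoeff f u = tropCoeff g u) : f = g := by
  ext u
  exact congrArg Tropical.trop (h u)

/-- The coefficient of `x^u` in `f` as a real number, with the junk value `0` outside the support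
of `f`; it makes the comparisons of terms accessible to linear arithmetic. -/
def realCoeff (f : TropPoly K M) (u : M) : ℝ := (tropCoeff f u).untopD 0

theorem coe_realCoeff {f : TropPoly K M} {u : M} (hu : u ∈ f.coeff.support) :
    (realCoeff f u : WithTop ℝ) = tropCoeff f u := by
  obtain ⟨r, hr⟩ := WithTop.ne_top_iff_exists.mp (mem_support_iff_tropCoeff.mp hu)
  rw [realCoeff, ← hr, WithTop.untopD_coe]

theorem support_add (f g : TropPoly K M) (u : M) :
    u ∈ (f + g).coeff.support ↔ u ∈ f.coeff.support ∨ u ∈ g.coeff.support := by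
  simp only [mem_support_iff_tropCoeff, tropCoeff_add, ne_eq, min_eq_top]
  tauto

theorem support_sum {ι : Type*} (s : Finset ι) (f : ι → TropPoly K M) (u : M) :
    u ∈ (∑ i ∈ s, f i).coeff.support ↔ ∃ i ∈ s, u ∈ (f i).coeff.support := by
  classical
  induction s using Finset.induction_on with
  | empty => simp
  | insert i s hi ih => rw [Finset.sum_insert hi, support_add, ih]; simp

theorem mem_minTerms {wt : M → ℝ} {f : TropPoly K M} {u : M} :
    u ∈ minTerms wt f ↔ u ∈ f.coeff.support ∧
      ∀ v ∈ f.coeff.support, realCoeff f u + wt u ≤ realCoeff f v + wt v := by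
  classical
  unfold minTerms
  rw [Finset.mem_filter]
  refine and_congr_right fun hu => ?_
  unfold tropEval
  constructor
  · intro h v hv
    have := h.trans_le (Finset.inf_le (f := fun u => tropCoeff f u + (wt u : WithTop ℝ)) hv)
    rw [← coe_realCoeff hu, ← coe_realCoeff hv] at this
    exact_mod_cast this
  · intro h
    refine le_antisymm (Finset.le_inf fun v hv => ?_) (Finset.inf_le hu)
    rw [← coe_realCoeff hu, ← coe_realCoeff hv]
    exact_mod_cast h v hv

theorem minTerms_subset (wt : M → ℝ) (f : TropPoly K M) : minTerms wt f ⊆ f.coeff.support :=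
  fun _ h => (mem_minTerms.mp h).1

theorem minTerms_nonempty (wt : M → ℝ) {f : TropPoly K M} {v : M} (hv : v ∈ f.coeff.support) :
    (minTerms wt f).Nonempty := by
  obtain ⟨u, hu, hmin⟩ := Finset.exists_min_image f.coeff.support (fun u => realCoeff f u + wt u)
    ⟨v, hv⟩
  exact ⟨u, mem_minTerms.mpr ⟨hu, hmin⟩⟩

theorem support_initialForm (wt : M → ℝ) (f : TropPoly K M) :
    (initialForm wt f).coeff.support = minTerms wt f := by
  classical
  ext u
  unfold initialForm
  rw [support_sum]
  simp only [AddMonoidAlgebra.coeff_single]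
  constructor
  · rintro ⟨i, hi, hu⟩
    rw [Finset.mem_singleton.mp (Finsupp.support_single_subset hu)]
    exact hi
  · intro h
    exact ⟨u, h, by simp⟩

theorem tropCoeff_boolean {F : TropPoly booleanSemiring M} {u : M}
    (hu : u ∈ F.coeff.support) : tropCoeff F u = 0 := by
  have h0 : F.coeff u ≠ 0 := Finsupp.mem_support_iff.mp hu
  unfold tropCoeff
  rcases (F.coeff u).2 with h | h
  · exact absurd (Subtype.ext h) h0
  · rw [Set.mem_singleton_iff.mp h]; rfl

theorem realCoeff_boolean (F : TropPoly booleanSemiring M) (u : M) : realCoeff F u = 0 := by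
  unfold realCoeff
  by_cases hu : u ∈ F.coeff.support
  · rw [tropCoeff_boolean hu]; rfl
  · rw [tropCoeff_of_notMem hu]; rfl

/-- A polynomial with Boolean coefficients is determined by its support. -/
theorem boolean_ext {F G : TropPoly booleanSemiring M}
    (h : ∀ u, u ∈ F.coeff.support ↔ u ∈ G.coeff.support) : F = G := by
  refine tropPoly_ext fun u => ?_
  by_cases hu : u ∈ F.coeff.support
  · rw [tropCoeff_boolean hu, tropCoeff_boolean ((h u).mp hu)]
  · have hu' := fun h' => hu ((h u).mpr h')
    rw [tropCoeff_of_notMem hu, tropCoeff_of_notMem hu']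

end Coefficients

section Monomials

variable {K : Subsemiring TropicalReal} {M : Type} [AddCommMonoid M]

theorem initialForm_mem {wt : M → ℝ} {I : Ideal (TropPoly K M)} {f : TropPoly K M} (hf : f ∈ I) :
    initialForm wt f ∈ initialIdealWt wt I := Ideal.subset_span ⟨f, hf, rfl⟩

variable [IsCancelAdd M]

theorem mem_support_single_mul (a : M) {c : K} (hc : c ≠ 0) (f : TropPoly K M) (v : M) :
    v ∈ (AddMonoidAlgebra.single a c * f).coeff.support ↔
      ∃ u ∈ f.coeff.support, v = a + u := by
  classical
  rw [AddMonoidAlgebra.support_coeff_single_mul_eq_image]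
  · simp [eq_comm]
  · intro y
    simp [hc]
  · exact IsAddLeftRegular.all a

theorem realCoeff_single_mul (a : M) {c : K} (hc : c ≠ 0) (f : TropPoly K M) {u : M}
    (hu : u ∈ f.coeff.support) :
    realCoeff (AddMonoidAlgebra.single a c * f) (a + u) =
      (Tropical.untrop (c : TropicalReal)).untopD 0 + realCoeff f u := by
  have hc' : Tropical.untrop (c : TropicalReal) ≠ ⊤ := by
    intro h
    rw [Tropical.untrop_eq_iff_eq_trop, Tropical.trop_top] at h
    exact hc (ZeroMemClass.coe_eq_zero.mp h)
  have h1 : tropCoeff (AddMonoidAlgebra.single a c * f) (a + u) =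
      Tropical.untrop (c : TropicalReal) + tropCoeff f u := by
    unfold tropCoeff
    rw [AddMonoidAlgebra.coeff_single_mul_add]
    rfl
  unfold realCoeff
  rw [h1]
  have h2 := mem_support_iff_tropCoeff.mp hu
  lift Tropical.untrop (c : TropicalReal) to ℝ using hc' with c'
  lift tropCoeff f u to ℝ using h2 with f'
  rfl

theorem mem_minTerms_single_mul {wt : M → ℝ} (hwt : ∀ u v, wt (u + v) = wt u + wt v) (a : M)
    {c : K} (hc : c ≠ 0) (f : TropPoly K M) (v : M) :
    v ∈ minTerms wt (AddMonoidAlgebra.single a c * f) ↔ ∃ u ∈ minTerms wt f, v = a + u := by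
  constructor
  · intro hv
    obtain ⟨hv1, hv2⟩ := mem_minTerms.mp hv
    obtain ⟨u, hu, rfl⟩ := (mem_support_single_mul a hc f v).mp hv1
    refine ⟨u, mem_minTerms.mpr ⟨hu, fun x hx => ?_⟩, rfl⟩
    have := hv2 (a + x) ((mem_support_single_mul a hc f _).mpr ⟨x, hx, rfl⟩)
    rw [realCoeff_single_mul a hc f hu, realCoeff_single_mul a hc f hx, hwt, hwt] at this
    linarith
  · rintro ⟨u, hu, rfl⟩
    obtain ⟨hu1, hu2⟩ := mem_minTerms.mp hu
    refine mem_minTerms.mpr ⟨(mem_support_single_mul a hc f _).mpr ⟨u, hu1, rfl⟩, fun y hy => ?_⟩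
    obtain ⟨x, hx, rfl⟩ := (mem_support_single_mul a hc f y).mp hy
    rw [realCoeff_single_mul a hc f hu1, realCoeff_single_mul a hc f hx, hwt, hwt]
    linarith [hu2 x hx]

/-- A polynomial lies in the initial ideal if and only if its support is a union of supports of
initial forms: products and sums of initial forms involve no cancellation. -/
theorem mem_initialIdealWt {wt : M → ℝ} (hwt : ∀ u v, wt (u + v) = wt u + wt v)
    {I : Ideal (TropPoly K M)} {F : TropPoly booleanSemiring M} :
    F ∈ initialIdealWt wt I ↔ ∀ e ∈ F.coeff.support, ∃ f ∈ I, e ∈ minTerms wt f ∧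
      minTerms wt f ⊆ F.coeff.support := by
  classical
  have hadd : ∀ F G : TropPoly booleanSemiring M,
      (∀ e ∈ F.coeff.support, ∃ f ∈ I, e ∈ minTerms wt f ∧ minTerms wt f ⊆ F.coeff.support) →
      (∀ e ∈ G.coeff.support, ∃ f ∈ I, e ∈ minTerms wt f ∧ minTerms wt f ⊆ G.coeff.support) →
      ∀ e ∈ (F + G).coeff.support, ∃ f ∈ I, e ∈ minTerms wt f ∧
        minTerms wt f ⊆ (F + G).coeff.support := by
    intro F G hF hG e he
    rcases (support_add F G e).mp he with h | h
    · obtain ⟨f, hf, h1, h2⟩ := hF e h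
      exact ⟨f, hf, h1, fun x hx => (support_add F G x).mpr (Or.inl (h2 hx))⟩
    · obtain ⟨f, hf, h1, h2⟩ := hG e h
      exact ⟨f, hf, h1, fun x hx => (support_add F G x).mpr (Or.inr (h2 hx))⟩
  constructor
  · intro hF
    unfold initialIdealWt at hF
    induction hF using Submodule.span_induction with
    | mem x hx =>
      obtain ⟨f, hf, rfl⟩ := hx
      intro e he
      rw [support_initialForm] at he ⊢
      exact ⟨f, hf, he, subset_rfl⟩
    | zero => simp
    | add F G _ _ hF hG => exact hadd F G hF hG
    | smul a F _ hF =>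
      rw [smul_eq_mul]
      induction a using AddMonoidAlgebra.induction_linear with
      | zero => simp
      | add a b ha hb => rw [add_mul]; exact hadd _ _ ha hb
      | single a c =>
        by_cases hc : c = 0
        · subst hc; simp
        intro e he
        obtain ⟨u, hu, rfl⟩ := (mem_support_single_mul a hc F e).mp he
        obtain ⟨f, hf, h1, h2⟩ := hF u hu
        refine ⟨AddMonoidAlgebra.single a 1 * f, I.mul_mem_left _ hf, ?_, ?_⟩
        · exact (mem_minTerms_single_mul hwt a one_ne_zero f _).mpr ⟨u, h1, rfl⟩
        · intro x hx
          obtain ⟨y, hy, rfl⟩ := (mem_minTerms_single_mul hwt a one_ne_zero f x).mp hx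
          exact (mem_support_single_mul a hc F _).mpr ⟨y, h2 hy, rfl⟩
  · intro h
    choose! f hf h1 h2 using h
    have : F = ∑ e ∈ F.coeff.support, initialForm wt (f e) := by
      refine boolean_ext fun u => ?_
      rw [support_sum]
      simp only [support_initialForm]
      exact ⟨fun hu => ⟨u, hu, h1 u hu⟩, fun ⟨e, he, hu⟩ => h2 e he hu⟩
    rw [this]
    exact Ideal.sum_mem _ fun e he => Ideal.subset_span ⟨f e, hf e he, rfl⟩

end Monomials

/-! ### Elimination, and initial ideals of tropical ideals -/

section Elimination

variable {K : Subsemiring TropicalReal} {M : Type}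

/-- `K` allows division by elements other than `∞`. This is the only property of `K` that is
needed; `ℝ ∪ {∞}` and the Boolean semiring both have it. -/
def IsDivisible (K : Subsemiring TropicalReal) : Prop :=
  ∀ a b : K, a ≠ 0 → b ≠ 0 → ∃ c : K, c ≠ 0 ∧ c * b = a

theorem isDivisible_top : IsDivisible ⊤ := by
  intro a b ha hb
  have key : ∀ x : (⊤ : Subsemiring TropicalReal), x ≠ 0 →
      ∃ r : ℝ, x = ⟨Tropical.trop (r : WithTop ℝ), trivial⟩ := by
    intro x hx
    have : Tropical.untrop (x : TropicalReal) ≠ ⊤ := by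
      intro h
      rw [Tropical.untrop_eq_iff_eq_trop, Tropical.trop_top] at h
      exact hx (ZeroMemClass.coe_eq_zero.mp h)
    obtain ⟨r, hr⟩ := WithTop.ne_top_iff_exists.mp this
    exact ⟨r, Subtype.ext (by rw [hr]; rfl)⟩
  obtain ⟨r, rfl⟩ := key a ha
  obtain ⟨s, rfl⟩ := key b hb
  refine ⟨⟨Tropical.trop ((r - s : ℝ) : WithTop ℝ), trivial⟩, ?_, ?_⟩
  · intro h
    exact Tropical.trop_coe_ne_zero (r - s) (congrArg Subtype.val h)
  · refine Subtype.ext ?_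
    change Tropical.trop (((r - s : ℝ) : WithTop ℝ) + (s : WithTop ℝ)) =
      Tropical.trop (r : WithTop ℝ)
    rw [← WithTop.coe_add, sub_add_cancel]

theorem booleanSemiring_eq_one {a : booleanSemiring} (ha : a ≠ 0) : a = 1 := by
  rcases a.2 with h | h
  · exact absurd (Subtype.ext h) ha
  · exact Subtype.ext h

theorem isDivisible_booleanSemiring : IsDivisible booleanSemiring := by
  intro a b ha hb
  rw [booleanSemiring_eq_one ha, booleanSemiring_eq_one hb]
  exact ⟨1, one_ne_zero, one_mul 1⟩

/-- The elimination axiom for two polynomials with a common monomial `x^u`, after shifting the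
coefficients of `g` by `c` to make the coefficients of `x^u` equal, and in terms of real
coefficients. -/
theorem IsTropicalIdeal.exists_eliminate [AddCommMonoid M] [IsCancelAdd M] (hK : IsDivisible K)
    {I : Ideal (TropPoly K M)} (hI : IsTropicalIdeal I) {f g : TropPoly K M} (hf : f ∈ I)
    (hg : g ∈ I) {u : M} (huf : u ∈ f.coeff.support) (hug : u ∈ g.coeff.support) :
    ∃ h ∈ I, ∃ c : ℝ, realCoeff f u = c + realCoeff g u ∧ u ∉ h.coeff.support ∧
      (∀ v ∈ h.coeff.support, (v ∈ f.coeff.support ∧ realCoeff f v ≤ realCoeff h v) ∨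
        (v ∈ g.coeff.support ∧ c + realCoeff g v ≤ realCoeff h v)) ∧
      (∀ v ∈ f.coeff.support, (v ∈ g.coeff.support → realCoeff f v < c + realCoeff g v) →
        v ∈ h.coeff.support ∧ realCoeff h v = realCoeff f v) := by
  obtain ⟨c, hc, hcab⟩ := hK (f.coeff u) (g.coeff u) (Finsupp.mem_support_iff.mp huf)
    (Finsupp.mem_support_iff.mp hug)
  set g' : TropPoly K M := AddMonoidAlgebra.single 0 c * g with hg'
  have hsupp : ∀ v, v ∈ g'.coeff.support ↔ v ∈ g.coeff.support := fun v => by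
    rw [hg', mem_support_single_mul 0 hc g v]
    simp
  set r : ℝ := (Tropical.untrop (c : TropicalReal)).untopD 0
  have hcoef : ∀ v ∈ g.coeff.support, realCoeff g' v = r + realCoeff g v := fun v hv => by
    have := realCoeff_single_mul 0 hc g hv
    rwa [zero_add] at this
  have hu : tropCoeff f u = tropCoeff g' u := by
    unfold tropCoeff
    rw [hg', ← hcab]
    have := AddMonoidAlgebra.coeff_single_mul_add g c 0 u
    rw [zero_add] at this
    rw [this]
  obtain ⟨h, hh, huh, hmin⟩ := hI f hf g' (I.mul_mem_left _ hg) u hu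
    (mem_support_iff_tropCoeff.mp huf)
  have hle : ∀ v, v ∈ h.coeff.support ↔ tropCoeff h v ≠ ⊤ := fun v => mem_support_iff_tropCoeff
  have hstrict : ∀ (p q : TropPoly K M) (v : M), v ∈ p.coeff.support →
      (v ∈ q.coeff.support → realCoeff p v < realCoeff q v) → tropCoeff p v < tropCoeff q v := by
    intro p q v hp hpq
    by_cases hq : v ∈ q.coeff.support
    · rw [← coe_realCoeff hp, ← coe_realCoeff hq]
      exact_mod_cast hpq hq
    · rw [tropCoeff_of_notMem hq]
      exact lt_top_iff_ne_top.mpr (mem_support_iff_tropCoeff.mp hp)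
  have heq : ∀ (p : TropPoly K M) (v : M), v ∈ p.coeff.support → tropCoeff h v = tropCoeff p v →
      v ∈ h.coeff.support ∧ realCoeff h v = realCoeff p v := by
    intro p v hp he
    refine ⟨?_, by unfold realCoeff; rw [he]⟩
    rw [hle, he]
    exact mem_support_iff_tropCoeff.mp hp
  refine ⟨h, hh, r, ?_, ?_, ?_, ?_⟩
  · rw [← hcoef u hug]
    unfold realCoeff
    rw [hu]
  · rw [hle, not_not]; exact huh
  · intro v hv
    have h1 := (hmin v).1
    rw [min_le_iff] at h1
    have hgen : ∀ p : TropPoly K M, tropCoeff p v ≤ tropCoeff h v →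
        v ∈ p.coeff.support ∧ realCoeff p v ≤ realCoeff h v := by
      intro p hp
      have hvp : v ∈ p.coeff.support := by
        rw [mem_support_iff_tropCoeff]
        exact ne_top_of_le_ne_top ((hle v).mp hv) hp
      refine ⟨hvp, ?_⟩
      rw [← coe_realCoeff hvp, ← coe_realCoeff hv] at hp
      exact_mod_cast hp
    rcases h1 with h1 | h1
    · exact Or.inl (hgen f h1)
    · obtain ⟨h2, h3⟩ := hgen g' h1
      have h4 := (hsupp v).mp h2
      rw [hcoef v h4] at h3
      exact Or.inr ⟨h4, h3⟩
  · intro v hv hlt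
    have := hstrict f g' v hv fun h' => by
      have h4 := (hsupp v).mp h'
      rw [hcoef v h4]
      exact hlt h4
    refine heq f v hv ?_
    rw [(hmin v).2 this.ne, min_eq_left this.le]

end Elimination

section InitialTropical

variable {K : Subsemiring TropicalReal} {M : Type}

/-- The supports of the elements of an ideal. -/
def supports [AddCommMonoid M] (L : Ideal (TropPoly K M)) : Set (Finset M) :=
  {s | ∃ f ∈ L, f.coeff.support = s}

theorem IsTropicalIdeal.isVectorFamily [AddCommMonoid M] [IsCancelAdd M] (hK : IsDivisible K)
    {L : Ideal (TropPoly K M)} (hL : IsTropicalIdeal L) : IsVectorFamily (supports L) := by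
  rintro _ ⟨f, hf, rfl⟩ _ ⟨g, hg, rfl⟩ u huf hug v hvf hvg
  obtain ⟨h, hh, c, -, huh, hsub, hf'⟩ := hL.exists_eliminate hK hf hg huf hug
  exact ⟨_, ⟨h, hh, rfl⟩, (hf' v hvf fun h => absurd h hvg).1, huh,
    fun x hx => (hsub x hx).imp And.left And.left⟩

variable [AddCommMonoid M] [IsCancelAdd M]

/-- Elimination in the initial ideal, one monomial `v` at a time: `u` is eliminated from `F` and `G`
by an initial form that contains `v`. -/
theorem IsTropicalIdeal.exists_minTerms (hK : IsDivisible K) {wt : M → ℝ}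
    (hwt : ∀ u v, wt (u + v) = wt u + wt v) {L : Ideal (TropPoly K M)} (hL : IsTropicalIdeal L)
    {F G : TropPoly booleanSemiring M} (hF : F ∈ initialIdealWt wt L)
    (hG : G ∈ initialIdealWt wt L) {u v : M}
    (huG : u ∈ G.coeff.support) (hvF : v ∈ F.coeff.support) (hvG : v ∉ G.coeff.support) :
    ∃ h ∈ L, v ∈ minTerms wt h ∧ u ∉ minTerms wt h ∧
      ∀ x ∈ minTerms wt h, x ∈ F.coeff.support ∨ x ∈ G.coeff.support := by
  obtain ⟨f, hf, hvf, hfF⟩ := (mem_initialIdealWt hwt).mp hF v hvF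
  by_cases huf : u ∈ minTerms wt f
  · obtain ⟨g, hg, hug, hgG⟩ := (mem_initialIdealWt hwt).mp hG u huG
    obtain ⟨huf1, huf2⟩ := mem_minTerms.mp huf
    obtain ⟨hug1, hug2⟩ := mem_minTerms.mp hug
    obtain ⟨hvf1, hvf2⟩ := mem_minTerms.mp hvf
    obtain ⟨h, hh, c, hc, huh, hsub, hf'⟩ := hL.exists_eliminate hK hf hg huf1 hug1
    have e1 : realCoeff f u + wt u = realCoeff f v + wt v :=
      le_antisymm (huf2 v hvf1) (hvf2 u huf1)
    obtain ⟨hvh, hvh'⟩ := hf' v hvf1 fun hvg => by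
      by_contra hcon
      refine hvG (hgG (mem_minTerms.mpr ⟨hvg, fun x hx => ?_⟩))
      linarith [hug2 x hx]
    refine ⟨h, hh, mem_minTerms.mpr ⟨hvh, fun x hx => ?_⟩, fun hu => huh (minTerms_subset _ _ hu),
      fun x hx => ?_⟩
    · rcases hsub x hx with ⟨h1, h2⟩ | ⟨h1, h2⟩
      · linarith [hvf2 x h1]
      · linarith [hug2 x h1]
    · obtain ⟨hx1, hx2⟩ := mem_minTerms.mp hx
      have hxv := hx2 v hvh
      rcases hsub x hx1 with ⟨h1, h2⟩ | ⟨h1, h2⟩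
      · refine Or.inl (hfF (mem_minTerms.mpr ⟨h1, fun y hy => ?_⟩))
        linarith [hvf2 y hy]
      · refine Or.inr (hgG (mem_minTerms.mpr ⟨h1, fun y hy => ?_⟩))
        linarith [hug2 y hy]
  · exact ⟨f, hf, hvf, huf, fun x hx => Or.inl (hfF hx)⟩

/-- The initial ideal of a tropical ideal is a tropical ideal: adding the polynomials of
`IsTropicalIdeal.exists_minTerms` over all monomials to be kept yields the required element. -/
theorem IsTropicalIdeal.initialIdealWt (hK : IsDivisible K) {wt : M → ℝ}
    (hwt : ∀ u v, wt (u + v) = wt u + wt v) {L : Ideal (TropPoly K M)} (hL : IsTropicalIdeal L) :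
    IsTropicalIdeal (initialIdealWt wt L) := by
  classical
  intro F hF G hG u huFG huF
  have huF' : u ∈ F.coeff.support := mem_support_iff_tropCoeff.mpr huF
  have huG' : u ∈ G.coeff.support := mem_support_iff_tropCoeff.mpr (huFG ▸ huF)
  have h1 : ∀ v : M, ∃ h ∈ L, (v ∈ F.coeff.support → v ∉ G.coeff.support → v ∈ minTerms wt h) ∧
      u ∉ minTerms wt h ∧ ∀ x ∈ minTerms wt h, x ∈ F.coeff.support ∨ x ∈ G.coeff.support := by
    intro v
    by_cases hv : v ∈ F.coeff.support ∧ v ∉ G.coeff.support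
    · obtain ⟨h, hh, h1, h2⟩ := hL.exists_minTerms hK hwt hF hG huG' hv.1 hv.2
      exact ⟨h, hh, fun _ _ => h1, h2⟩
    · exact ⟨0, zero_mem _, fun a b => absurd ⟨a, b⟩ hv, by simp [minTerms], by simp [minTerms]⟩
  have h2 : ∀ v : M, ∃ h ∈ L, (v ∈ G.coeff.support → v ∉ F.coeff.support → v ∈ minTerms wt h) ∧
      u ∉ minTerms wt h ∧ ∀ x ∈ minTerms wt h, x ∈ F.coeff.support ∨ x ∈ G.coeff.support := by
    intro v
    by_cases hv : v ∈ G.coeff.support ∧ v ∉ F.coeff.support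
    · obtain ⟨h, hh, h1, h2, h3⟩ := hL.exists_minTerms hK hwt hG hF huF' hv.1 hv.2
      exact ⟨h, hh, fun _ _ => h1, h2, fun x hx => (h3 x hx).symm⟩
    · exact ⟨0, zero_mem _, fun a b => absurd ⟨a, b⟩ hv, by simp [minTerms], by simp [minTerms]⟩
  choose p hp hp1 hp2 hp3 using h1
  choose q hq hq1 hq2 hq3 using h2
  set H : TropPoly booleanSemiring M := ∑ v ∈ F.coeff.support, initialForm wt (p v) +
    ∑ v ∈ G.coeff.support, initialForm wt (q v) with hHdef
  have hH : ∀ x, x ∈ H.coeff.support ↔ (∃ v ∈ F.coeff.support, x ∈ minTerms wt (p v)) ∨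
      ∃ v ∈ G.coeff.support, x ∈ minTerms wt (q v) := by
    intro x
    rw [hHdef, support_add, support_sum, support_sum]
    simp only [support_initialForm]
  have hHsub : ∀ x ∈ H.coeff.support, x ∈ F.coeff.support ∨ x ∈ G.coeff.support := by
    intro x hx
    rcases (hH x).mp hx with ⟨v, _, h⟩ | ⟨v, _, h⟩
    · exact hp3 v x h
    · exact hq3 v x h
  refine ⟨H, ?_, tropCoeff_of_notMem fun hu => ?_, fun v => ⟨?_, fun hne => ?_⟩⟩
  · exact add_mem (Ideal.sum_mem _ fun v _ => initialForm_mem (hp v))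
      (Ideal.sum_mem _ fun v _ => initialForm_mem (hq v))
  · rcases (hH u).mp hu with ⟨v, _, h⟩ | ⟨v, _, h⟩
    · exact hp2 v h
    · exact hq2 v h
  · by_cases hv : v ∈ H.coeff.support
    · rw [tropCoeff_boolean hv]
      rcases hHsub v hv with h | h
      · exact (min_le_left _ _).trans (tropCoeff_boolean h).le
      · exact (min_le_right _ _).trans (tropCoeff_boolean h).le
    · rw [tropCoeff_of_notMem hv]; exact le_top
  · by_cases hvF : v ∈ F.coeff.support <;> by_cases hvG : v ∈ G.coeff.support
    · exact absurd ((tropCoeff_boolean hvF).trans (tropCoeff_boolean hvG).symm) hne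
    · rw [tropCoeff_boolean hvF, tropCoeff_of_notMem hvG, min_eq_left le_top]
      exact tropCoeff_boolean ((hH v).mpr (Or.inl ⟨v, hvF, hp1 v hvF hvG⟩))
    · rw [tropCoeff_boolean hvG, tropCoeff_of_notMem hvF, min_eq_right le_top]
      exact tropCoeff_boolean ((hH v).mpr (Or.inr ⟨v, hvG, hq1 v hvG hvF⟩))
    · exact absurd ((tropCoeff_of_notMem hvF).trans (tropCoeff_of_notMem hvG).symm) hne

end InitialTropical

/-! ### Restriction to a set of monomials -/

section Restriction

variable {K : Subsemiring TropicalReal} {M : Type}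

open Classical in
/-- The part of a polynomial with exponents in `E`. -/
def restrictTo (E : Set M) (f : TropPoly K M) : TropPoly K M :=
  AddMonoidAlgebra.ofCoeff (f.coeff.filter (· ∈ E))

theorem mem_support_restrictTo {E : Set M} {f : TropPoly K M} {u : M} :
    u ∈ (restrictTo E f).coeff.support ↔ u ∈ f.coeff.support ∧ u ∈ E := by
  classical
  unfold restrictTo
  rw [AddMonoidAlgebra.coeff_ofCoeff, Finsupp.support_filter, Finset.mem_filter]

theorem coeff_restrictTo_of_mem {E : Set M} (f : TropPoly K M) {u : M} (hu : u ∈ E) :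
    (restrictTo E f).coeff u = f.coeff u := by
  classical
  exact Finsupp.filter_apply_pos _ _ hu

theorem coeff_restrictTo_of_notMem {E : Set M} (f : TropPoly K M) {u : M} (hu : u ∉ E) :
    (restrictTo E f).coeff u = 0 := by
  classical
  exact Finsupp.filter_apply_neg _ _ hu

theorem realCoeff_restrictTo {E : Set M} (f : TropPoly K M) {u : M} (hu : u ∈ E) :
    realCoeff (restrictTo E f) u = realCoeff f u := by
  unfold realCoeff tropCoeff
  rw [coeff_restrictTo_of_mem f hu]

/-- If the initial form of `f` involves `E` at all, then the part of it with exponents in `E` is the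
initial form of the part of `f`. -/
theorem minTerms_restrictTo {E : Set M} {wt : M → ℝ} {f : TropPoly K M} {e : M} (he : e ∈ E)
    (hef : e ∈ minTerms wt f) :
    e ∈ minTerms wt (restrictTo E f) ∧
      ∀ x ∈ minTerms wt (restrictTo E f), x ∈ minTerms wt f ∧ x ∈ E := by
  obtain ⟨h1, h2⟩ := mem_minTerms.mp hef
  have he' : e ∈ (restrictTo E f).coeff.support := mem_support_restrictTo.mpr ⟨h1, he⟩
  refine ⟨mem_minTerms.mpr ⟨he', fun v hv => ?_⟩, fun x hx => ?_⟩
  · obtain ⟨hv1, hv2⟩ := mem_support_restrictTo.mp hv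
    rw [realCoeff_restrictTo f he, realCoeff_restrictTo f hv2]
    exact h2 v hv1
  · obtain ⟨hx1, hx2⟩ := mem_minTerms.mp hx
    obtain ⟨hx3, hx4⟩ := mem_support_restrictTo.mp hx1
    refine ⟨mem_minTerms.mpr ⟨hx3, fun v hv => ?_⟩, hx4⟩
    have := hx2 e he'
    rw [realCoeff_restrictTo f he, realCoeff_restrictTo f hx4] at this
    exact this.trans (h2 v hv)

/-- An ideal is restrictable to `E` if it contains with a polynomial also its part with exponents in
`E`. For a homogeneous ideal this holds for the sets of all monomials of a given degree. -/
def IsRestrictable [AddCommMonoid M] (L : Ideal (TropPoly K M)) (E : Set M) : Prop :=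
  ∀ f ∈ L, restrictTo E f ∈ L

theorem IsRestrictable.initialIdealWt [AddCommMonoid M] [IsCancelAdd M] {wt : M → ℝ}
    (hwt : ∀ u v, wt (u + v) = wt u + wt v) {L : Ideal (TropPoly K M)} {E : Set M}
    (hL : IsRestrictable L E) : IsRestrictable (initialIdealWt wt L) E := by
  intro F hF
  rw [mem_initialIdealWt hwt] at hF ⊢
  intro e he
  obtain ⟨he1, he2⟩ := mem_support_restrictTo.mp he
  obtain ⟨f, hf, hef, hfF⟩ := hF e he1
  obtain ⟨h1, h2⟩ := minTerms_restrictTo he2 hef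
  exact ⟨_, hL f hf, h1, fun x hx => mem_support_restrictTo.mpr
    ⟨hfF (h2 x hx).1, (h2 x hx).2⟩⟩

end Restriction

/-! ### The matroid of an ideal and its initial matroids -/

section IdealMatroid

variable {K : Subsemiring TropicalReal} {M : Type} [AddCommMonoid M]

theorem minTerms_convex {wt₀ wt₁ : M →+ ℝ} {s : ℝ} (hs0 : 0 ≤ s) (hs1 : s ≤ 1)
    {wts : M →+ ℝ} (hwts : ∀ u, wts u = (1 - s) * wt₀ u + s * wt₁ u) {f : TropPoly K M} {e : M}
    (h0 : e ∈ minTerms wt₀ f) (h1 : e ∈ minTerms wt₁ f) : e ∈ minTerms wts f := by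
  obtain ⟨he, h0⟩ := mem_minTerms.mp h0
  obtain ⟨-, h1⟩ := mem_minTerms.mp h1
  refine mem_minTerms.mpr ⟨he, fun v hv => ?_⟩
  rw [hwts, hwts]
  nlinarith [mul_le_mul_of_nonneg_left (h0 v hv) (sub_nonneg.mpr hs1),
    mul_le_mul_of_nonneg_left (h1 v hv) hs0]

variable [IsCancelAdd M]

/-- The matroid on a finite set `E` of monomials whose independent sets contain the support of no
nonzero polynomial of the ideal. -/
def IsTropicalIdeal.matroid (hK : IsDivisible K) {L : Ideal (TropPoly K M)}
    (hL : IsTropicalIdeal L) (E : Finset M) : Matroid M :=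
  vectorMatroid (hL.isVectorFamily hK) E

/-- The matroid of the initial ideal with respect to `wt`. -/
def IsTropicalIdeal.initialMatroid (hK : IsDivisible K) {L : Ideal (TropPoly K M)}
    (hL : IsTropicalIdeal L) (E : Finset M) (wt : M →+ ℝ) : Matroid M :=
  (hL.initialIdealWt hK (map_add wt)).matroid isDivisible_booleanSemiring E

variable (hK : IsDivisible K) {L : Ideal (TropPoly K M)} (hL : IsTropicalIdeal L) {E : Finset M}
  {wt : M →+ ℝ}

@[simp] theorem IsTropicalIdeal.initialMatroid_ground : (hL.initialMatroid hK E wt).E = E := rfl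

/-- Gaussian elimination for a diagonally dominant system: let each `f e`, for `e` in `T`, have `e`
as the only monomial of `T` in its initial form. Then the other monomials of `S` can be removed from
the `f e` one after the other. Because of the dominance, the shift that cancels `a` in `f e` by
means of `f a` moves the terms of `f a` strictly above the leading term `e`, so that it survives. -/
theorem IsTropicalIdeal.exists_diagonal (hK : IsDivisible K) {L : Ideal (TropPoly K M)}
    (hL : IsTropicalIdeal L) {E : Finset M} {wt : M →+ ℝ} (T S : Finset M) (hS : S ⊆ T)
    (f : M → TropPoly K M)
    (hf : ∀ e ∈ T, f e ∈ L ∧ (f e).coeff.support ⊆ E ∧ e ∈ minTerms wt (f e) ∧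
      ∀ x ∈ T, x ≠ e → x ∉ minTerms wt (f e)) :
    ∃ g : M → TropPoly K M, ∀ e ∈ T, g e ∈ L ∧ (g e).coeff.support ⊆ E ∧
      e ∈ minTerms wt (g e) ∧ (∀ x ∈ T, x ≠ e → x ∉ minTerms wt (g e)) ∧
      ∀ x ∈ S, x ≠ e → x ∉ (g e).coeff.support := by
  classical
  induction S using Finset.induction_on with
  | empty => exact ⟨f, fun e he => ⟨(hf e he).1, (hf e he).2.1, (hf e he).2.2.1, (hf e he).2.2.2,
      by simp⟩⟩
  | insert a S haS ih =>
    obtain ⟨g, hg⟩ := ih ((Finset.subset_insert a S).trans hS)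
    have haT : a ∈ T := hS (Finset.mem_insert_self a S)
    have step : ∀ e, ∃ h : TropPoly K M, e ∈ T → h ∈ L ∧ h.coeff.support ⊆ E ∧
        e ∈ minTerms wt h ∧ (∀ x ∈ T, x ≠ e → x ∉ minTerms wt h) ∧
        ∀ x ∈ insert a S, x ≠ e → x ∉ h.coeff.support := by
      intro e
      by_cases he : e ∈ T
      swap
      · exact ⟨0, fun h => absurd h he⟩
      obtain ⟨h1, h2, h3, h4, h5⟩ := hg e he
      by_cases hae : a ≠ e ∧ a ∈ (g e).coeff.support
      · obtain ⟨hae, hag⟩ := hae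
        obtain ⟨a1, a2, a3, a4, a5⟩ := hg a haT
        obtain ⟨ha6, ha7⟩ := mem_minTerms.mp a3
        obtain ⟨he6, he7⟩ := mem_minTerms.mp h3
        obtain ⟨h, hh, c, hc, hah, hsub, hfst⟩ := hL.exists_eliminate hK h1 a1 hag ha6
        have hlt : ∀ e' ∈ T, ∀ x ∈ T, x ≠ e' → x ∈ (g e').coeff.support →
            realCoeff (g e') e' + wt e' < realCoeff (g e') x + wt x := by
          intro e' he' x hxT hxe hx
          obtain ⟨k1, k2⟩ := mem_minTerms.mp (hg e' he').2.2.1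
          by_contra hcon
          refine (hg e' he').2.2.2.1 x hxT hxe (mem_minTerms.mpr ⟨hx, fun y hy => ?_⟩)
          linarith [k2 y hy]
        have hlta := hlt e he a haT hae hag
        obtain ⟨heh, heh'⟩ := hfst e he6 fun heg => by
          linarith [hlt a haT e he hae.symm heg]
        refine ⟨h, fun _ => ⟨hh, fun x hx => ?_, mem_minTerms.mpr ⟨heh, fun x hx => ?_⟩,
          fun x hxT hxe hx => ?_, fun x hx hxe hxh => ?_⟩⟩
        · exact (hsub x hx).elim (fun h => h2 h.1) (fun h => a2 h.1)
        · rcases hsub x hx with ⟨k1, k2⟩ | ⟨k1, k2⟩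
          · linarith [he7 x k1]
          · linarith [ha7 x k1]
        · obtain ⟨hx1, hx2⟩ := mem_minTerms.mp hx
          have := hx2 e heh
          rcases hsub x hx1 with ⟨k1, k2⟩ | ⟨k1, k2⟩
          · linarith [hlt e he x hxT hxe k1]
          · linarith [ha7 x k1]
        · rcases Finset.mem_insert.mp hx with rfl | hxS
          · exact hah hxh
          · have hxa : x ≠ a := fun h => haS (h ▸ hxS)
            exact (hsub x hxh).elim (fun h => h5 x hxS hxe h.1) (fun h => a5 x hxS hxa h.1)
      · refine ⟨g e, fun _ => ⟨h1, h2, h3, h4, fun x hx hxe hxg => ?_⟩⟩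
        rcases Finset.mem_insert.mp hx with rfl | hxS
        · exact hae ⟨hxe, hxg⟩
        · exact h5 x hxS hxe hxg
    choose h hh using step
    exact ⟨h, hh⟩

/-- Passing to the initial ideal does not change the rank. -/
theorem IsTropicalIdeal.isBase_of_initialMatroid (hE : IsRestrictable L (E : Set M)) {B : Set M}
    (hB : (hL.initialMatroid hK E wt).IsBase B) : (hL.matroid hK E).IsBase B := by
  classical
  have hBE : B ⊆ E := hB.subset_ground
  have hind : (hL.matroid hK E).Indep B := by
    refine ⟨hBE, ?_⟩
    rintro _ ⟨f, hf, rfl⟩ hfB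
    have h1 := hB.indep.2 (minTerms wt f) ⟨_, initialForm_mem hf, support_initialForm _ _⟩
      fun x hx => hfB (minTerms_subset _ _ hx)
    by_contra hne
    obtain ⟨v, hv⟩ := Finset.nonempty_iff_ne_empty.mpr hne
    exact (minTerms_nonempty wt hv).ne_empty h1
  refine hind.isBase_of_ground_subset_closure ?_
  -- lift the fundamental circuits of the initial matroid; their supports may be larger than these
  -- circuits, which the elimination repairs
  have hex : ∀ e, ∃ f : TropPoly K M, e ∈ (E.filter fun x => x ∉ B) → f ∈ L ∧
      f.coeff.support ⊆ E ∧ e ∈ minTerms wt f ∧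
      ∀ x ∈ (E.filter fun x => x ∉ B), x ≠ e → x ∉ minTerms wt f := by
    intro e
    by_cases he : e ∈ E.filter fun x => x ∉ B
    swap
    · exact ⟨0, fun h => absurd h he⟩
    obtain ⟨heE, heB⟩ := Finset.mem_filter.mp he
    have hcl : e ∈ (hL.initialMatroid hK E wt).closure B := by rw [hB.closure_eq]; exact heE
    obtain ⟨_, ⟨F, hF, rfl⟩, heF, hFB⟩ := exists_vector_of_mem_closure
      ((hL.initialIdealWt hK (map_add wt)).isVectorFamily isDivisible_booleanSemiring) hBE hcl heB
    obtain ⟨f, hf, hef, hfF⟩ := (mem_initialIdealWt (map_add wt)).mp hF e heF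
    obtain ⟨h1, h2⟩ := minTerms_restrictTo (E := (E : Set M)) heE hef
    refine ⟨_, fun _ => ⟨hE f hf, fun x hx => (mem_support_restrictTo.mp hx).2, h1,
      fun x hx hxe hxm => ?_⟩⟩
    exact (hFB (hfF (h2 x hxm).1)).elim hxe (Finset.mem_filter.mp hx).2
  choose f hf using hex
  obtain ⟨g, hg⟩ := hL.exists_diagonal hK (wt := wt) _ _ subset_rfl f hf
  intro e heE
  by_cases heB : e ∈ B
  · exact (hL.matroid hK E).mem_closure_of_mem heB hBE
  obtain ⟨h1, h2, h3, -, h5⟩ := hg e (Finset.mem_filter.mpr ⟨heE, heB⟩)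
  refine mem_closure_of_vector _ hBE heE ⟨_, h1, rfl⟩ (minTerms_subset _ _ h3) fun x hx => ?_
  by_contra hcon
  rw [Set.mem_insert_iff, not_or] at hcon
  exact h5 x (Finset.mem_filter.mpr ⟨h2 hx, hcon.2⟩) hcon.1 hx

theorem IsTropicalIdeal.mem_closure_of_mem_minTerms {X : Set M} (hX : X ⊆ E) {f : TropPoly K M}
    (hf : f ∈ L) {e : M} (he : e ∈ E) (hef : e ∈ minTerms wt f)
    (hfX : (minTerms wt f : Set M) ⊆ insert e X) :
    e ∈ (hL.initialMatroid hK E wt).closure X :=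
  mem_closure_of_vector
    ((hL.initialIdealWt hK (map_add wt)).isVectorFamily isDivisible_booleanSemiring) hX he
    ⟨_, initialForm_mem hf, support_initialForm _ _⟩ hef hfX

theorem IsTropicalIdeal.isBase_of_closure_eq (hE : IsRestrictable L (E : Set M)) {B : Set M}
    (hB : (hL.matroid hK E).IsBase B) (hcl : (E : Set M) ⊆ (hL.initialMatroid hK E wt).closure B) :
    (hL.initialMatroid hK E wt).IsBase B := by
  have hsp : (hL.initialMatroid hK E wt).Spanning B :=
    (Matroid.spanning_iff_ground_subset_closure
      (M := hL.initialMatroid hK E wt) hB.subset_ground).mpr hcl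
  obtain ⟨B', hB', hsub⟩ := hsp.exists_isBase_subset
  rwa [← (hL.isBase_of_initialMatroid hK hE hB').eq_of_subset_isBase hB hsub]

theorem IsTropicalIdeal.exists_fundamental {B : Set M} (hB : (hL.matroid hK E).IsBase B) {e : M}
    (he : e ∈ E) (heB : e ∉ B) :
    ∃ f ∈ L, e ∈ f.coeff.support ∧ (f.coeff.support : Set M) ⊆ insert e B := by
  have hcl : e ∈ (hL.matroid hK E).closure B := by rw [hB.closure_eq]; exact he
  obtain ⟨_, ⟨f, hf, rfl⟩, h1, h2⟩ := exists_vector_of_mem_closure _ hB.subset_ground hcl heB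
  exact ⟨f, hf, h1, h2⟩

/-- A fundamental circuit with respect to a basis of the initial matroid has the element outside the
basis in its initial form, as the basis contains no nonempty vector. -/
theorem IsTropicalIdeal.mem_minTerms_of_isBase {B : Set M}
    (hB : (hL.initialMatroid hK E wt).IsBase B) {e : M} {f : TropPoly K M} (hf : f ∈ L)
    (hef : e ∈ f.coeff.support) (hfB : (f.coeff.support : Set M) ⊆ insert e B) :
    e ∈ minTerms wt f := by
  by_contra hcon
  refine (minTerms_nonempty wt hef).ne_empty (hB.indep.2 _
    ⟨_, initialForm_mem hf, support_initialForm _ _⟩ fun x hx => ?_)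
  exact (hfB (minTerms_subset _ _ hx)).resolve_left fun h => hcon (h ▸ hx)

/-- Converse to `IsTropicalIdeal.mem_minTerms_of_isBase`: bases of the initial matroid are
recognized by the initial forms of their fundamental circuits. -/
theorem IsTropicalIdeal.isBase_of_fundamental (hE : IsRestrictable L (E : Set M)) {B : Set M}
    (hB : (hL.matroid hK E).IsBase B)
    (h : ∀ e ∈ E, e ∉ B → ∃ f ∈ L, (f.coeff.support : Set M) ⊆ insert e B ∧ e ∈ minTerms wt f) :
    (hL.initialMatroid hK E wt).IsBase B := by
  refine hL.isBase_of_closure_eq hK hE hB fun e he => ?_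
  by_cases heB : e ∈ B
  · exact (hL.initialMatroid hK E wt).mem_closure_of_mem heB hB.subset_ground
  obtain ⟨f, hf, hfB, hef⟩ := h e he heB
  exact hL.mem_closure_of_mem_minTerms hK hB.subset_ground hf he hef
    fun x hx => hfB (minTerms_subset _ _ hx)

theorem IsTropicalIdeal.mem_minTerms_of_exchange {B : Set M} {b e : M}
    (hB' : (hL.initialMatroid hK E wt).IsBase (insert e (B \ {b})))
    {f : TropPoly K M} (hf : f ∈ L)
    (hef : e ∈ f.coeff.support) (hfB : (f.coeff.support : Set M) ⊆ insert e B) :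
    b ∈ minTerms wt f := by
  by_contra hcon
  refine (minTerms_nonempty wt hef).ne_empty (hB'.indep.2 _
    ⟨_, initialForm_mem hf, support_initialForm _ _⟩ fun x hx => ?_)
  rcases hfB (minTerms_subset _ _ hx) with h | h
  · exact Or.inl h
  · exact Or.inr ⟨h, fun h' => hcon (h' ▸ hx)⟩

theorem IsTropicalIdeal.isBase_exchange {B : Set M} {b e : M} (he : e ∈ E)
    (hb : b ∈ B) (hB : (hL.initialMatroid hK E wt).IsBase B)
    {f : TropPoly K M} (hf : f ∈ L) (hfB : (f.coeff.support : Set M) ⊆ insert e B)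
    (hbf : b ∈ minTerms wt f) :
    (hL.initialMatroid hK E wt).IsBase (insert e (B \ {b})) := by
  refine hB.exchange_base_of_notMem_closure hb (fun hcl => ?_) he
  have hsub : B \ {b} ⊆ (E : Set M) := Set.sdiff_subset.trans hB.subset_ground
  refine hB.indep.notMem_closure_sdiff_of_mem hb ?_
  have hbcl : b ∈ (hL.initialMatroid hK E wt).closure (insert e (B \ {b})) := by
    refine hL.mem_closure_of_mem_minTerms hK (Set.insert_subset he hsub) hf
      (hB.subset_ground hb) hbf fun x hx => ?_
    rcases hfB (minTerms_subset _ _ hx) with h | h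
    · exact Or.inr (Or.inl h)
    · by_cases hxb : x = b
      · exact Or.inl hxb
      · exact Or.inr (Or.inr ⟨h, hxb⟩)
  rwa [Matroid.closure_insert_eq_of_mem_closure hcl] at hbcl

theorem IsTropicalIdeal.isBase_convex (hE : IsRestrictable L (E : Set M)) {wt₀ wt₁ wts : M →+ ℝ}
    {s : ℝ} (hs0 : 0 ≤ s) (hs1 : s ≤ 1) (hwts : ∀ u, wts u = (1 - s) * wt₀ u + s * wt₁ u)
    {B : Set M} (h0 : (hL.initialMatroid hK E wt₀).IsBase B)
    (h1 : (hL.initialMatroid hK E wt₁).IsBase B) : (hL.initialMatroid hK E wts).IsBase B := by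
  have hB := hL.isBase_of_initialMatroid hK hE h0
  refine hL.isBase_of_fundamental hK hE hB fun e he heB => ?_
  obtain ⟨f, hf, hef, hfB⟩ := hL.exists_fundamental hK hB he heB
  exact ⟨f, hf, hfB, minTerms_convex hs0 hs1 hwts (hL.mem_minTerms_of_isBase hK h0 hf hef hfB)
    (hL.mem_minTerms_of_isBase hK h1 hf hef hfB)⟩

/-- If `B` is a basis at both ends of a segment of weights, then so is every basis `B'` at an inner
point. The induction is on `|B' \ B|`: an exchange towards `B` yields a basis `B''` at both ends. In
the fundamental circuit that connects `B'` and `B''`, the difference of the values of the two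
exchanged monomials is affine along the segment, nonnegative at the ends and zero inside, hence
zero, so the exchange back to `B'` is possible at both ends. -/
theorem IsTropicalIdeal.isBase_endpoints (hE : IsRestrictable L (E : Set M))
    {wt₀ wt₁ wts : M →+ ℝ} {s : ℝ} (hs0 : 0 < s) (hs1 : s < 1)
    (hwts : ∀ u, wts u = (1 - s) * wt₀ u + s * wt₁ u)
    {B : Set M} (h0 : (hL.initialMatroid hK E wt₀).IsBase B)
    (h1 : (hL.initialMatroid hK E wt₁).IsBase B) (m : ℕ) :
    ∀ B', (hL.initialMatroid hK E wts).IsBase B' → (B' \ B).ncard = m →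
      (hL.initialMatroid hK E wt₀).IsBase B' ∧ (hL.initialMatroid hK E wt₁).IsBase B' := by
  have hBs := hL.isBase_convex hK hE hs0.le hs1.le hwts h0 h1
  induction m with
  | zero =>
    intro B' hB' hm
    have hfin : B'.Finite := E.finite_toSet.subset hB'.subset_ground
    rw [Set.ncard_eq_zero hfin.sdiff] at hm
    rw [hB'.eq_of_subset_isBase hBs (Set.sdiff_eq_empty.mp hm)]
    exact ⟨h0, h1⟩
  | succ m ih =>
    intro B' hB' hm
    have hfin : B'.Finite := E.finite_toSet.subset hB'.subset_ground
    obtain ⟨e, heB', heB⟩ : (B' \ B).Nonempty := by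
      rw [← Set.ncard_pos hfin.sdiff]; omega
    obtain ⟨y, ⟨hyB, hyB'⟩, hB''⟩ := hB'.exchange hBs ⟨heB', heB⟩
    have hey : e ≠ y := fun h => heB (h ▸ hyB)
    have heB'' : e ∉ insert y (B' \ {e}) := by
      rintro (h | h)
      · exact hey h
      · exact h.2 rfl
    have hback : insert e (insert y (B' \ {e}) \ {y}) = B' := by
      rw [Set.insert_sdiff_of_mem _ (Set.mem_singleton y), Set.sdiff_singleton_eq_self
        (fun h => hyB' h.1), Set.insert_sdiff_singleton, Set.insert_eq_of_mem heB']
    have hcard : (insert y (B' \ {e}) \ B).ncard = m := by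
      rw [Set.insert_sdiff_of_mem _ hyB, Set.sdiff_sdiff_comm]
      have := Set.ncard_sdiff_singleton_add_one (show e ∈ B' \ B from ⟨heB', heB⟩) hfin.sdiff
      omega
    obtain ⟨i0, i1⟩ := ih _ hB'' hcard
    have heE : e ∈ E := hB'.subset_ground heB'
    obtain ⟨f, hf, hef, hfB⟩ := hL.exists_fundamental hK (hL.isBase_of_initialMatroid hK hE i0)
      heE heB''
    have e0 := hL.mem_minTerms_of_isBase hK i0 hf hef hfB
    have e1 := hL.mem_minTerms_of_isBase hK i1 hf hef hfB
    have ys : y ∈ minTerms wts f :=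
      hL.mem_minTerms_of_exchange hK (b := y) (B := insert y (B' \ {e})) (hback.symm ▸ hB') hf
        hef hfB
    obtain ⟨-, e0'⟩ := mem_minTerms.mp e0
    obtain ⟨-, e1'⟩ := mem_minTerms.mp e1
    obtain ⟨hy, ys'⟩ := mem_minTerms.mp ys
    have k0 := e0' y hy
    have k1 := e1' y hy
    have ks := ys' e hef
    rw [hwts, hwts] at ks
    -- an affine function that is nonnegative at both ends and vanishes inside is zero
    have z0 : realCoeff f y + wt₀ y ≤ realCoeff f e + wt₀ e := by
      nlinarith [mul_nonneg hs0.le (sub_nonneg.mpr k1)]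
    have z1 : realCoeff f y + wt₁ y ≤ realCoeff f e + wt₁ e := by
      nlinarith [mul_nonneg (sub_nonneg.mpr hs1.le) (sub_nonneg.mpr k0)]
    rw [← hback]
    exact ⟨hL.isBase_exchange hK heE (Set.mem_insert _ _) i0 hf hfB
        (mem_minTerms.mpr ⟨hy, fun v hv => z0.trans (e0' v hv)⟩),
      hL.isBase_exchange hK heE (Set.mem_insert _ _) i1 hf hfB
        (mem_minTerms.mpr ⟨hy, fun v hv => z1.trans (e1' v hv)⟩)⟩

theorem IsTropicalIdeal.initialMatroid_convex (hE : IsRestrictable L (E : Set M))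
    {wt₀ wt₁ wts : M →+ ℝ} {s : ℝ} (hs0 : 0 < s) (hs1 : s < 1)
    (hwts : ∀ u, wts u = (1 - s) * wt₀ u + s * wt₁ u)
    (h : hL.initialMatroid hK E wt₀ = hL.initialMatroid hK E wt₁) :
    hL.initialMatroid hK E wts = hL.initialMatroid hK E wt₀ := by
  refine Matroid.ext_isBase (by simp only [IsTropicalIdeal.initialMatroid_ground])
    fun B' _ => ⟨fun hB' => ?_, fun hB' => ?_⟩
  · obtain ⟨B, hB⟩ := (hL.initialMatroid hK E wt₀).exists_isBase
    exact (hL.isBase_endpoints hK hE hs0 hs1 hwts hB (h ▸ hB) _ B' hB' rfl).1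
  · exact hL.isBase_convex hK hE hs0.le hs1.le hwts hB' (h ▸ hB')

/-- If one set remains a basis along an open segment, then the initial matroid is constant on it. -/
theorem IsTropicalIdeal.initialMatroid_eq_of_isBase (hE : IsRestrictable L (E : Set M))
    {wt wt' : M →+ ℝ} {ε₀ : ℝ} {B : Set M}
    (hB : ∀ ε : ℝ, 0 < ε → ε < ε₀ → (hL.initialMatroid hK E (wt + ε • wt')).IsBase B)
    {ε ε' : ℝ} (h1 : 0 < ε) (h2 : ε < ε₀) (h3 : 0 < ε') (h4 : ε' < ε₀) :
    hL.initialMatroid hK E (wt + ε • wt') = hL.initialMatroid hK E (wt + ε' • wt') := by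
  have key : ∀ ε ε' : ℝ, 0 < ε → ε < ε₀ → 0 < ε' → ε' < ε₀ → ∀ B',
      (hL.initialMatroid hK E (wt + ε • wt')).IsBase B' →
      (hL.initialMatroid hK E (wt + ε' • wt')).IsBase B' := by
    intro ε ε' h1 h2 h3 h4 B' hB'
    obtain ⟨a, ha0, ha⟩ := exists_between (lt_min h1 h3)
    obtain ⟨b, hb, hb0⟩ := exists_between (max_lt h2 h4)
    obtain ⟨ha1, ha2⟩ := lt_min_iff.mp ha
    obtain ⟨hb1, hb2⟩ := max_lt_iff.mp hb
    have hab : 0 < b - a := by linarith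
    have hcomb : ∀ t u, (wt + t • wt') u =
        (1 - (t - a) / (b - a)) * (wt + a • wt') u + (t - a) / (b - a) * (wt + b • wt') u := by
      intro t u
      simp only [AddMonoidHom.add_apply, AddMonoidHom.smul_apply, smul_eq_mul]
      field_simp
      ring
    have hpos : ∀ t, a < t → 0 < (t - a) / (b - a) := fun t ht => div_pos (by linarith) hab
    have hlt : ∀ t, t < b → (t - a) / (b - a) < 1 := fun t ht => by
      rw [div_lt_one hab]; linarith
    obtain ⟨j0, j1⟩ := hL.isBase_endpoints hK hE (hpos ε ha1) (hlt ε hb1) (hcomb ε)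
      (hB a ha0 (by linarith)) (hB b (by linarith) hb0) _ B' hB' rfl
    exact hL.isBase_convex hK hE (hpos ε' ha2).le (hlt ε' hb2).le (hcomb ε') j0 j1
  exact Matroid.ext_isBase (by simp only [IsTropicalIdeal.initialMatroid_ground]) fun B' _ =>
    ⟨key _ _ h1 h2 h3 h4 B', key _ _ h3 h4 h1 h2 B'⟩

end IdealMatroid

/-! ### Small perturbations of the weight -/

section Perturbation

open Filter Topology

variable {K : Subsemiring TropicalReal} {M : Type} [AddCommMonoid M]

theorem eventually_minTerms_add_smul (wt wt' : M →+ ℝ) (f : TropPoly K M) :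
    ∀ᶠ ε : ℝ in 𝓝[>] 0, minTerms (wt + ε • wt' : M →+ ℝ) f = minTerms wt' (initialForm wt f) := by
  have key : ∀ x ∈ f.coeff.support, ∀ y ∈ f.coeff.support, ∀ᶠ ε : ℝ in 𝓝[>] 0,
      realCoeff f x + wt x < realCoeff f y + wt y →
      realCoeff f x + (wt x + ε * wt' x) < realCoeff f y + (wt y + ε * wt' y) := by
    intro x _ y _
    by_cases hxy : realCoeff f x + wt x < realCoeff f y + wt y
    · have h1 : Tendsto (fun ε : ℝ => realCoeff f x + (wt x + ε * wt' x)) (𝓝 0)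
          (𝓝 (realCoeff f x + (wt x + 0 * wt' x))) := (by fun_prop : Continuous _).tendsto 0
      have h2 : Tendsto (fun ε : ℝ => realCoeff f y + (wt y + ε * wt' y)) (𝓝 0)
          (𝓝 (realCoeff f y + (wt y + 0 * wt' y))) := (by fun_prop : Continuous _).tendsto 0
      have h3 := h1.eventually_lt h2 (by simpa using hxy)
      filter_upwards [h3.filter_mono nhdsWithin_le_nhds] with ε hε _ using hε
    · exact Eventually.of_forall fun ε h => absurd h hxy
  have key' : ∀ᶠ ε : ℝ in 𝓝[>] 0, ∀ x ∈ f.coeff.support, ∀ y ∈ f.coeff.support,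
      realCoeff f x + wt x < realCoeff f y + wt y →
      realCoeff f x + (wt x + ε * wt' x) < realCoeff f y + (wt y + ε * wt' y) := by
    rw [eventually_all_finset]
    intro x hx
    rw [eventually_all_finset]
    exact key x hx
  filter_upwards [key', self_mem_nhdsWithin] with ε hε hpos
  have hpos' : (0 : ℝ) < ε := hpos
  ext u
  rw [mem_minTerms, mem_minTerms, support_initialForm]
  simp only [AddMonoidHom.add_apply, AddMonoidHom.smul_apply, smul_eq_mul, realCoeff_boolean,
    zero_add]
  constructor
  · rintro ⟨hu, hmin⟩
    have hu' : u ∈ minTerms wt f := mem_minTerms.mpr ⟨hu, fun v hv => by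
      by_contra hcon
      exact absurd (hε v hv u hu (not_le.mp hcon)) (not_lt.mpr (hmin v hv))⟩
    refine ⟨hu', fun v hv => ?_⟩
    obtain ⟨hv1, hv2⟩ := mem_minTerms.mp hv
    have h1 := hmin v hv1
    have h2 := hv2 u hu
    have h3 : ε * wt' u ≤ ε * wt' v := by linarith
    exact le_of_mul_le_mul_left h3 hpos'
  · rintro ⟨hu, hmin⟩
    obtain ⟨hu1, hu2⟩ := mem_minTerms.mp hu
    refine ⟨hu1, fun v hv => ?_⟩
    rcases (hu2 v hv).lt_or_eq with h | h
    · exact (hε u hu1 v hv h).le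
    · have hv' : v ∈ minTerms wt f := mem_minTerms.mpr ⟨hv, fun x hx => h ▸ hu2 x hx⟩
      have := mul_le_mul_of_nonneg_left (hmin v hv') hpos'.le
      linarith

variable [IsCancelAdd M]

variable (hK : IsDivisible K) {L : Ideal (TropPoly K M)} (hL : IsTropicalIdeal L) {E : Finset M}

/-- On a finite set of monomials, the initial matroid of the initial ideal is the initial matroid
for all small perturbations. The bound on the perturbation depends on the set. -/
theorem IsTropicalIdeal.eventually_initialMatroid_eq (hE : IsRestrictable L (E : Set M))
    (wt wt' : M →+ ℝ) :
    ∀ᶠ ε : ℝ in 𝓝[>] 0,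
      (hL.initialIdealWt hK (map_add wt)).initialMatroid isDivisible_booleanSemiring E wt' =
        hL.initialMatroid hK E (wt + ε • wt') := by
  have hvec : ∀ s ∈ E.powerset, ∀ e ∈ E, ∀ᶠ ε : ℝ in 𝓝[>] 0,
      s ∈ supports (_root_.initialIdealWt wt' (_root_.initialIdealWt wt L)) → e ∈ s →
      ∃ f ∈ L, e ∈ minTerms (wt + ε • wt' : M →+ ℝ) f ∧
        minTerms (wt + ε • wt' : M →+ ℝ) f ⊆ s := by
    intro s _ e _
    by_cases hs : s ∈ supports (_root_.initialIdealWt wt' (_root_.initialIdealWt wt L)) ∧ e ∈ s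
    · obtain ⟨⟨F, hF, rfl⟩, he⟩ := hs
      obtain ⟨G, hG, heG, hGF⟩ := (mem_initialIdealWt (map_add wt')).mp hF e he
      obtain ⟨heG1, heG2⟩ := mem_minTerms.mp heG
      obtain ⟨f, hf, hef, hfG⟩ := (mem_initialIdealWt (map_add wt)).mp hG e heG1
      have h1 : e ∈ minTerms wt' (initialForm wt f) := by
        refine mem_minTerms.mpr ⟨by rwa [support_initialForm], fun v hv => ?_⟩
        rw [support_initialForm] at hv
        have := heG2 v (hfG hv)
        simpa only [realCoeff_boolean] using this
      filter_upwards [eventually_minTerms_add_smul wt wt' f] with ε hε _ _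
      refine ⟨f, hf, hε ▸ h1, fun x hx => hGF ?_⟩
      rw [hε] at hx
      obtain ⟨hx1, hx2⟩ := mem_minTerms.mp hx
      rw [support_initialForm] at hx1
      refine mem_minTerms.mpr ⟨hfG hx1, fun y hy => ?_⟩
      have h2 := hx2 e (by rwa [support_initialForm])
      have h3 := heG2 y hy
      simp only [realCoeff_boolean] at h2 h3 ⊢
      exact h2.trans h3
    · exact Eventually.of_forall fun ε h1 h2 => absurd ⟨h1, h2⟩ hs
  have hvec' : ∀ᶠ ε : ℝ in 𝓝[>] 0, ∀ s ∈ E.powerset, ∀ e ∈ E,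
      s ∈ supports (_root_.initialIdealWt wt' (_root_.initialIdealWt wt L)) → e ∈ s →
      ∃ f ∈ L, e ∈ minTerms (wt + ε • wt' : M →+ ℝ) f ∧
        minTerms (wt + ε • wt' : M →+ ℝ) f ⊆ s := by
    rw [eventually_all_finset]
    intro s hs
    rw [eventually_all_finset]
    exact hvec s hs
  filter_upwards [hvec'] with ε hε
  have hL' := hL.initialIdealWt hK (map_add wt)
  set M₁ := hL'.initialMatroid isDivisible_booleanSemiring E wt' with hM₁
  set M₂ := hL.initialMatroid hK E (wt + ε • wt') with hM₂
  have hground : M₁.E = M₂.E := by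
    rw [hM₁, hM₂, IsTropicalIdeal.initialMatroid_ground, IsTropicalIdeal.initialMatroid_ground]
  have hM₁E : M₁.E = E := rfl
  have hcl : ∀ X ⊆ (E : Set M), M₁.closure X ⊆ M₂.closure X := by
    intro X hX e he
    have heE : e ∈ E := M₁.mem_ground_of_mem_closure he
    by_cases heX : e ∈ X
    · exact M₂.mem_closure_of_mem heX (hground ▸ hX)
    obtain ⟨s, hs, hes, hsX⟩ := exists_vector_of_mem_closure
      ((hL'.initialIdealWt isDivisible_booleanSemiring (map_add wt')).isVectorFamily
        isDivisible_booleanSemiring) hX he heX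
    have hsE : s ⊆ E := fun x hx => by
      rcases hsX hx with h | h
      · exact h ▸ heE
      · exact hX h
    obtain ⟨f, hf, hef, hfs⟩ := hε s (Finset.mem_powerset.mpr hsE) e heE hs hes
    exact hL.mem_closure_of_mem_minTerms hK hX hf heE hef fun x hx => hsX (hfs hx)
  have hbase : ∀ B, M₁.IsBase B → M₂.IsBase B := by
    intro B hB
    have h1 := hL'.isBase_of_initialMatroid isDivisible_booleanSemiring
      (hE.initialIdealWt (map_add wt)) hB
    have h2 : (hL.matroid hK E).IsBase B := hL.isBase_of_initialMatroid hK hE h1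
    refine hL.isBase_of_closure_eq hK hE h2 ?_
    have h3 := hcl B hB.subset_ground
    rwa [hB.closure_eq] at h3
  have hcl' : ∀ X, M₁.closure X ⊆ M₂.closure X := by
    intro X
    rw [← M₁.closure_inter_ground, ← M₂.closure_inter_ground, ← hground]
    exact hcl _ Set.inter_subset_right
  refine Matroid.ext_closure fun X => (hcl' X).antisymm ?_
  rw [← M₁.closure_inter_ground, ← M₂.closure_inter_ground, ← hground]
  exact Matroid.closure_subset_of_isBase_of_closure_le hground hbase hcl' Set.inter_subset_right

end Perturbation

/-! ### Homogeneous tropical ideals -/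

section Graded

variable {N : ℕ}

/-- The monomials of degree `d`. -/
def monomialsOfDegree (N d : ℕ) : Finset (Fin N →₀ ℕ) := Finset.univ.finsuppAntidiag d

theorem mem_monomialsOfDegree {d : ℕ} {u : Fin N →₀ ℕ} :
    u ∈ monomialsOfDegree N d ↔ ∑ i, u i = d := by
  simp [monomialsOfDegree]

/-- A tropical ideal of the polynomial semiring that is homogeneous: it contains the homogeneous
parts of its elements. -/
structure IsGradedTropical {K : Subsemiring TropicalReal} (L : Ideal (OrdPoly K N)) : Prop where
  tropical : IsTropicalIdeal L
  restrict : ∀ d, IsRestrictable L (monomialsOfDegree N d : Set (Fin N →₀ ℕ))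

variable {K : Subsemiring TropicalReal}

theorem IsGradedTropical.initialIdealWt (hK : IsDivisible K) {L : Ideal (OrdPoly K N)}
    (hL : IsGradedTropical L)
    (wt : (Fin N →₀ ℕ) →+ ℝ) : IsGradedTropical (initialIdealWt wt L) :=
  ⟨hL.tropical.initialIdealWt hK (map_add wt),
    fun d => (hL.restrict d).initialIdealWt (map_add wt)⟩

theorem le_of_matroid_eq {J₁ J₂ : Ideal (OrdPoly booleanSemiring N)} (h₁ : IsGradedTropical J₁)
    (h₂ : IsGradedTropical J₂)
    (h : ∀ d, h₁.tropical.matroid isDivisible_booleanSemiring (monomialsOfDegree N d) =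
      h₂.tropical.matroid isDivisible_booleanSemiring (monomialsOfDegree N d)) : J₁ ≤ J₂ := by
  intro F hF
  have hG : ∀ e ∈ F.coeff.support, ∃ G ∈ J₂, e ∈ G.coeff.support ∧
      G.coeff.support ⊆ F.coeff.support := by
    intro e he
    set E := monomialsOfDegree N (∑ i, e i)
    have heE : e ∈ E := mem_monomialsOfDegree.mpr rfl
    set P := restrictTo (E : Set (Fin N →₀ ℕ)) F
    have hP : P ∈ J₁ := h₁.restrict _ F hF
    have heP : e ∈ P.coeff.support := mem_support_restrictTo.mpr ⟨he, heE⟩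
    have hX : (P.coeff.support : Set (Fin N →₀ ℕ)) \ {e} ⊆ E :=
      fun x hx => (mem_support_restrictTo.mp hx.1).2
    have hcl := mem_closure_of_vector (h₁.tropical.isVectorFamily isDivisible_booleanSemiring)
      hX heE ⟨P, hP, rfl⟩ heP fun x hx => by
        by_cases hxe : x = e
        · exact Or.inl hxe
        · exact Or.inr ⟨hx, hxe⟩
    have hcl' : e ∈ (h₂.tropical.matroid isDivisible_booleanSemiring E).closure
        ((P.coeff.support : Set (Fin N →₀ ℕ)) \ {e}) := h _ ▸ hcl
    obtain ⟨_, ⟨G, hG, rfl⟩, heG, hGP⟩ := exists_vector_of_mem_closure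
      (h₂.tropical.isVectorFamily isDivisible_booleanSemiring) hX hcl' fun h => h.2 rfl
    refine ⟨G, hG, heG, fun x hx => ?_⟩
    rcases hGP hx with h | h
    · exact h ▸ he
    · exact (mem_support_restrictTo.mp h.1).1
  choose! G hGJ heG hGF using hG
  have : F = ∑ e ∈ F.coeff.support, G e := boolean_ext fun u => by
    rw [support_sum]
    exact ⟨fun hu => ⟨u, hu, heG u hu⟩, fun ⟨e, he, hu⟩ => hGF e he hu⟩
  rw [this]
  exact Ideal.sum_mem _ hGJ

/-- A homogeneous tropical ideal with Boolean coefficients is determined by its matroids in all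
degrees. -/
theorem eq_of_matroid_eq {J₁ J₂ : Ideal (OrdPoly booleanSemiring N)} (h₁ : IsGradedTropical J₁)
    (h₂ : IsGradedTropical J₂)
    (h : ∀ d, h₁.tropical.matroid isDivisible_booleanSemiring (monomialsOfDegree N d) =
      h₂.tropical.matroid isDivisible_booleanSemiring (monomialsOfDegree N d)) : J₁ = J₂ :=
  le_antisymm (le_of_matroid_eq h₁ h₂ h) (le_of_matroid_eq h₂ h₁ fun d => (h d).symm)

/-- The largest monomials, for the lexicographic order, of the homogeneous elements of `J`. -/
def leadingMonomials (J : Ideal (OrdPoly booleanSemiring N)) : Set (Fin N →₀ ℕ) :=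
  {m | ∃ G ∈ supports J, G ⊆ monomialsOfDegree N (∑ i, m i) ∧ m ∈ G ∧
    ∀ x ∈ G, toLex x ≤ toLex m}

/-- Multiples of leading monomials are leading monomials. -/
theorem leadingMonomials_upward {J : Ideal (OrdPoly booleanSemiring N)} {m m' : Fin N →₀ ℕ}
    (hm : m ∈ leadingMonomials J) (hle : m ≤ m') : m' ∈ leadingMonomials J := by
  obtain ⟨a, rfl⟩ := exists_add_of_le hle
  obtain ⟨_, ⟨F, hF, rfl⟩, hFE, hmF, hmax⟩ := hm
  have hs := mem_support_single_mul a (one_ne_zero (α := booleanSemiring)) F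
  refine ⟨_, ⟨AddMonoidAlgebra.single a 1 * F, J.mul_mem_left _ hF, rfl⟩, fun x hx => ?_, ?_,
    fun x hx => ?_⟩
  · obtain ⟨u, hu, rfl⟩ := (hs x).mp hx
    have := mem_monomialsOfDegree.mp (hFE hu)
    rw [mem_monomialsOfDegree]
    simp only [Finsupp.add_apply, Finset.sum_add_distrib, this]
    exact add_comm _ _
  · exact (hs _).mpr ⟨m, hmF, add_comm _ _⟩
  · obtain ⟨u, hu, rfl⟩ := (hs x).mp hx
    rw [add_comm m a, toLex_add, toLex_add]
    exact add_le_add_right (hmax u hu) _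

theorem isBase_standardMonomials {J : Ideal (OrdPoly booleanSemiring N)} (hJ : IsTropicalIdeal J)
    (d : ℕ) : (hJ.matroid isDivisible_booleanSemiring (monomialsOfDegree N d)).IsBase
      {e | e ∈ monomialsOfDegree N d ∧ e ∉ leadingMonomials J} := by
  have h := isBase_of_not_leading (κ := toLex) toLex.injective
    (hJ.isVectorFamily isDivisible_booleanSemiring) (monomialsOfDegree N d)
  have heq : {e | e ∈ monomialsOfDegree N d ∧ e ∉ leadingMonomials J} =
      {e | e ∈ monomialsOfDegree N d ∧ ¬ ∃ G ∈ supports J, G ⊆ monomialsOfDegree N d ∧ e ∈ G ∧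
        ∀ x ∈ G, toLex x ≤ toLex e} := by
    ext e
    refine and_congr_right fun he => ?_
    rw [leadingMonomials, Set.mem_ofPred_eq, mem_monomialsOfDegree.mp he]
  rw [heq]
  exact h

/-- Whether a monomial is a leading monomial is determined by the matroid in its degree. -/
theorem mem_leadingMonomials_iff {J : Ideal (OrdPoly booleanSemiring N)} (hJ : IsTropicalIdeal J)
    {m : Fin N →₀ ℕ} : m ∈ leadingMonomials J ↔
      m ∈ (hJ.matroid isDivisible_booleanSemiring (monomialsOfDegree N (∑ i, m i))).closure
        {x | x ∈ monomialsOfDegree N (∑ i, m i) ∧ toLex x < toLex m} := by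
  have hX : {x | x ∈ monomialsOfDegree N (∑ i, m i) ∧ toLex x < toLex m} ⊆
      (monomialsOfDegree N (∑ i, m i) : Set (Fin N →₀ ℕ)) := fun x hx => hx.1
  constructor
  · rintro ⟨G, hG, hGE, hmG, hmax⟩
    refine mem_closure_of_vector _ hX (hGE hmG) hG hmG fun x hx => ?_
    exact (hmax x hx).eq_or_lt.imp (fun h => toLex.injective h) fun h => ⟨hGE hx, h⟩
  · intro h
    obtain ⟨G, hG, hmG, hGX⟩ := exists_vector_of_mem_closure
      (hJ.isVectorFamily isDivisible_booleanSemiring) hX h fun h => lt_irrefl _ h.2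
    refine ⟨G, hG, fun x hx => ?_, hmG, fun x hx => ?_⟩
    · rcases hGX hx with h | h
      · exact h ▸ mem_monomialsOfDegree.mpr rfl
      · exact h.1
    · rcases hGX hx with h | h
      · exact h ▸ le_rfl
      · exact h.2.le

/-- Dickson's lemma: every set of monomials has a finite subset that divides all its elements. -/
theorem exists_finset_generators {N : ℕ} (S : Set (Fin N →₀ ℕ)) :
    ∃ A : Finset (Fin N →₀ ℕ), (∀ a ∈ A, a ∈ S) ∧ ∀ m ∈ S, ∃ a ∈ A, a ≤ m := by
  have hfin : {x | Minimal (· ∈ S) x}.Finite :=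
    WellQuasiOrderedLE.finite_of_isAntichain (setOfPred_minimal_antichain _)
  refine ⟨hfin.toFinset, fun a ha => (hfin.mem_toFinset.mp ha).prop, fun m hm => ?_⟩
  obtain ⟨a, ha, hmin⟩ := exists_minimal_le_of_wellFoundedLT (· ∈ S) m hm
  exact ⟨a, hfin.mem_toFinset.mpr hmin, ha⟩

open Filter Topology in
/-- Initial ideals of initial ideals are initial ideals for small perturbations, with one bound `ε₀`
for all degrees. The bound is the one for the finitely many degrees of the generators of the leading
monomials of `in_{wt'}(in_wt(L))`. -/
theorem IsGradedTropical.exists_initialIdealWt_eq (hK : IsDivisible K)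
    {L : Ideal (OrdPoly K N)} (hL : IsGradedTropical L) (wt wt' : (Fin N →₀ ℕ) →+ ℝ) :
    ∃ ε₀ > (0 : ℝ), ∀ ε : ℝ, 0 < ε → ε < ε₀ →
      _root_.initialIdealWt wt' (_root_.initialIdealWt wt L) =
        _root_.initialIdealWt (wt + ε • wt' : (Fin N →₀ ℕ) →+ ℝ) L := by
  have hL' := hL.initialIdealWt hK wt
  have hJ := hL'.initialIdealWt isDivisible_booleanSemiring wt'
  have hJε := fun ε : ℝ => hL.initialIdealWt hK (wt + ε • wt')
  have hev : ∀ d, ∀ᶠ ε : ℝ in 𝓝[>] 0,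
      hJ.tropical.matroid isDivisible_booleanSemiring (monomialsOfDegree N d) =
        (hJε ε).tropical.matroid isDivisible_booleanSemiring (monomialsOfDegree N d) :=
    fun d => hL.tropical.eventually_initialMatroid_eq hK (hL.restrict d) wt wt'
  obtain ⟨A, hA, hAgen⟩ := exists_finset_generators
    (leadingMonomials (_root_.initialIdealWt wt' (_root_.initialIdealWt wt L)))
  have hev' : ∀ᶠ ε : ℝ in 𝓝[>] 0, ∀ a ∈ A,
      hJ.tropical.matroid isDivisible_booleanSemiring (monomialsOfDegree N (∑ i, a i)) =
        (hJε ε).tropical.matroid isDivisible_booleanSemiring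
          (monomialsOfDegree N (∑ i, a i)) := by
    rw [eventually_all_finset]
    exact fun a _ => hev _
  obtain ⟨ε₀, hε₀, hsub⟩ := mem_nhdsGT_iff_exists_Ioo_subset.mp hev'
  refine ⟨ε₀, hε₀, fun ε h1 h2 => eq_of_matroid_eq hJ (hJε ε) fun d => ?_⟩
  set B : Set (Fin N →₀ ℕ) := {e | e ∈ monomialsOfDegree N d ∧
    e ∉ leadingMonomials (_root_.initialIdealWt wt' (_root_.initialIdealWt wt L))} with hB
  have hBJ := isBase_standardMonomials hJ.tropical d
  rw [← hB] at hBJ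
  have hBL : (hL.tropical.matroid hK (monomialsOfDegree N d)).IsBase B :=
    hL.tropical.isBase_of_initialMatroid hK (hL.restrict d)
      (hL'.tropical.isBase_of_initialMatroid isDivisible_booleanSemiring (hL'.restrict d) hBJ)
  -- the leading monomials can only increase under the perturbation, and their numbers in degree `d`
  -- are equal because the matroids have equal ranks
  have hbase : ∀ δ : ℝ, 0 < δ → δ < ε₀ →
      (hL.tropical.initialMatroid hK (monomialsOfDegree N d) (wt + δ • wt')).IsBase B := by
    intro δ hδ0 hδ
    have hδA := hsub ⟨hδ0, hδ⟩
    have hlead : leadingMonomials (_root_.initialIdealWt wt' (_root_.initialIdealWt wt L)) ⊆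
        leadingMonomials (_root_.initialIdealWt (wt + δ • wt' : (Fin N →₀ ℕ) →+ ℝ) L) := by
      intro m hm
      obtain ⟨a, ha, ham⟩ := hAgen m hm
      refine leadingMonomials_upward ?_ ham
      have h3 := (mem_leadingMonomials_iff hJ.tropical).mp (hA a ha)
      rw [hδA a ha] at h3
      exact (mem_leadingMonomials_iff (hJε δ).tropical).mpr h3
    have hBδ := isBase_standardMonomials (hJε δ).tropical d
    have hsubB : {e | e ∈ monomialsOfDegree N d ∧ e ∉ leadingMonomials
        (_root_.initialIdealWt (wt + δ • wt' : (Fin N →₀ ℕ) →+ ℝ) L)} ⊆ B :=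
      fun e he => ⟨he.1, fun h => he.2 (hlead h)⟩
    have := (hL.tropical.isBase_of_initialMatroid hK (hL.restrict d) hBδ).eq_of_subset_isBase
      hBL hsubB
    rw [← this]
    exact hBδ
  -- in degree `d` the equality holds for some `δ < ε₀`, and from there it spreads to all `ε < ε₀`
  obtain ⟨δ, hδ, hδ'⟩ := ((hev d).and (Ioo_mem_nhdsGT hε₀)).exists
  rw [hδ]
  exact hL.tropical.initialMatroid_eq_of_isBase hK (hL.restrict d) hbase hδ'.1 hδ'.2 h1 h2

/-- The weights with a given initial ideal form a convex set. -/
theorem IsGradedTropical.initialIdealWt_convex (hK : IsDivisible K)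
    {L : Ideal (OrdPoly K N)} (hL : IsGradedTropical L)
    {wt₀ wt₁ wts : (Fin N →₀ ℕ) →+ ℝ} {s : ℝ} (hs0 : 0 < s) (hs1 : s < 1)
    (hwts : ∀ u, wts u = (1 - s) * wt₀ u + s * wt₁ u)
    (h : _root_.initialIdealWt wt₀ L = _root_.initialIdealWt wt₁ L) :
    _root_.initialIdealWt wts L = _root_.initialIdealWt wt₀ L := by
  refine eq_of_matroid_eq (hL.initialIdealWt hK wts) (hL.initialIdealWt hK wt₀) fun d => ?_
  refine hL.tropical.initialMatroid_convex hK (hL.restrict d) hs0 hs1 hwts ?_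
  unfold IsTropicalIdeal.initialMatroid
  congr 1

end Graded

/-! ### Initial ideals and monomial substitutions -/

section MapDomain

variable {K : Subsemiring TropicalReal} {M M' : Type}

theorem tropCoeff_single_self (m : M) (c : K) :
    tropCoeff (AddMonoidAlgebra.single m c) m = Tropical.untrop (c : TropicalReal) := by
  unfold tropCoeff
  rw [AddMonoidAlgebra.coeff_single, Finsupp.single_eq_same]

theorem tropCoeff_single_of_ne {m u : M} (h : u ≠ m) (c : K) :
    tropCoeff (AddMonoidAlgebra.single m c) u = ⊤ := by
  rw [tropCoeff_eq_top, AddMonoidAlgebra.coeff_single, Finsupp.single_eq_of_ne h]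

theorem tropCoeff_sum {ι : Type*} (s : Finset ι) (f : ι → TropPoly K M) (u : M) :
    tropCoeff (∑ i ∈ s, f i) u = s.inf fun i => tropCoeff (f i) u := by
  classical
  induction s using Finset.induction_on with
  | empty => rfl
  | insert i s hi ih => rw [Finset.sum_insert hi, Finset.inf_insert, tropCoeff_add, ih]

variable [AddCommMonoid M] [AddCommMonoid M']

theorem mapDomainRingHom_eq_sum (π : M →+ M') (f : TropPoly K M) :
    AddMonoidAlgebra.mapDomainRingHom K π f =
      ∑ m ∈ f.coeff.support, AddMonoidAlgebra.single (π m) (f.coeff m) := by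
  apply AddMonoidAlgebra.coeff_injective
  rw [AddMonoidAlgebra.coeff_sum]
  rfl

theorem mapDomainRingHom_single (π : M →+ M') (m : M) (c : K) :
    AddMonoidAlgebra.mapDomainRingHom K π (AddMonoidAlgebra.single m c) =
      AddMonoidAlgebra.single (π m) c := AddMonoidAlgebra.mapDomain_single

theorem mem_support_mapDomain (π : M →+ M') (f : TropPoly K M) (u : M') :
    u ∈ (AddMonoidAlgebra.mapDomainRingHom K π f).coeff.support ↔
      ∃ m ∈ f.coeff.support, π m = u := by
  rw [mapDomainRingHom_eq_sum, support_sum]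
  refine exists_congr fun m => and_congr_right fun hm => ?_
  rw [AddMonoidAlgebra.coeff_single]
  refine ⟨fun h => (Finset.mem_singleton.mp (Finsupp.support_single_subset h)).symm, ?_⟩
  rintro rfl
  simpa using hm

theorem tropCoeff_mapDomain_le (π : M →+ M') (f : TropPoly K M) (m : M) :
    tropCoeff (AddMonoidAlgebra.mapDomainRingHom K π f) (π m) ≤ tropCoeff f m := by
  by_cases hm : m ∈ f.coeff.support
  · rw [mapDomainRingHom_eq_sum, tropCoeff_sum]
    refine (Finset.inf_le hm).trans ?_
    rw [tropCoeff_single_self]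
    rfl
  · rw [tropCoeff_of_notMem hm]; exact le_top

theorem le_tropCoeff_mapDomain (π : M →+ M') (f : TropPoly K M) (u : M') (c : WithTop ℝ)
    (h : ∀ m ∈ f.coeff.support, π m = u → c ≤ tropCoeff f m) :
    c ≤ tropCoeff (AddMonoidAlgebra.mapDomainRingHom K π f) u := by
  rw [mapDomainRingHom_eq_sum, tropCoeff_sum]
  refine Finset.le_inf fun m hm => ?_
  by_cases hmu : u = π m
  · subst hmu
    rw [tropCoeff_single_self]
    exact h m hm rfl
  · rw [tropCoeff_single_of_ne hmu]; exact le_top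

theorem tropCoeff_mapDomain_of_injOn {π : M →+ M'} {S : Set M} (hπ : S.InjOn π)
    {f : TropPoly K M} (hf : (f.coeff.support : Set M) ⊆ S) {m : M} (hm : m ∈ S) :
    tropCoeff (AddMonoidAlgebra.mapDomainRingHom K π f) (π m) = tropCoeff f m := by
  refine le_antisymm (tropCoeff_mapDomain_le π f m) (le_tropCoeff_mapDomain π f _ _ ?_)
  intro m' hm' he
  rw [hπ (hf hm') hm he]

theorem exists_tropCoeff_mapDomain (π : M →+ M') (f : TropPoly K M) {u : M'}
    (hu : u ∈ (AddMonoidAlgebra.mapDomainRingHom K π f).coeff.support) :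
    ∃ m ∈ f.coeff.support, π m = u ∧
      tropCoeff f m ≤ tropCoeff (AddMonoidAlgebra.mapDomainRingHom K π f) u := by
  classical
  obtain ⟨m₀, hm₀, hm₀u⟩ := (mem_support_mapDomain π f u).mp hu
  obtain ⟨m, hm, hmin⟩ := (f.coeff.support.filter fun m => π m = u).exists_min_image
    (fun m => tropCoeff f m) ⟨m₀, Finset.mem_filter.mpr ⟨hm₀, hm₀u⟩⟩
  obtain ⟨hm1, hm2⟩ := Finset.mem_filter.mp hm
  exact ⟨m, hm1, hm2, le_tropCoeff_mapDomain π f _ _ fun m' h1 h2 =>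
    hmin m' (Finset.mem_filter.mpr ⟨h1, h2⟩)⟩

theorem initialForm_mapDomain (π : M →+ M') (wt : M' → ℝ) (f : TropPoly K M) :
    initialForm wt (AddMonoidAlgebra.mapDomainRingHom K π f) =
      AddMonoidAlgebra.mapDomainRingHom booleanSemiring π (initialForm (wt ∘ π) f) := by
  set g := AddMonoidAlgebra.mapDomainRingHom K π f with hg
  have hle : ∀ m ∈ f.coeff.support, π m ∈ g.coeff.support ∧
      realCoeff g (π m) ≤ realCoeff f m := by
    intro m hm
    have h1 : π m ∈ g.coeff.support := (mem_support_mapDomain π f _).mpr ⟨m, hm, rfl⟩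
    refine ⟨h1, ?_⟩
    have := tropCoeff_mapDomain_le π f m
    rw [← hg, ← coe_realCoeff hm, ← coe_realCoeff h1] at this
    exact_mod_cast this
  have hex : ∀ u ∈ g.coeff.support, ∃ m ∈ f.coeff.support, π m = u ∧
      realCoeff f m ≤ realCoeff g u := by
    intro u hu
    obtain ⟨m, hm, hmu, h⟩ := exists_tropCoeff_mapDomain π f hu
    refine ⟨m, hm, hmu, ?_⟩
    rw [← hg, ← coe_realCoeff hm, ← coe_realCoeff hu] at h
    exact_mod_cast h
  refine boolean_ext fun u => ?_
  rw [mem_support_mapDomain, support_initialForm]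
  simp only [support_initialForm]
  constructor
  · intro hu
    obtain ⟨hu1, hu2⟩ := mem_minTerms.mp hu
    obtain ⟨m, hm, rfl, hmu⟩ := hex u hu1
    refine ⟨m, mem_minTerms.mpr ⟨hm, fun v hv => ?_⟩, rfl⟩
    have h1 := hu2 _ (hle v hv).1
    have h2 := (hle v hv).2
    simp only [Function.comp_apply]
    linarith
  · rintro ⟨m, hm, rfl⟩
    obtain ⟨hm1, hm2⟩ := mem_minTerms.mp hm
    refine mem_minTerms.mpr ⟨(hle m hm1).1, fun v hv => ?_⟩
    obtain ⟨x, hx, rfl, hxv⟩ := hex v hv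
    have h1 := hm2 x hx
    have h2 := (hle m hm1).2
    simp only [Function.comp_apply] at h1
    linarith

end MapDomain

section Localization

variable {K : Subsemiring TropicalReal} {N n : ℕ} {π : (Fin N →₀ ℕ) →+ (Fin n → ℤ)}

theorem single_mul_single_neg {n : ℕ} (a : Fin n → ℤ) (f : Laurent K n) :
    AddMonoidAlgebra.single (-a) 1 * (AddMonoidAlgebra.single a 1 * f) = f := by
  rw [← mul_assoc, AddMonoidAlgebra.single_mul_single, neg_add_cancel, one_mul]
  exact one_mul f

/-- The extension of an ideal along a substitution that becomes surjective on exponents after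
forming differences is a localization: its elements are the images divided by monomials. -/
theorem mem_map_mapDomain (hπ : ∀ b : Fin n → ℤ, ∃ m m', π m + b = π m')
    {L : Ideal (OrdPoly K N)} {f : Laurent K n} :
    f ∈ L.map (AddMonoidAlgebra.mapDomainRingHom K π) ↔ ∃ m, ∃ l ∈ L,
      AddMonoidAlgebra.single (π m) 1 * f = AddMonoidAlgebra.mapDomainRingHom K π l := by
  have hadd : ∀ f g : Laurent K n,
      (∃ m, ∃ l ∈ L, AddMonoidAlgebra.single (π m) 1 * f =
        AddMonoidAlgebra.mapDomainRingHom K π l) →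
      (∃ m, ∃ l ∈ L, AddMonoidAlgebra.single (π m) 1 * g =
        AddMonoidAlgebra.mapDomainRingHom K π l) →
      ∃ m, ∃ l ∈ L, AddMonoidAlgebra.single (π m) 1 * (f + g) =
        AddMonoidAlgebra.mapDomainRingHom K π l := by
    rintro f g ⟨m, l, hl, h⟩ ⟨m', l', hl', h'⟩
    refine ⟨m + m', AddMonoidAlgebra.single m' 1 * l + AddMonoidAlgebra.single m 1 * l',
      add_mem (L.mul_mem_left _ hl) (L.mul_mem_left _ hl'), ?_⟩
    rw [map_add, map_add, map_mul, map_mul, mapDomainRingHom_single, mapDomainRingHom_single, ← h,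
      ← h', mul_add, ← mul_assoc, ← mul_assoc, AddMonoidAlgebra.single_mul_single,
      AddMonoidAlgebra.single_mul_single, one_mul, add_comm (π m') (π m)]
  constructor
  · intro hf
    induction hf using Submodule.span_induction with
    | mem x hx =>
      obtain ⟨l, hl, rfl⟩ := hx
      refine ⟨0, l, hl, ?_⟩
      rw [map_zero]
      exact one_mul _
    | zero => exact ⟨0, 0, zero_mem _, by rw [mul_zero, map_zero]⟩
    | add f g _ _ hf hg => exact hadd f g hf hg
    | smul a f _ hf =>
      rw [smul_eq_mul]
      induction a using AddMonoidAlgebra.induction_linear with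
      | zero => exact ⟨0, 0, zero_mem _, by rw [zero_mul, mul_zero, map_zero]⟩
      | add a b ha hb => rw [add_mul]; exact hadd _ _ ha hb
      | single b c =>
        obtain ⟨m, l, hl, h⟩ := hf
        obtain ⟨m₁, m₂, hb⟩ := hπ b
        refine ⟨m + m₁, AddMonoidAlgebra.single m₂ c * l, L.mul_mem_left _ hl, ?_⟩
        rw [map_mul, mapDomainRingHom_single, ← h, ← mul_assoc, ← mul_assoc,
          AddMonoidAlgebra.single_mul_single, AddMonoidAlgebra.single_mul_single, map_add,
          one_mul, mul_one, ← hb]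
        congr 2
        abel
  · rintro ⟨m, l, hl, h⟩
    rw [← single_mul_single_neg (π m) f, h]
    exact Ideal.mul_mem_left _ _ (Ideal.mem_map_of_mem _ hl)

theorem initialForm_single_mul {n : ℕ} {wt : (Fin n → ℤ) → ℝ}
    (hwt : ∀ u v, wt (u + v) = wt u + wt v)
    (a : Fin n → ℤ) (f : Laurent K n) :
    initialForm wt (AddMonoidAlgebra.single a 1 * f) =
      AddMonoidAlgebra.single a 1 * initialForm wt f := by
  refine boolean_ext fun u => ?_
  rw [support_initialForm, mem_minTerms_single_mul hwt a one_ne_zero,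
    mem_support_single_mul a one_ne_zero, support_initialForm]

theorem initialIdealWt_map (hπ : ∀ b : Fin n → ℤ, ∃ m m', π m + b = π m')
    {wt : (Fin n → ℤ) → ℝ} (hwt : ∀ u v, wt (u + v) = wt u + wt v) (L : Ideal (OrdPoly K N)) :
    initialIdealWt wt (L.map (AddMonoidAlgebra.mapDomainRingHom K π)) =
      (initialIdealWt (wt ∘ π) L).map (AddMonoidAlgebra.mapDomainRingHom booleanSemiring π) := by
  apply le_antisymm
  · refine Ideal.span_le.mpr ?_
    rintro _ ⟨f, hf, rfl⟩
    obtain ⟨m, l, hl, h⟩ := (mem_map_mapDomain hπ).mp hf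
    have h1 := initialForm_single_mul hwt (π m) f
    rw [h, initialForm_mapDomain] at h1
    rw [SetLike.mem_coe, ← single_mul_single_neg (π m) (initialForm wt f), ← h1]
    exact Ideal.mul_mem_left _ _ (Ideal.mem_map_of_mem _ (initialForm_mem hl))
  · rw [Ideal.map_le_iff_le_comap]
    refine Ideal.span_le.mpr ?_
    rintro _ ⟨l, hl, rfl⟩
    rw [SetLike.mem_coe, Ideal.mem_comap, ← initialForm_mapDomain]
    exact initialForm_mem (Ideal.mem_map_of_mem _ hl)

end Localization

/-! ### Setting `x₀ = 1` -/

section Dehomogenization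

variable {n : ℕ}

/-- The exponent of the Laurent monomial obtained from a monomial by setting `x₀ = 1`. -/
def dehomExponent (n : ℕ) : (Fin (n + 1) →₀ ℕ) →+ (Fin n → ℤ) where
  toFun m i := (m i.succ : ℤ)
  map_zero' := by ext; simp
  map_add' := by intros; ext; simp

/-- Setting `x₀ = 1` in a polynomial. -/
def dehomogenize (K : Subsemiring TropicalReal) (n : ℕ) : OrdPoly K (n + 1) →+* Laurent K n :=
  AddMonoidAlgebra.mapDomainRingHom K (dehomExponent n)

theorem exists_dehomExponent_add (b : Fin n → ℤ) :
    ∃ m m', dehomExponent n m + b = dehomExponent n m' := by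
  refine ⟨Finsupp.equivFunOnFinite.symm (Fin.cons 0 fun i => (-b i).toNat),
    Finsupp.equivFunOnFinite.symm (Fin.cons 0 fun i => (b i).toNat), ?_⟩
  ext i
  simp only [dehomExponent, AddMonoidHom.coe_mk, ZeroHom.coe_mk, Pi.add_apply,
    Finsupp.equivFunOnFinite_symm_apply_apply, Fin.cons_succ]
  omega

theorem homWt_eq (w : Fin n → ℝ) : homWt w = dotWt w ∘ dehomExponent n := by
  funext m
  simp [homWt, dotWt, dehomExponent, Fin.sum_univ_succ]

theorem dotWt_add (w : Fin n → ℝ) (u v : Fin n → ℤ) : dotWt w (u + v) = dotWt w u + dotWt w v := by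
  simp [dotWt, add_mul, Finset.sum_add_distrib]

/-- The value `homWt w` of a monomial at `(0, w)` as an additive homomorphism. -/
def homWtHom (w : Fin n → ℝ) : (Fin (n + 1) →₀ ℕ) →+ ℝ where
  toFun := homWt w
  map_zero' := by simp [homWt]
  map_add' u v := by
    rw [homWt_eq, Function.comp_apply, map_add, dotWt_add]
    rfl

theorem homWt_add_smul (w v : Fin n → ℝ) (ε : ℝ) :
    homWt (w + ε • v) = (homWtHom w + ε • homWtHom v : (Fin (n + 1) →₀ ℕ) →+ ℝ) := by
  funext m
  change homWt (w + ε • v) m = homWt w m + ε * homWt v m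
  simp only [homWt_eq, Function.comp_apply, dotWt, Pi.add_apply, Pi.smul_apply, smul_eq_mul]
  rw [Finset.mul_sum, ← Finset.sum_add_distrib]
  exact Finset.sum_congr rfl fun i _ => by ring

variable {K : Subsemiring TropicalReal}

theorem initialIdeal_map (w : Fin n → ℝ) (L : Ideal (OrdPoly K (n + 1))) :
    initialIdeal w (L.map (dehomogenize K n)) =
      (initialIdealWt (homWt w) L).map (dehomogenize booleanSemiring n) := by
  rw [homWt_eq]
  exact initialIdealWt_map exists_dehomExponent_add (dotWt_add w) L

theorem dehomExponent_injOn (d : ℕ) :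
    (monomialsOfDegree (n + 1) d : Set (Fin (n + 1) →₀ ℕ)).InjOn (dehomExponent n) := by
  intro m hm m' hm' h
  have hs : ∀ i : Fin n, m i.succ = m' i.succ := fun i => by
    have : (m i.succ : ℤ) = m' i.succ := congrFun h i
    exact_mod_cast this
  have h1 := mem_monomialsOfDegree.mp hm
  have h2 := mem_monomialsOfDegree.mp hm'
  rw [Fin.sum_univ_succ] at h1 h2
  simp only [hs] at h1
  ext i
  refine Fin.cases ?_ hs i
  omega

theorem restrictTo_add {M : Type} (E : Set M) (f g : TropPoly K M) :
    restrictTo E (f + g) = restrictTo E f + restrictTo E g := by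
  classical
  ext1
  exact Finsupp.filter_add

theorem restrictTo_of_subset {M : Type} {E : Set M} {f : TropPoly K M}
    (h : (f.coeff.support : Set M) ⊆ E) : restrictTo E f = f := by
  classical
  ext u
  by_cases hu : u ∈ E
  · rw [coeff_restrictTo_of_mem f hu]
  · rw [coeff_restrictTo_of_notMem f hu, eq_comm]
    rw [Finsupp.notMem_support_iff.mp fun h' => hu (h h')]

theorem restrictTo_of_disjoint {M : Type} {E : Set M} {f : TropPoly K M}
    (h : ∀ u ∈ f.coeff.support, u ∉ E) : restrictTo E f = 0 := by
  classical
  ext u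
  by_cases hu : u ∈ E
  · rw [coeff_restrictTo_of_mem f hu, Finsupp.notMem_support_iff.mp fun h' => h u h' hu]
    rfl
  · rw [coeff_restrictTo_of_notMem f hu]
    rfl

theorem restrictTo_restrictTo_of_disjoint {M : Type} {E E' : Set M} (h : Disjoint E E')
    (f : TropPoly K M) : restrictTo E (restrictTo E' f) = 0 :=
  restrictTo_of_disjoint fun _ hu hE =>
    Set.disjoint_left.mp h hE (mem_support_restrictTo.mp hu).2

theorem disjoint_monomialsOfDegree {N d d' : ℕ} (h : d ≠ d') :
    Disjoint (monomialsOfDegree N d : Set (Fin N →₀ ℕ)) (monomialsOfDegree N d') :=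
  Set.disjoint_left.mpr fun _ h1 h2 =>
    h ((mem_monomialsOfDegree.mp h1).symm.trans (mem_monomialsOfDegree.mp h2))

theorem restrictTo_single_mul {N : ℕ} (a : Fin N →₀ ℕ) (c : K) (f : OrdPoly K N) (d : ℕ) :
    restrictTo (monomialsOfDegree N (∑ i, a i + d) : Set (Fin N →₀ ℕ))
      (AddMonoidAlgebra.single a c * f) = AddMonoidAlgebra.single a c *
        restrictTo (monomialsOfDegree N d : Set (Fin N →₀ ℕ)) f := by
  refine AddMonoidAlgebra.coeff_injective (Finsupp.ext fun u => ?_)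
  by_cases ha : ∃ v, a + v = u
  · obtain ⟨v, rfl⟩ := ha
    have hiff : a + v ∈ (monomialsOfDegree N (∑ i, a i + d) : Set (Fin N →₀ ℕ)) ↔
        v ∈ (monomialsOfDegree N d : Set (Fin N →₀ ℕ)) := by
      rw [Finset.mem_coe, Finset.mem_coe, mem_monomialsOfDegree, mem_monomialsOfDegree]
      simp [Finset.sum_add_distrib]
    rw [AddMonoidAlgebra.coeff_single_mul_add]
    by_cases hv : v ∈ (monomialsOfDegree N d : Set (Fin N →₀ ℕ))
    · rw [coeff_restrictTo_of_mem _ (hiff.mpr hv), coeff_restrictTo_of_mem _ hv,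
        AddMonoidAlgebra.coeff_single_mul_add]
    · rw [coeff_restrictTo_of_notMem _ (fun h => hv (hiff.mp h)), coeff_restrictTo_of_notMem _ hv,
        mul_zero]
  · push Not at ha
    rw [AddMonoidAlgebra.coeff_single_mul_of_forall_add_ne _ _ ha]
    by_cases hu : u ∈ (monomialsOfDegree N (∑ i, a i + d) : Set (Fin N →₀ ℕ))
    · rw [coeff_restrictTo_of_mem _ hu,
        AddMonoidAlgebra.coeff_single_mul_of_forall_add_ne _ _ ha]
    · rw [coeff_restrictTo_of_notMem _ hu]

theorem restrictTo_single_mul_of_lt {N : ℕ} (a : Fin N →₀ ℕ) (c : K) (f : OrdPoly K N) {d : ℕ}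
    (hd : d < ∑ i, a i) : restrictTo (monomialsOfDegree N d : Set (Fin N →₀ ℕ))
      (AddMonoidAlgebra.single a c * f) = 0 := by
  classical
  refine restrictTo_of_disjoint fun u hu huE => ?_
  obtain ⟨v, _, rfl⟩ := Finset.mem_image.mp
    (AddMonoidAlgebra.support_coeff_single_mul_subset f c a hu)
  have := mem_monomialsOfDegree.mp huE
  simp only [Finsupp.add_apply, Finset.sum_add_distrib] at this
  omega

theorem eq_sum_restrictTo {N : ℕ} (f : OrdPoly K N) :
    f = ∑ d ∈ f.coeff.support.image (fun u => ∑ i, u i),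
      restrictTo (monomialsOfDegree N d : Set (Fin N →₀ ℕ)) f := by
  classical
  refine tropPoly_ext fun u => ?_
  rw [tropCoeff_sum]
  refine le_antisymm (Finset.le_inf fun d _ => ?_) ?_
  · by_cases hu : u ∈ (restrictTo (monomialsOfDegree N d : Set (Fin N →₀ ℕ)) f).coeff.support
    · unfold tropCoeff
      rw [coeff_restrictTo_of_mem f (mem_support_restrictTo.mp hu).2]
    · rw [tropCoeff_of_notMem hu]; exact le_top
  · by_cases hu : u ∈ f.coeff.support
    · refine (Finset.inf_le (Finset.mem_image_of_mem _ hu)).trans ?_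
      unfold tropCoeff
      rw [coeff_restrictTo_of_mem f (mem_monomialsOfDegree.mpr rfl)]
    · rw [tropCoeff_of_notMem hu]; exact le_top

/-- The ideal of the polynomials in `x₀, …, xₙ` all of whose homogeneous parts are mapped to `J`
by setting `x₀ = 1`. -/
def homogeneousLift (J : Ideal (Laurent K n)) : Ideal (OrdPoly K (n + 1)) where
  carrier := {h | ∀ d, dehomogenize K n
    (restrictTo (monomialsOfDegree (n + 1) d : Set (Fin (n + 1) →₀ ℕ)) h) ∈ J}
  zero_mem' d := by
    rw [restrictTo_of_disjoint (by simp), map_zero]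
    exact zero_mem _
  add_mem' hf hg d := by
    rw [restrictTo_add, map_add]
    exact add_mem (hf d) (hg d)
  smul_mem' a f hf := by
    rw [smul_eq_mul]
    induction a using AddMonoidAlgebra.induction_linear with
    | zero =>
      intro d
      rw [zero_mul, restrictTo_of_disjoint (by simp), map_zero]
      exact zero_mem _
    | add a b ha hb =>
      intro d
      rw [add_mul, restrictTo_add, map_add]
      exact add_mem (ha d) (hb d)
    | single a c =>
      intro d
      rcases le_or_gt (∑ i, a i) d with h | h
      · obtain ⟨d', rfl⟩ := Nat.exists_eq_add_of_le h
        rw [restrictTo_single_mul, map_mul]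
        exact Ideal.mul_mem_left _ _ (hf d')
      · rw [restrictTo_single_mul_of_lt a c f h, map_zero]
        exact zero_mem _

theorem mem_homogeneousLift {J : Ideal (Laurent K n)} {h : OrdPoly K (n + 1)} :
    h ∈ homogeneousLift J ↔ ∀ d, dehomogenize K n
      (restrictTo (monomialsOfDegree (n + 1) d : Set (Fin (n + 1) →₀ ℕ)) h) ∈ J := Iff.rfl

theorem mem_homogeneousLift_of_subset {J : Ideal (Laurent K n)} {h : OrdPoly K (n + 1)} {d : ℕ}
    (hd : (h.coeff.support : Set (Fin (n + 1) →₀ ℕ)) ⊆ monomialsOfDegree (n + 1) d) :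
    h ∈ homogeneousLift J ↔ dehomogenize K n h ∈ J := by
  constructor
  · intro hh
    have := mem_homogeneousLift.mp hh d
    rwa [restrictTo_of_subset hd] at this
  · intro hh d'
    by_cases hdd : d' = d
    · subst hdd
      rwa [restrictTo_of_subset hd]
    · rw [restrictTo_of_disjoint fun u hu hu' =>
        Set.disjoint_left.mp (disjoint_monomialsOfDegree hdd) hu' (hd hu), map_zero]
      exact zero_mem _

theorem isRestrictable_homogeneousLift (J : Ideal (Laurent K n)) (d : ℕ) :
    IsRestrictable (homogeneousLift J)
      (monomialsOfDegree (n + 1) d : Set (Fin (n + 1) →₀ ℕ)) := by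
  intro f hf
  rw [mem_homogeneousLift_of_subset (d := d) fun u hu => (mem_support_restrictTo.mp hu).2]
  exact hf d

/-- The homogeneous polynomial of degree `d` that becomes `k` for `x₀ = 1`. Terms of `k` which do
not come from monomials of degree `d` are dropped. -/
def liftToDegree (d : ℕ) (k : Laurent K n) : OrdPoly K (n + 1) :=
  ∑ m ∈ monomialsOfDegree (n + 1) d,
    AddMonoidAlgebra.single m (k.coeff (dehomExponent n m))

theorem coeff_liftToDegree_of_mem {d : ℕ} (k : Laurent K n) {m : Fin (n + 1) →₀ ℕ}
    (hm : m ∈ monomialsOfDegree (n + 1) d) :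
    (liftToDegree d k).coeff m = k.coeff (dehomExponent n m) := by
  unfold liftToDegree
  rw [AddMonoidAlgebra.coeff_sum, Finsupp.finsetSum_apply, Finset.sum_eq_single m]
  · rw [AddMonoidAlgebra.coeff_single, Finsupp.single_eq_same]
  · intro b _ hb
    rw [AddMonoidAlgebra.coeff_single, Finsupp.single_eq_of_ne hb.symm]
  · exact fun h => absurd hm h

theorem coeff_liftToDegree_of_notMem {d : ℕ} (k : Laurent K n) {m : Fin (n + 1) →₀ ℕ}
    (hm : m ∉ monomialsOfDegree (n + 1) d) : (liftToDegree d k).coeff m = 0 := by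
  unfold liftToDegree
  rw [AddMonoidAlgebra.coeff_sum, Finsupp.finsetSum_apply]
  refine Finset.sum_eq_zero fun b hb => ?_
  rw [AddMonoidAlgebra.coeff_single, Finsupp.single_eq_of_ne]
  exact fun h => hm (h ▸ hb)

theorem support_liftToDegree (d : ℕ) (k : Laurent K n) :
    ((liftToDegree d k).coeff.support : Set (Fin (n + 1) →₀ ℕ)) ⊆
      monomialsOfDegree (n + 1) d := by
  intro m hm
  by_contra h
  exact Finsupp.mem_support_iff.mp hm (coeff_liftToDegree_of_notMem k h)

theorem dehomogenize_liftToDegree {d : ℕ} {k : Laurent K n}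
    (hk : ∀ u ∈ k.coeff.support, ∃ m ∈ monomialsOfDegree (n + 1) d, dehomExponent n m = u) :
    dehomogenize K n (liftToDegree d k) = k := by
  refine tropPoly_ext fun u => ?_
  by_cases hu : ∃ m ∈ monomialsOfDegree (n + 1) d, dehomExponent n m = u
  · obtain ⟨m, hm, rfl⟩ := hu
    unfold dehomogenize
    rw [tropCoeff_mapDomain_of_injOn (dehomExponent_injOn d) (support_liftToDegree d k) hm]
    unfold tropCoeff
    rw [coeff_liftToDegree_of_mem k hm]
  · rw [tropCoeff_of_notMem fun h => hu (hk u h), tropCoeff_of_notMem]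
    intro h
    obtain ⟨m, hm, hmu⟩ := (mem_support_mapDomain _ _ u).mp h
    exact hu ⟨m, support_liftToDegree d k hm, hmu⟩

/-- Elimination of `x^u` takes place in the degree of `x^u`, where it is inherited from `J` because
setting `x₀ = 1` is injective on the monomials of one degree. In the other degrees `f + g` serves.
-/
theorem isTropicalIdeal_homogeneousLift {J : Ideal (Laurent K n)} (hJ : IsTropicalIdeal J) :
    IsTropicalIdeal (homogeneousLift J) := by
  intro f hf g hg u hfg hfu
  set d := ∑ i, u i with hd
  set E : Set (Fin (n + 1) →₀ ℕ) := ↑(monomialsOfDegree (n + 1) d) with hE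
  have huE : u ∈ E := mem_monomialsOfDegree.mpr rfl
  have hco : ∀ (p : OrdPoly K (n + 1)) (m : Fin (n + 1) →₀ ℕ), m ∈ E →
      tropCoeff (dehomogenize K n (restrictTo E p)) (dehomExponent n m) = tropCoeff p m := by
    intro p m hm
    unfold dehomogenize
    rw [tropCoeff_mapDomain_of_injOn (dehomExponent_injOn d)
      (fun u hu => (mem_support_restrictTo.mp hu).2) hm]
    unfold tropCoeff
    rw [coeff_restrictTo_of_mem p hm]
  obtain ⟨k, hk, hku, hkmin⟩ := hJ _ (hf d) _ (hg d) (dehomExponent n u)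
    (by rw [hco f u huE, hco g u huE, hfg]) (by rwa [hco f u huE])
  have hkE : ∀ v ∈ k.coeff.support, ∃ m ∈ monomialsOfDegree (n + 1) d,
      dehomExponent n m = v := by
    intro v hv
    have h1 := ne_top_of_le_ne_top (mem_support_iff_tropCoeff.mp hv) (hkmin v).1
    rw [ne_eq, min_eq_top, not_and_or] at h1
    have hgen : ∀ p : OrdPoly K (n + 1),
        tropCoeff (dehomogenize K n (restrictTo E p)) v ≠ ⊤ →
        ∃ m ∈ monomialsOfDegree (n + 1) d, dehomExponent n m = v := by
      intro p hp
      obtain ⟨m, hm, hmv⟩ := (mem_support_mapDomain _ _ v).mp (mem_support_iff_tropCoeff.mpr hp)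
      exact ⟨m, (mem_support_restrictTo.mp hm).2, hmv⟩
    exact h1.elim (hgen f) (hgen g)
  have hlift : liftToDegree d k ∈ homogeneousLift J := by
    rw [mem_homogeneousLift_of_subset (support_liftToDegree d k), dehomogenize_liftToDegree hkE]
    exact hk
  have hrest : restrictTo Eᶜ (f + g) ∈ homogeneousLift J := by
    intro d'
    by_cases hdd : d' = d
    · subst hdd
      rw [restrictTo_restrictTo_of_disjoint disjoint_compl_right, map_zero]
      exact zero_mem _
    · have : restrictTo (monomialsOfDegree (n + 1) d' : Set (Fin (n + 1) →₀ ℕ))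
          (restrictTo Eᶜ (f + g)) =
          restrictTo (monomialsOfDegree (n + 1) d' : Set (Fin (n + 1) →₀ ℕ)) (f + g) := by
        refine AddMonoidAlgebra.coeff_injective (Finsupp.ext fun m => ?_)
        by_cases hm : m ∈ (monomialsOfDegree (n + 1) d' : Set (Fin (n + 1) →₀ ℕ))
        · rw [coeff_restrictTo_of_mem _ hm, coeff_restrictTo_of_mem _ hm,
            coeff_restrictTo_of_mem _ (show m ∈ Eᶜ from
              fun h => Set.disjoint_left.mp (disjoint_monomialsOfDegree hdd) hm h)]
        · rw [coeff_restrictTo_of_notMem _ hm, coeff_restrictTo_of_notMem _ hm]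
      rw [this]
      exact (add_mem hf hg : f + g ∈ homogeneousLift J) d'
  have h1 : ∀ m ∈ E, tropCoeff (liftToDegree d k + restrictTo Eᶜ (f + g)) m =
      tropCoeff k (dehomExponent n m) := by
    intro m hm
    have e1 : tropCoeff (restrictTo Eᶜ (f + g)) m = ⊤ :=
      tropCoeff_eq_top.mpr (coeff_restrictTo_of_notMem _ fun h => h hm)
    rw [tropCoeff_add, e1, min_eq_left le_top]
    unfold tropCoeff
    rw [coeff_liftToDegree_of_mem k hm]
  have h2 : ∀ m ∉ E, tropCoeff (liftToDegree d k + restrictTo Eᶜ (f + g)) m =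
      min (tropCoeff f m) (tropCoeff g m) := by
    intro m hm
    have e1 : tropCoeff (liftToDegree d k) m = ⊤ :=
      tropCoeff_eq_top.mpr (coeff_liftToDegree_of_notMem k hm)
    rw [tropCoeff_add, e1, min_eq_right le_top, ← tropCoeff_add]
    unfold tropCoeff
    rw [coeff_restrictTo_of_mem _ (by exact hm)]
  refine ⟨_, add_mem hlift hrest, by rw [h1 u huE, hku], fun v => ?_⟩
  by_cases hv : v ∈ E
  · rw [h1 v hv, ← hco f v hv, ← hco g v hv]
    exact hkmin _
  · rw [h2 v hv]
    exact ⟨le_rfl, fun _ => rfl⟩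

theorem isGradedTropical_homogeneousLift {J : Ideal (Laurent K n)} (hJ : IsTropicalIdeal J) :
    IsGradedTropical (homogeneousLift J) :=
  ⟨isTropicalIdeal_homogeneousLift hJ, isRestrictable_homogeneousLift J⟩

end Dehomogenization

/-! ### The homogenization of an ideal of Laurent polynomials -/

section Homogenization

variable {n : ℕ} {K : Subsemiring TropicalReal}

/-- The exponent map underlying `toLaurent`. -/
def laurentExponent (n : ℕ) : (Fin n →₀ ℕ) →+ (Fin n → ℤ) where
  toFun u i := (u i : ℤ)
  map_zero' := by ext; simp
  map_add' := by intros; ext; simp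

theorem toLaurent_eq_sum (f : OrdPoly K n) : toLaurent K n f =
    ∑ u ∈ f.coeff.support, AddMonoidAlgebra.single (laurentExponent n u) (f.coeff u) :=
  mapDomainRingHom_eq_sum (laurentExponent n) f

theorem dehomExponent_cons (a : ℕ) (u : Fin n →₀ ℕ) :
    dehomExponent n (Finsupp.cons a u) = laurentExponent n u := by
  ext i
  simp [dehomExponent, laurentExponent]

theorem dehomogenize_homogenizePoly (f : OrdPoly K n) :
    dehomogenize K n (homogenizePoly f) = toLaurent K n f := by
  unfold homogenizePoly dehomogenize
  rw [map_sum, toLaurent_eq_sum]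
  refine Finset.sum_congr rfl fun u _ => ?_
  rw [mapDomainRingHom_single, dehomExponent_cons]

theorem support_homogenizePoly (f : OrdPoly K n) :
    ((homogenizePoly f).coeff.support : Set (Fin (n + 1) →₀ ℕ)) ⊆
      monomialsOfDegree (n + 1) (tropDegree f) := by
  intro m hm
  obtain ⟨u, hu, hmu⟩ := (support_sum _ _ m).mp hm
  rw [AddMonoidAlgebra.coeff_single] at hmu
  rw [Finset.mem_singleton.mp (Finsupp.support_single_subset hmu)]
  refine mem_monomialsOfDegree.mpr ?_
  have : ∑ i, u i ≤ tropDegree f := Finset.le_sup (f := fun u : Fin n →₀ ℕ => ∑ i, u i) hu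
  rw [Fin.sum_univ_succ]
  simp only [Finsupp.cons_zero, Finsupp.cons_succ]
  omega

theorem homogenization_le (J : Ideal (Laurent K n)) : homogenization J ≤ homogeneousLift J := by
  refine Ideal.span_le.mpr ?_
  rintro _ ⟨f, hf, rfl⟩
  rw [SetLike.mem_coe, mem_homogeneousLift_of_subset (support_homogenizePoly f),
    dehomogenize_homogenizePoly]
  exact hf

/-- A homogeneous polynomial is the homogenization of its image for `x₀ = 1`, up to a power of
`x₀`. -/
theorem exists_eq_single_mul_homogenizePoly {h : OrdPoly K (n + 1)} {d : ℕ}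
    (hd : (h.coeff.support : Set (Fin (n + 1) →₀ ℕ)) ⊆ monomialsOfDegree (n + 1) d) :
    ∃ (f : OrdPoly K n) (a : Fin (n + 1) →₀ ℕ), toLaurent K n f = dehomogenize K n h ∧
      h = AddMonoidAlgebra.single a 1 * homogenizePoly f := by
  classical
  set p : (Fin (n + 1) →₀ ℕ) → (Fin n →₀ ℕ) := Finsupp.tail with hp
  set f : OrdPoly K n := AddMonoidAlgebra.mapDomain p h with hf
  have hcons : ∀ m ∈ monomialsOfDegree (n + 1) d,
      Finsupp.cons (d - ∑ i, p m i) (p m) = m := by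
    intro m hm
    have h1 := mem_monomialsOfDegree.mp hm
    rw [Fin.sum_univ_succ] at h1
    have h2 : ∑ i, p m i = ∑ i : Fin n, m i.succ := rfl
    have h3 : d - ∑ i, p m i = m 0 := by omega
    rw [h3]
    exact Finsupp.cons_tail m
  have hle : ∀ m ∈ monomialsOfDegree (n + 1) d, ∑ i, p m i ≤ d := by
    intro m hm
    have h1 := mem_monomialsOfDegree.mp hm
    rw [Fin.sum_univ_succ] at h1
    have h2 : ∑ i, p m i = ∑ i : Fin n, m i.succ := rfl
    omega
  have hinj : (monomialsOfDegree (n + 1) d : Set (Fin (n + 1) →₀ ℕ)).InjOn p := by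
    intro m hm m' hm' he
    rw [← hcons m hm, ← hcons m' hm', he]
  have hinj' : (h.coeff.support : Set (Fin (n + 1) →₀ ℕ)).InjOn p := hinj.mono hd
  have hsupp : f.coeff.support = h.coeff.support.image p :=
    Finsupp.mapDomain_support_of_injOn h.coeff hinj'
  have hcoeff : ∀ m ∈ h.coeff.support, f.coeff (p m) = h.coeff m := fun m hm =>
    Finsupp.mapDomain_apply' _ h.coeff subset_rfl hinj' hm
  have hsum : ∀ {R : Type} [AddCommMonoid R] (F : (Fin n →₀ ℕ) → K → R),
      ∑ u ∈ f.coeff.support, F u (f.coeff u) = ∑ m ∈ h.coeff.support, F (p m) (h.coeff m) := by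
    intro R _ F
    rw [hsupp, Finset.sum_image hinj']
    exact Finset.sum_congr rfl fun m hm => by rw [hcoeff m hm]
  have hdeg : tropDegree f ≤ d := Finset.sup_le fun u hu => by
    rw [hsupp] at hu
    obtain ⟨m, hm, rfl⟩ := Finset.mem_image.mp hu
    exact hle m (hd hm)
  have hdecomp : h = ∑ m ∈ h.coeff.support, AddMonoidAlgebra.single m (h.coeff m) := by
    apply AddMonoidAlgebra.coeff_injective
    rw [AddMonoidAlgebra.coeff_sum]
    exact (Finsupp.sum_single h.coeff).symm
  refine ⟨f, Finsupp.cons (d - tropDegree f) 0, ?_, ?_⟩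
  · rw [toLaurent_eq_sum, hsum fun u c => AddMonoidAlgebra.single (laurentExponent n u) c]
    unfold dehomogenize
    rw [mapDomainRingHom_eq_sum]
    refine Finset.sum_congr rfl fun m hm => ?_
    rw [← dehomExponent_cons (d - ∑ i, p m i), hcons m (hd hm)]
  · unfold homogenizePoly
    rw [hsum fun u c => AddMonoidAlgebra.single (Finsupp.cons (tropDegree f - ∑ i, u i) u) c,
      Finset.mul_sum]
    refine hdecomp.trans (Finset.sum_congr rfl fun m hm => ?_)
    rw [AddMonoidAlgebra.single_mul_single, one_mul]
    congr 1
    have h1 : ∑ i, p m i ≤ tropDegree f :=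
      Finset.le_sup (f := fun u : Fin n →₀ ℕ => ∑ i, u i)
        (hsupp ▸ Finset.mem_image_of_mem p hm)
    conv_lhs => rw [← hcons m (hd hm)]
    ext i
    refine Fin.cases ?_ (fun i => ?_) i
    · simp only [Finsupp.add_apply, Finsupp.cons_zero]
      omega
    · simp only [Finsupp.add_apply, Finsupp.cons_succ, Finsupp.zero_apply, zero_add]

/-- Membership in the homogenization can be tested on the homogeneous parts after setting
`x₀ = 1`. -/
theorem homogenization_eq (J : Ideal (Laurent K n)) : homogenization J = homogeneousLift J := by
  refine le_antisymm (homogenization_le J) fun h hh => ?_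
  rw [eq_sum_restrictTo h]
  refine Ideal.sum_mem _ fun d _ => ?_
  obtain ⟨f, a, h1, h2⟩ := exists_eq_single_mul_homogenizePoly
    (h := restrictTo (monomialsOfDegree (n + 1) d : Set (Fin (n + 1) →₀ ℕ)) h) (d := d)
    fun u hu => (mem_support_restrictTo.mp hu).2
  rw [h2]
  refine Ideal.mul_mem_left _ _ (Ideal.subset_span ⟨f, ?_, rfl⟩)
  rw [SetLike.mem_coe, Ideal.mem_comap, h1]
  exact hh d

theorem isGradedTropical_homogenization {J : Ideal (Laurent K n)} (hJ : IsTropicalIdeal J) :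
    IsGradedTropical (homogenization J) :=
  homogenization_eq J ▸ isGradedTropical_homogeneousLift hJ

theorem exists_single_mul_eq_toLaurent (f : Laurent K n) : ∃ (a : Fin n → ℤ) (g : OrdPoly K n),
    AddMonoidAlgebra.single a 1 * f = toLaurent K n g := by
  classical
  set a : Fin n → ℤ := fun i => ∑ u ∈ f.coeff.support, |u i| with ha
  have hpos : ∀ u ∈ f.coeff.support, ∀ i, 0 ≤ a i + u i := by
    intro u hu i
    have h1 : |u i| ≤ a i := Finset.single_le_sum (f := fun u : Fin n → ℤ => |u i|)
      (fun _ _ => abs_nonneg _) hu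
    have := neg_abs_le (u i)
    omega
  refine ⟨a, ∑ u ∈ f.coeff.support, AddMonoidAlgebra.single
    (Finsupp.equivFunOnFinite.symm fun i => (a i + u i).toNat) (f.coeff u), ?_⟩
  have hdecomp : f = ∑ m ∈ f.coeff.support, AddMonoidAlgebra.single m (f.coeff m) := by
    apply AddMonoidAlgebra.coeff_injective
    rw [AddMonoidAlgebra.coeff_sum]
    exact (Finsupp.sum_single f.coeff).symm
  rw [map_sum]
  conv_lhs => rw [hdecomp, Finset.mul_sum]
  refine Finset.sum_congr rfl fun u hu => ?_
  rw [AddMonoidAlgebra.single_mul_single, one_mul]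
  have : toLaurent K n (AddMonoidAlgebra.single
      (Finsupp.equivFunOnFinite.symm fun i => (a i + u i).toNat) (f.coeff u)) =
      AddMonoidAlgebra.single (laurentExponent n
        (Finsupp.equivFunOnFinite.symm fun i => (a i + u i).toNat)) (f.coeff u) :=
    mapDomainRingHom_single (laurentExponent n) _ _
  rw [this]
  congr 1
  ext i
  have := hpos u hu i
  simp only [laurentExponent, AddMonoidHom.coe_mk, ZeroHom.coe_mk,
    Finsupp.equivFunOnFinite_symm_apply_apply, Pi.add_apply]
  omega

theorem map_homogenization (J : Ideal (Laurent K n)) :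
    (homogenization J).map (dehomogenize K n) = J := by
  apply le_antisymm
  · rw [Ideal.map_le_iff_le_comap]
    refine Ideal.span_le.mpr ?_
    rintro _ ⟨f, hf, rfl⟩
    rw [SetLike.mem_coe, Ideal.mem_comap, dehomogenize_homogenizePoly]
    exact hf
  · intro f hf
    obtain ⟨a, g, hg⟩ := exists_single_mul_eq_toLaurent f
    rw [← single_mul_single_neg a f, hg, ← dehomogenize_homogenizePoly]
    refine Ideal.mul_mem_left _ _ (Ideal.mem_map_of_mem _ (Ideal.subset_span ⟨g, ?_, rfl⟩))
    rw [SetLike.mem_coe, Ideal.mem_comap, ← hg]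
    exact Ideal.mul_mem_left _ _ hf

theorem initialIdeal_eq_map (J : Ideal (Laurent K n)) (w : Fin n → ℝ) :
    initialIdeal w J =
      (initialIdealWt (homWt w) (homogenization J)).map (dehomogenize booleanSemiring n) := by
  rw [← initialIdeal_map, map_homogenization]

theorem initialIdeal_initialIdeal_eq_map (J : Ideal (Laurent K n)) (w v : Fin n → ℝ) :
    initialIdeal v (initialIdeal w J) =
      (initialIdealWt (homWt v) (initialIdealWt (homWt w) (homogenization J))).map
        (dehomogenize booleanSemiring n) := by
  rw [initialIdeal_eq_map J w, initialIdeal_map]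

theorem IsGradedTropical.exists_homWt (hK : IsDivisible K) {L : Ideal (OrdPoly K (n + 1))}
    (hL : IsGradedTropical L) (w v : Fin n → ℝ) : ∃ ε₀ > (0 : ℝ), ∀ ε : ℝ, 0 < ε → ε < ε₀ →
      _root_.initialIdealWt (homWt v) (_root_.initialIdealWt (homWt w) L) =
        _root_.initialIdealWt (homWt (w + ε • v)) L := by
  obtain ⟨ε₀, hε₀, h⟩ := hL.exists_initialIdealWt_eq hK (homWtHom w) (homWtHom v)
  refine ⟨ε₀, hε₀, fun ε h1 h2 => ?_⟩
  rw [homWt_add_smul]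
  exact h ε h1 h2

theorem IsGradedTropical.convex_homWt (hK : IsDivisible K) {L : Ideal (OrdPoly K (n + 1))}
    (hL : IsGradedTropical L) (w : Fin n → ℝ) :
    Convex ℝ {w' | _root_.initialIdealWt (homWt w') L = _root_.initialIdealWt (homWt w) L} := by
  rw [convex_iff_forall_pos]
  intro x hx y hy a b ha hb hab
  obtain rfl : a = 1 - b := by linarith
  have := hL.initialIdealWt_convex hK (wt₀ := homWtHom x) (wt₁ := homWtHom y)
    (wts := homWtHom ((1 - b) • x + b • y)) hb (by linarith) (fun u => ?_) (hx.trans hy.symm)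
  · exact this.trans hx
  · change homWt ((1 - b) • x + b • y) u = (1 - b) * homWt x u + b * homWt y u
    simp only [homWt_eq, Function.comp_apply, dotWt, Pi.add_apply, Pi.smul_apply, smul_eq_mul]
    rw [Finset.mul_sum, Finset.mul_sum, ← Finset.sum_add_distrib]
    exact Finset.sum_congr rfl fun i _ => by ring

theorem exists_initialIdeal_eq (hK : IsDivisible K) {J : Ideal (Laurent K n)}
    (hJ : IsTropicalIdeal J) (w v : Fin n → ℝ) : ∃ ε₀ > (0 : ℝ), ∀ ε : ℝ, 0 < ε → ε < ε₀ →
      initialIdeal v (initialIdeal w J) = initialIdeal (w + ε • v) J := by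
  obtain ⟨ε₀, hε₀, h⟩ := (isGradedTropical_homogenization hJ).exists_homWt hK w v
  refine ⟨ε₀, hε₀, fun ε h1 h2 => ?_⟩
  rw [initialIdeal_initialIdeal_eq_map, h ε h1 h2, ← initialIdeal_eq_map]

theorem isTropicalIdeal_initialIdeal (hK : IsDivisible K) {J : Ideal (Laurent K n)}
    (hJ : IsTropicalIdeal J) (w : Fin n → ℝ) : IsTropicalIdeal (initialIdeal w J) :=
  hJ.initialIdealWt hK (dotWt_add w)

/-- A point lies in the variety if and only if the initial ideal there contains no monomial. -/
theorem mem_tropVariety_iff (J : Ideal (Laurent K n)) (w : Fin n → ℝ) :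
    w ∈ tropVariety J ↔ ∀ F ∈ initialIdeal w J, F.coeff.support.card ≠ 1 := by
  constructor
  · intro hw F hF hcard
    obtain ⟨u, hu⟩ := Finset.card_eq_one.mp hcard
    obtain ⟨f, hf, huf, hfF⟩ := (mem_initialIdealWt (dotWt_add w)).mp hF u (by simp [hu])
    rw [hu] at hfF
    obtain ⟨x, hx, y, hy, hxy⟩ := hw f hf fun h => by
      have := minTerms_subset _ _ huf
      simp [h] at this
    exact hxy ((Finset.mem_singleton.mp (hfF hx)).trans (Finset.mem_singleton.mp (hfF hy)).symm)
  · intro h f hf hf0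
    obtain ⟨v, hv⟩ : f.coeff.support.Nonempty := by
      rw [Finset.nonempty_iff_ne_empty, ne_eq, Finsupp.support_eq_empty]
      exact fun h => hf0 (AddMonoidAlgebra.coeff_eq_zero.mp h)
    obtain ⟨u, hu⟩ := minTerms_nonempty (dotWt w) hv
    by_contra hcon
    push Not at hcon
    refine h _ (initialForm_mem hf) ?_
    rw [support_initialForm, Finset.card_eq_one]
    exact ⟨u, Finset.eq_singleton_iff_unique_mem.mpr ⟨hu, fun x hx => hcon x hx u hu⟩⟩

/-- Membership in a tropical variety depends on the initial ideal only, even across different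
coefficient semirings. -/
theorem mem_tropVariety_congr {K' : Subsemiring TropicalReal} {J : Ideal (Laurent K n)}
    {J' : Ideal (Laurent K' n)} {w w' : Fin n → ℝ} (h : initialIdeal w J = initialIdeal w' J') :
    w ∈ tropVariety J ↔ w' ∈ tropVariety J' := by
  rw [mem_tropVariety_iff, mem_tropVariety_iff, h]

end Homogenization

/-! ### Relatively open convex sets and their cones -/

section RelativeInterior

variable {n : ℕ}

theorem mem_intrinsicInterior_iff {s : Set (Fin n → ℝ)} {x : Fin n → ℝ} :
    x ∈ intrinsicInterior ℝ s ↔ x ∈ s ∧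
      ∃ r > 0, ∀ z ∈ affineSpan ℝ s, dist z x < r → z ∈ s := by
  rw [mem_intrinsicInterior]
  constructor
  · rintro ⟨y, hy, rfl⟩
    have hys : y ∈ (Subtype.val ⁻¹' s : Set (affineSpan ℝ s)) := interior_subset hy
    refine ⟨hys, ?_⟩
    obtain ⟨r, hr, hball⟩ := Metric.mem_nhds_iff.mp (mem_interior_iff_mem_nhds.mp hy)
    exact ⟨r, hr, fun z hz hzr =>
      hball (show (⟨z, hz⟩ : affineSpan ℝ s) ∈ Metric.ball y r from hzr)⟩
  · rintro ⟨hx, r, hr, h⟩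
    refine ⟨⟨x, subset_affineSpan ℝ s hx⟩, ?_, rfl⟩
    rw [mem_interior_iff_mem_nhds, Metric.mem_nhds_iff]
    exact ⟨r, hr, fun z hz => h z z.2 hz⟩

/-- Every segment between points of `C` can be prolonged within `C` beyond its end points. For
convex sets this means that `C` is relatively open. -/
def IsProlongable (C : Set (Fin n → ℝ)) : Prop :=
  ∀ x ∈ C, ∀ y ∈ C, ∃ δ > (0 : ℝ), x + δ • (x - y) ∈ C

theorem line_mem_affineSubspace (S : AffineSubspace ℝ (Fin n → ℝ)) {x y z : Fin n → ℝ} (hx : x ∈ S)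
    (hy : y ∈ S) (hz : z ∈ S) (c : ℝ) : z + c • (x - y) ∈ S := by
  have := S.smul_vsub_vadd_mem c hx hy hz
  rwa [vsub_eq_sub, vadd_eq_add, add_comm] at this

/-- A prolongable convex set is relatively open. -/
theorem IsProlongable.exists_ball {C : Set (Fin n → ℝ)} (hC : Convex ℝ C) (hp : IsProlongable C)
    {x : Fin n → ℝ} (hx : x ∈ C) : ∃ r > 0, ∀ z ∈ affineSpan ℝ C, dist z x < r → z ∈ C := by
  obtain ⟨p, hpi⟩ := Set.Nonempty.intrinsicInterior hC ⟨x, hx⟩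
  obtain ⟨hpC, r, hr, hball⟩ := mem_intrinsicInterior_iff.mp hpi
  obtain ⟨δ, hδ, hy⟩ := hp x hx p hpC
  have h1δ : 0 < 1 + δ := by linarith
  -- the homothety with centre `x + δ (x - p)` that moves `x` to `p` has ratio `(1 + δ) / δ`
  refine ⟨r * (δ / (1 + δ)), by positivity, fun z hz hzx => ?_⟩
  have hp' : p + ((1 + δ) / δ) • (z - x) ∈ C := by
    refine hball _ (line_mem_affineSubspace _ hz (subset_affineSpan ℝ C hx)
      (subset_affineSpan ℝ C hpC) _) ?_
    rw [dist_eq_norm, add_sub_cancel_left, norm_smul, Real.norm_eq_abs,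
      abs_of_pos (by positivity), ← dist_eq_norm]
    calc (1 + δ) / δ * dist z x < (1 + δ) / δ * (r * (δ / (1 + δ))) := by
          gcongr
      _ = r := by field_simp
  have hcomb := hC hp' hy (a := δ / (1 + δ)) (b := 1 / (1 + δ)) (by positivity) (by positivity)
    (by field_simp; ring)
  convert hcomb using 1
  ext i
  simp only [Pi.add_apply, Pi.smul_apply, Pi.sub_apply, smul_eq_mul]
  field_simp
  ring

theorem affineSpan_closure (C : Set (Fin n → ℝ)) : affineSpan ℝ (closure C) = affineSpan ℝ C := by
  refine le_antisymm (affineSpan_le.mpr ?_) (affineSpan_mono ℝ subset_closure)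
  exact closure_minimal (subset_affineSpan ℝ C) (AffineSubspace.closed_of_finiteDimensional _)

/-- The half-open segment from a point `x` of a relatively open convex set to a point `y` of the
closure lies in the set. -/
theorem IsProlongable.combo_mem {C : Set (Fin n → ℝ)} (hC : Convex ℝ C) (hp : IsProlongable C)
    {x y : Fin n → ℝ} (hx : x ∈ C) (hy : y ∈ closure C) {t : ℝ} (ht0 : 0 < t) (ht1 : t ≤ 1) :
    y + t • (x - y) ∈ C := by
  obtain ⟨r, hr, hball⟩ := hp.exists_ball hC hx
  obtain ⟨y', hy', hyy'⟩ := Metric.mem_closure_iff.mp hy (t * r) (by positivity)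
  have hyS : y ∈ affineSpan ℝ C := affineSpan_closure C ▸ subset_affineSpan ℝ _ hy
  have hp' : x + ((1 - t) / t) • (y - y') ∈ C := by
    refine hball _ (line_mem_affineSubspace _ hyS (subset_affineSpan ℝ C hy')
      (subset_affineSpan ℝ C hx) _) ?_
    rw [dist_eq_norm, add_sub_cancel_left, norm_smul, Real.norm_eq_abs,
      abs_of_nonneg (div_nonneg (by linarith) ht0.le), ← dist_eq_norm]
    have h1 : (1 - t) / t * dist y y' ≤ 1 / t * dist y y' := by
      gcongr
      linarith
    calc (1 - t) / t * dist y y' ≤ 1 / t * dist y y' := h1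
      _ < 1 / t * (t * r) := by gcongr
      _ = r := by field_simp
  have hcomb := hC hy' hp' (a := 1 - t) (b := t) (by linarith) ht0.le (by ring)
  convert hcomb using 1
  ext i
  simp only [Pi.add_apply, Pi.smul_apply, Pi.sub_apply, smul_eq_mul]
  field_simp
  ring

theorem IsProlongable.intrinsicInterior_closure {C : Set (Fin n → ℝ)} (hC : Convex ℝ C)
    (hp : IsProlongable C) : intrinsicInterior ℝ (closure C) = C := by
  ext x
  rw [mem_intrinsicInterior_iff, affineSpan_closure]
  constructor
  · rintro ⟨hx, r, hr, hball⟩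
    obtain ⟨p, hpC⟩ : C.Nonempty := closure_nonempty_iff.mp ⟨x, hx⟩
    have hxS : x ∈ affineSpan ℝ C := affineSpan_closure C ▸ subset_affineSpan ℝ _ hx
    set δ : ℝ := r / (2 * (1 + ‖x - p‖)) with hδ
    have hn := norm_nonneg (x - p)
    have hδ0 : 0 < δ := by positivity
    have hy : x + δ • (x - p) ∈ closure C := by
      refine hball _ (line_mem_affineSubspace _ hxS (subset_affineSpan ℝ C hpC) hxS _) ?_
      rw [dist_eq_norm, add_sub_cancel_left, norm_smul, Real.norm_eq_abs, abs_of_pos hδ0, hδ]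
      rw [div_mul_eq_mul_div, div_lt_iff₀ (by positivity)]
      nlinarith
    have := hp.combo_mem hC hpC hy (t := δ / (1 + δ)) (by positivity)
      (by rw [div_le_one (by linarith)]; linarith)
    convert this using 1
    ext i
    simp only [Pi.add_apply, Pi.smul_apply, Pi.sub_apply, smul_eq_mul]
    have h1 : 1 + δ ≠ 0 := by positivity
    field_simp
    ring
  · intro hx
    obtain ⟨r, hr, hball⟩ := hp.exists_ball hC hx
    exact ⟨subset_closure hx, r, hr, fun z hz hzr => subset_closure (hball z hz hzr)⟩

theorem starCone_mono (w : Fin n → ℝ) {X Y : Set (Fin n → ℝ)} (h : X ⊆ Y) :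
    starCone w X ⊆ starCone w Y :=
  fun _ ⟨ε₀, hε₀, hv⟩ => ⟨ε₀, hε₀, fun ε h1 h2 => h (hv ε h1 h2)⟩

theorem sub_mem_starCone {w x : Fin n → ℝ} {C : Set (Fin n → ℝ)} (hC : Convex ℝ C) (hw : w ∈ C)
    (hx : x ∈ C) : x - w ∈ starCone w C :=
  ⟨1, one_pos, fun _ h0 h1 => hC.add_smul_sub_mem hw hx ⟨h0.le, h1.le⟩⟩

theorem vectorSpan_starCone {w : Fin n → ℝ} {C : Set (Fin n → ℝ)} (hC : Convex ℝ C) (hw : w ∈ C) :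
    vectorSpan ℝ (starCone w C) = vectorSpan ℝ C := by
  have h0 : (0 : Fin n → ℝ) ∈ starCone w C := by
    have := sub_mem_starCone hC hw hw
    rwa [sub_self] at this
  apply le_antisymm
  · rw [vectorSpan_eq_span_vsub_set_right ℝ h0, Submodule.span_le]
    rintro _ ⟨v, ⟨ε₀, hε₀, hv⟩, rfl⟩
    have h1 := vsub_mem_vectorSpan ℝ (hv (ε₀ / 2) (by positivity) (by linarith)) hw
    rw [vsub_eq_sub, add_sub_cancel_left] at h1
    have h2 := Submodule.smul_mem _ (ε₀ / 2)⁻¹ h1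
    rw [smul_smul, inv_mul_cancel₀ (by positivity), one_smul] at h2
    simpa using h2
  · rw [vectorSpan_eq_span_vsub_set_right ℝ hw, Submodule.span_le]
    rintro _ ⟨x, hx, rfl⟩
    have := vsub_mem_vectorSpan ℝ (sub_mem_starCone hC hw hx) h0
    simpa using this

end RelativeInterior

/-! ### Stars of polyhedral complexes -/

section PolyhedralComplex

variable {n : ℕ}

theorem IsPolyhedron.convex {P : Set (Fin n → ℝ)} (hP : IsPolyhedron P) : Convex ℝ P := by
  obtain ⟨A, rfl⟩ := hP
  intro x hx y hy a b ha hb hab c hc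
  have h1 := mul_le_mul_of_nonneg_left (hx c hc) ha
  have h2 := mul_le_mul_of_nonneg_left (hy c hc) hb
  have h3 : ∑ i, c.1 i * (a • x + b • y) i = a * ∑ i, c.1 i * x i + b * ∑ i, c.1 i * y i := by
    rw [Finset.mul_sum, Finset.mul_sum, ← Finset.sum_add_distrib]
    refine Finset.sum_congr rfl fun i _ => ?_
    simp only [Pi.add_apply, Pi.smul_apply, smul_eq_mul]
    ring
  rw [h3]
  calc _ ≤ a * c.2 + b * c.2 := add_le_add h1 h2
    _ = c.2 := by rw [← add_mul, hab, one_mul]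

theorem IsPolyhedron.isClosed {P : Set (Fin n → ℝ)} (hP : IsPolyhedron P) : IsClosed P := by
  obtain ⟨A, rfl⟩ := hP
  have : {x : Fin n → ℝ | ∀ a ∈ A, ∑ i, a.1 i * x i ≤ a.2} =
      ⋂ a ∈ A, {x | ∑ i, a.1 i * x i ≤ a.2} := by
    ext x; simp
  rw [this]
  exact isClosed_biInter fun a _ => isClosed_le (by fun_prop) continuous_const

/-- Every point of a polyhedron is a relative interior point of a face: the face on which all
inequalities that are tight at the point are tight. It is exposed by the sum of these inequalities,
the zero functional if there are none. -/
theorem IsPolyhedron.exists_face {P : Set (Fin n → ℝ)} (hP : IsPolyhedron P) {w : Fin n → ℝ}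
    (hw : w ∈ P) : ∃ F, IsExposed ℝ P F ∧ w ∈ intrinsicInterior ℝ F := by
  classical
  obtain ⟨A, rfl⟩ := hP
  set T := A.filter fun a => ∑ i, a.1 i * w i = a.2 with hT
  set l : StrongDual ℝ (Fin n → ℝ) :=
    ∑ a ∈ T, ∑ i, a.1 i • ContinuousLinearMap.proj (R := ℝ) (φ := fun _ : Fin n => ℝ) i with hl
  have hlx : ∀ x, l x = ∑ a ∈ T, ∑ i, a.1 i * x i := fun x => by
    simp [hl]
  have hTw : ∀ a ∈ T, ∑ i, a.1 i * w i = a.2 := fun a ha => (Finset.mem_filter.mp ha).2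
  have hTA : ∀ a ∈ T, a ∈ A := fun a ha => (Finset.mem_filter.mp ha).1
  set P := {x : Fin n → ℝ | ∀ a ∈ A, ∑ i, a.1 i * x i ≤ a.2} with hP
  have hlw : ∀ y ∈ P, l y ≤ l w := fun y hy => by
    rw [hlx, hlx]
    exact Finset.sum_le_sum fun a ha => (hy a (hTA a ha)).trans (hTw a ha).ge
  set F := {x ∈ P | ∀ y ∈ P, l y ≤ l x} with hF
  have hactive : ∀ x ∈ F, ∀ a ∈ T, ∑ i, a.1 i * x i = a.2 := by
    intro x hx a ha
    have h1 : ∑ a ∈ T, ∑ i, a.1 i * x i = ∑ a ∈ T, a.2 := by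
      rw [← Finset.sum_congr rfl hTw, ← hlx, ← hlx]
      exact le_antisymm (hlw x hx.1) (hx.2 w hw)
    exact (Finset.sum_eq_sum_iff_of_le fun a ha => hx.1 a (hTA a ha)).mp h1 a ha
  refine ⟨F, fun _ => ⟨l, rfl⟩, mem_intrinsicInterior_iff.mpr ⟨⟨hw, hlw⟩, ?_⟩⟩
  -- the constraints that are not active at `w` hold in a neighbourhood of `w`
  have hnear : ∀ᶠ z in nhds w, ∀ a ∈ A, a ∉ T → ∑ i, a.1 i * z i ≤ a.2 := by
    rw [Filter.eventually_all_finset]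
    intro a ha
    by_cases haT : a ∈ T
    · exact Filter.Eventually.of_forall fun z h => absurd haT h
    · have hlt : ∑ i, a.1 i * w i < a.2 :=
        lt_of_le_of_ne (hw a ha) fun h => haT (Finset.mem_filter.mpr ⟨ha, h⟩)
      have hcont : Continuous fun z : Fin n → ℝ => ∑ i, a.1 i * z i := by fun_prop
      filter_upwards [hcont.continuousAt.eventually_lt continuousAt_const hlt]
        with z hz _ using hz.le
  obtain ⟨r, hr, hball⟩ := Metric.eventually_nhds_iff.mp hnear
  refine ⟨r, hr, fun z hz hzr => ?_⟩
  have hzT : ∀ a ∈ T, ∑ i, a.1 i * z i = a.2 := by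
    intro a ha
    have hspan : affineSpan ℝ F ≤ (affineSpan ℝ {a.2}).comap
        (∑ i, a.1 i • LinearMap.proj (R := ℝ) (φ := fun _ : Fin n => ℝ) i :
          (Fin n → ℝ) →ₗ[ℝ] ℝ).toAffineMap := by
      refine affineSpan_le.mpr fun x hx => ?_
      simpa using hactive x hx a ha
    simpa using hspan hz
  have hzP : z ∈ P := fun a ha => by
    by_cases haT : a ∈ T
    · exact (hzT a haT).le
    · exact hball hzr a ha haT
  refine ⟨hzP, fun y hy => (hlw y hy).trans_eq ?_⟩
  rw [hlx, hlx]
  exact Finset.sum_congr rfl fun a ha => (hTw a ha).trans (hzT a ha).symm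

/-- The star of the support of a finite polyhedral complex is the support of its star. -/
theorem IsPolyhedralComplex.sUnion_polyStar {Γ : Set (Set (Fin n → ℝ))}
    (hΓ : IsPolyhedralComplex Γ) (w : Fin n → ℝ) :
    starCone w (⋃₀ Γ) = ⋃₀ polyStar Γ w := by
  apply subset_antisymm
  · intro v hv
    -- one cell contains `w + ε v` for arbitrarily small `ε`
    obtain ⟨τ, hτ, hfreq⟩ : ∃ τ ∈ Γ, ∃ᶠ ε : ℝ in nhdsWithin 0 (Set.Ioi 0), w + ε • v ∈ τ := by
      by_contra hcon
      push Not at hcon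
      obtain ⟨ε₀, hε₀, hv⟩ := hv
      have h1 : ∀ᶠ ε : ℝ in nhdsWithin 0 (Set.Ioi 0), ∀ τ ∈ Γ, w + ε • v ∉ τ :=
        (hΓ.finite.eventually_all (l := nhdsWithin 0 (Set.Ioi 0))).mpr fun τ hτ => hcon τ hτ
      obtain ⟨ε, hε, hε'⟩ := (h1.and (Ioo_mem_nhdsGT hε₀)).exists
      obtain ⟨τ, hτ, hmem⟩ := hv ε hε'.1 hε'.2
      exact hε τ hτ hmem
    have hcl := (hΓ.polyhedron τ hτ).isClosed
    have hcv := (hΓ.polyhedron τ hτ).convex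
    have hwτ : w ∈ τ := by
      refine hcl.mem_of_frequently_of_tendsto hfreq ?_
      have : Filter.Tendsto (fun ε : ℝ => w + ε • v) (nhds 0) (nhds (w + (0 : ℝ) • v)) :=
        (by fun_prop : Continuous fun ε : ℝ => w + ε • v).tendsto 0
      rw [zero_smul, add_zero] at this
      exact this.mono_left nhdsWithin_le_nhds
    obtain ⟨ε₁, hε₁, hpos⟩ := (hfreq.and_eventually self_mem_nhdsWithin).exists
    have hpos' : (0 : ℝ) < ε₁ := hpos
    obtain ⟨σ, hσ, hwσ⟩ := (hΓ.polyhedron τ hτ).exists_face hwτ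
    refine ⟨starCone w τ, ⟨σ, hΓ.face_mem τ hτ σ ⟨w, intrinsicInterior_subset hwσ⟩ hσ, hwσ, τ, hτ,
      hσ.subset, rfl⟩, ε₁, hpos', fun ε h1 h2 => ?_⟩
    have := hcv.add_smul_sub_mem hwτ hε₁ (t := ε / ε₁)
      ⟨by positivity, by rw [div_le_one hpos']; exact h2.le⟩
    rwa [add_sub_cancel_left, smul_smul, div_mul_cancel₀ _ hpos'.ne'] at this
  · rintro v ⟨C, ⟨σ, _, _, τ, hτ, _, rfl⟩, hv⟩
    exact starCone_mono w (Set.subset_sUnion_of_mem hτ) hv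

end PolyhedralComplex

/-! ### Gröbner cells -/

section GroebnerCells

variable {n : ℕ} {K : Subsemiring TropicalReal}

/-- The set of the weights `w'` with `in_{w'}(L) = in_w(L)`; its closure is the Gröbner cell of `L`
at `w`. -/
def groebnerClass (L : Ideal (OrdPoly K (n + 1))) (w : Fin n → ℝ) : Set (Fin n → ℝ) :=
  {w' | initialIdealWt (homWt w') L = initialIdealWt (homWt w) L}

theorem mem_groebnerClass_self (L : Ideal (OrdPoly K (n + 1))) (w : Fin n → ℝ) :
    w ∈ groebnerClass L w :=
  rfl

theorem mem_groebnerCell_self (L : Ideal (OrdPoly K (n + 1))) (w : Fin n → ℝ) :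
    w ∈ groebnerCell L w :=
  subset_closure rfl

theorem groebnerCell_congr {L : Ideal (OrdPoly K (n + 1))} {w w' : Fin n → ℝ}
    (h : w' ∈ groebnerClass L w) : groebnerCell L w' = groebnerCell L w := by
  have h' : initialIdealWt (homWt w') L = initialIdealWt (homWt w) L := h
  rw [groebnerCell, groebnerCell, h']

theorem mem_closure_of_ray {C : Set (Fin n → ℝ)} {w v : Fin n → ℝ} {ε₀ : ℝ} (hε₀ : 0 < ε₀)
    (h : ∀ ε : ℝ, 0 < ε → ε < ε₀ → w + ε • v ∈ C) : w ∈ closure C := by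
  refine mem_closure_of_frequently_of_tendsto (b := nhdsWithin (0 : ℝ) (Ioi 0))
    (f := fun ε : ℝ => w + ε • v) ?_ ?_
  · exact Filter.Eventually.frequently
      (Filter.mem_of_superset (Ioo_mem_nhdsGT hε₀) fun ε hε => h ε hε.1 hε.2)
  · have : Filter.Tendsto (fun ε : ℝ => w + ε • v) (nhds 0) (nhds (w + (0 : ℝ) • v)) :=
      (by fun_prop : Continuous fun ε : ℝ => w + ε • v).tendsto 0
    rw [zero_smul, add_zero] at this
    exact this.mono_left nhdsWithin_le_nhds

variable (hK : IsDivisible K) {L : Ideal (OrdPoly K (n + 1))} (hL : IsGradedTropical L)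
include hK hL

theorem isGradedTropical_initialIdealWt_homWt (w : Fin n → ℝ) :
    IsGradedTropical (initialIdealWt (homWt w) L) :=
  hL.initialIdealWt hK (homWtHom w)

/-- For `x` and `y` in the class, the direction `x - y` leads from `y` into the class by convexity.
By the formula for initial ideals of initial ideals, the same direction then leads from `x` into the
class, as only the initial ideal at the starting point matters. -/
theorem isProlongable_groebnerClass (w : Fin n → ℝ) : IsProlongable (groebnerClass L w) := by
  intro x hx y hy
  obtain ⟨ε₁, hε₁, h₁⟩ := hL.exists_homWt hK x (x - y)
  obtain ⟨ε₂, hε₂, h₂⟩ := hL.exists_homWt hK y (x - y)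
  have hx' : initialIdealWt (homWt x) L = initialIdealWt (homWt w) L := hx
  have hy' : initialIdealWt (homWt y) L = initialIdealWt (homWt w) L := hy
  set ε := min (min ε₁ ε₂) 1 / 2 with hε
  have hm : 0 < min (min ε₁ ε₂) 1 := by positivity
  have hε0 : 0 < ε := by positivity
  have hlt : ε < min (min ε₁ ε₂) 1 := half_lt_self hm
  refine ⟨ε, hε0, ?_⟩
  have h3 : y + ε • (x - y) ∈ groebnerClass L w :=
    (hL.convex_homWt hK w).add_smul_sub_mem hy hx
      ⟨hε0.le, (hlt.trans_le (min_le_right _ _)).le⟩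
  have h3' : initialIdealWt (homWt (y + ε • (x - y))) L = initialIdealWt (homWt w) L := h3
  change initialIdealWt (homWt (x + ε • (x - y))) L = _
  rw [← h₁ ε hε0 (hlt.trans_le ((min_le_left _ _).trans (min_le_left _ _))), hx', ← hy',
    h₂ ε hε0 (hlt.trans_le ((min_le_left _ _).trans (min_le_right _ _))), h3', hy']

theorem intrinsicInterior_groebnerCell (w : Fin n → ℝ) :
    intrinsicInterior ℝ (groebnerCell L w) = groebnerClass L w :=
  (isProlongable_groebnerClass hK hL w).intrinsicInterior_closure (hL.convex_homWt hK w)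

theorem groebnerClass_combo_mem {w x y : Fin n → ℝ} (hx : x ∈ groebnerClass L w)
    (hy : y ∈ groebnerCell L w) {t : ℝ} (ht0 : 0 < t) (ht1 : t ≤ 1) :
    y + t • (x - y) ∈ groebnerClass L w :=
  (isProlongable_groebnerClass hK hL w).combo_mem (hL.convex_homWt hK w) hx hy ht0 ht1

theorem convex_groebnerCell (w : Fin n → ℝ) : Convex ℝ (groebnerCell L w) :=
  Convex.closure (hL.convex_homWt hK w)

/-- `in_v(in_w(L)) = in_u(L)` means that `in_u(L)` is also the initial ideal at the points `w + ε v`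
with small `ε > 0`. -/
theorem initialIdealWt_eq_iff_mem_starCone {w v u : Fin n → ℝ} :
    initialIdealWt (homWt v) (initialIdealWt (homWt w) L) = initialIdealWt (homWt u) L ↔
      v ∈ starCone w (groebnerClass L u) := by
  obtain ⟨ε₀, hε₀, h⟩ := hL.exists_homWt hK w v
  constructor
  · intro hv
    exact ⟨ε₀, hε₀, fun ε h1 h2 => (h ε h1 h2).symm.trans hv⟩
  · rintro ⟨ε₁, hε₁, h'⟩
    have hm : 0 < min ε₀ ε₁ / 2 := by positivity
    have hlt : min ε₀ ε₁ / 2 < min ε₀ ε₁ := half_lt_self (by positivity)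
    exact (h _ hm (hlt.trans_le (min_le_left _ _))).trans
      (h' _ hm (hlt.trans_le (min_le_right _ _)))

/-- The cell at `w` is contained in the cells at the nearby points `w + ε v`. -/
theorem groebnerCell_subset {w v u : Fin n → ℝ}
    (h : initialIdealWt (homWt v) (initialIdealWt (homWt w) L) = initialIdealWt (homWt u) L) :
    groebnerCell L w ⊆ groebnerCell L u := by
  refine closure_minimal (fun w' hw' => ?_) isClosed_closure
  have hw'' : initialIdealWt (homWt w') L = initialIdealWt (homWt w) L := hw'
  obtain ⟨ε₀, hε₀, h'⟩ := (initialIdealWt_eq_iff_mem_starCone hK hL (w := w') (v := v)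
    (u := u)).mp ((congrArg (initialIdealWt (homWt v)) hw'').trans h)
  exact mem_closure_of_ray hε₀ h'

theorem initialIdealWt_sub_eq {w u : Fin n → ℝ} (hw : w ∈ groebnerCell L u) :
    initialIdealWt (homWt (u - w)) (initialIdealWt (homWt w) L) = initialIdealWt (homWt u) L := by
  rw [initialIdealWt_eq_iff_mem_starCone hK hL]
  exact ⟨1, one_pos, fun ε h1 h2 =>
    groebnerClass_combo_mem hK hL (mem_groebnerClass_self L u) hw h1 h2.le⟩

/-- The Gröbner cells of an initial ideal are the cones of the Gröbner cells. For the classes in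
place of the cells, this is `initialIdealWt_eq_iff_mem_starCone`; it has to be extended to the
closures. -/
theorem groebnerCell_initialIdealWt {w v u : Fin n → ℝ}
    (h : initialIdealWt (homWt v) (initialIdealWt (homWt w) L) = initialIdealWt (homWt u) L) :
    groebnerCell (initialIdealWt (homWt w) L) v = starCone w (groebnerCell L u) := by
  have hL' := isGradedTropical_initialIdealWt_homWt hK hL w
  have hclass : groebnerClass (initialIdealWt (homWt w) L) v = starCone w (groebnerClass L u) := by
    ext v'
    rw [← initialIdealWt_eq_iff_mem_starCone hK hL, ← h]
    rfl
  apply subset_antisymm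
  · intro v₀ hv₀
    obtain ⟨δ₀, hδ₀, hδ⟩ := (initialIdealWt_eq_iff_mem_starCone
      isDivisible_booleanSemiring hL' (w := v₀) (v := v - v₀) (u := v)).mp
      (initialIdealWt_sub_eq isDivisible_booleanSemiring hL' hv₀)
    have h1 := (initialIdealWt_eq_iff_mem_starCone isDivisible_booleanSemiring hL').mpr
      ⟨δ₀, hδ₀, hδ⟩
    obtain ⟨ε₀, hε₀, h2⟩ := hL.exists_homWt hK w v₀
    refine ⟨ε₀, hε₀, fun ε h3 h4 => ?_⟩
    rw [h2 ε h3 h4, h] at h1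
    exact groebnerCell_subset hK hL h1 (mem_groebnerCell_self L _)
  · intro x hx
    obtain ⟨ε₀, hε₀, hx⟩ := hx
    -- `u - w` lies in the relative interior of the cone, and so does the open segment to `x`
    refine mem_closure_of_ray (v := u - w - x) one_pos fun t ht0 ht1 => ?_
    change _ ∈ groebnerClass (initialIdealWt (homWt w) L) v
    rw [hclass]
    have hw : w ∈ groebnerCell L u :=
      groebnerCell_subset hK hL h (mem_groebnerCell_self L w)
    refine ⟨min ε₀ 1, by positivity, fun ε h1 h2 => ?_⟩
    have h3 := hx ε h1 (h2.trans_le (min_le_left _ _))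
    have h4 := groebnerClass_combo_mem hK hL (mem_groebnerClass_self L u) hw h1
      (h2.trans_le (min_le_right _ _)).le
    have h5 := groebnerClass_combo_mem hK hL h4 h3 ht0 ht1.le
    convert h5 using 1
    module

end GroebnerCells

/-! ### Varieties and multiplicities -/

section TropicalIdeals

variable {n : ℕ} {K : Subsemiring TropicalReal} (hK : IsDivisible K) {J : Ideal (Laurent K n)}
  (hJ : IsTropicalIdeal J)

theorem initialIdeal_eq_of_mem_groebnerClass {J : Ideal (Laurent K n)} {u u' : Fin n → ℝ}
    (h : u' ∈ groebnerClass (homogenization J) u) : initialIdeal u' J = initialIdeal u J := by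
  rw [initialIdeal_eq_map, initialIdeal_eq_map]
  exact congrArg _ h

theorem initialIdeal_initialIdeal_eq_of_homogenization {J : Ideal (Laurent K n)}
    {w v u : Fin n → ℝ}
    (h : initialIdealWt (homWt v) (initialIdealWt (homWt w) (homogenization J)) =
      initialIdealWt (homWt u) (homogenization J)) :
    initialIdeal v (initialIdeal w J) = initialIdeal u J := by
  rw [initialIdeal_initialIdeal_eq_map, h, ← initialIdeal_eq_map]

theorem mem_tropVariety_of_mem_groebnerClass {J : Ideal (Laurent K n)} {u u' : Fin n → ℝ}
    (h : u' ∈ groebnerClass (homogenization J) u) (hu : u ∈ tropVariety J) :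
    u' ∈ tropVariety J :=
  (mem_tropVariety_congr (initialIdeal_eq_of_mem_groebnerClass h)).mpr hu

include hK hJ

theorem tropVariety_initialIdeal (w : Fin n → ℝ) :
    tropVariety (initialIdeal w J) = starCone w (tropVariety J) := by
  ext v
  obtain ⟨ε₀, hε₀, h⟩ := exists_initialIdeal_eq hK hJ w v
  constructor
  · intro hv
    exact ⟨ε₀, hε₀, fun ε h1 h2 => (mem_tropVariety_congr (h ε h1 h2)).mp hv⟩
  · rintro ⟨ε₁, hε₁, h'⟩
    have hm : 0 < min ε₀ ε₁ / 2 := by positivity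
    have hlt : min ε₀ ε₁ / 2 < min ε₀ ε₁ := half_lt_self (by positivity)
    exact (mem_tropVariety_congr (h _ hm (hlt.trans_le (min_le_left _ _)))).mpr
      (h' _ hm (hlt.trans_le (min_le_right _ _)))

omit hK hJ in
theorem mem_tropVariety_of_mem_tropVariety_initialIdeal {w v : Fin n → ℝ}
    (hv : v ∈ tropVariety (initialIdeal w J)) : w ∈ tropVariety J := by
  rw [mem_tropVariety_iff]
  intro F hF hcard
  obtain ⟨u, hu, u', hu', hne⟩ := hv F hF fun h => by simp [h] at hcard
  exact hne (Finset.card_le_one.mp hcard.le _ (minTerms_subset _ _ hu) _ (minTerms_subset _ _ hu'))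

/-- The star of the Gröbner complex structure consists of the Gröbner cells of the initial ideal of
the homogenization. The cell with `w` in its relative interior is the cell at `w`, and a cell at `u`
that contains it gives the direction `v = u - w`. -/
theorem polyStar_groebnerComplex (w : Fin n → ℝ) :
    polyStar (groebnerComplex J) w =
      groebnerComplexOn (initialIdealWt (homWt w) (homogenization J))
        (tropVariety (initialIdeal w J)) := by
  have hH := isGradedTropical_homogenization hJ
  ext C
  constructor
  · rintro ⟨_, ⟨w₁, _, rfl⟩, hw, _, ⟨u, hu, rfl⟩, hsub, rfl⟩
    have h := initialIdealWt_sub_eq hK hH (hsub (intrinsicInterior_subset hw))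
    exact ⟨u - w, (mem_tropVariety_congr
      (initialIdeal_initialIdeal_eq_of_homogenization h)).mpr hu,
      groebnerCell_initialIdealWt hK hH h⟩
  · rintro ⟨v, hv, rfl⟩
    obtain ⟨ε₀, hε₀, h⟩ := hH.exists_homWt hK w v
    have h' := h (ε₀ / 2) (by positivity) (half_lt_self hε₀)
    refine ⟨groebnerCell (homogenization J) w, ⟨w,
      mem_tropVariety_of_mem_tropVariety_initialIdeal hv, rfl⟩, ?_, _, ⟨w + (ε₀ / 2) • v, ?_, rfl⟩,
      groebnerCell_subset hK hH h', groebnerCell_initialIdealWt hK hH h'⟩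
    · rw [intrinsicInterior_groebnerCell hK hH]
      exact mem_groebnerClass_self _ w
    · exact (mem_tropVariety_congr (initialIdeal_initialIdeal_eq_of_homogenization h')).mp hv

/-- At a relative interior point of a maximal cell, the star of the variety is contained in the span
of the cell: the cell at a nearby point of the variety contains the given cell, so by maximality it
is equal to it. -/
theorem mem_vectorSpan_of_maximal {p x : Fin n → ℝ}
    (hmax : Maximal (· ∈ groebnerComplex J) (groebnerCell (homogenization J) p))
    (hx : x ∈ starCone p (tropVariety J)) :
    x ∈ vectorSpan ℝ (groebnerCell (homogenization J) p) := by
  have hH := isGradedTropical_homogenization hJ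
  obtain ⟨ε₀, hε₀, h⟩ := hH.exists_homWt hK p x
  obtain ⟨ε₁, hε₁, h'⟩ := hx
  have hm : 0 < min ε₀ ε₁ / 2 := by positivity
  have hlt : min ε₀ ε₁ / 2 < min ε₀ ε₁ := half_lt_self (by positivity)
  have hsub := groebnerCell_subset hK hH (h _ hm (hlt.trans_le (min_le_left _ _)))
  have hle := hmax.2 ⟨_, h' _ hm (hlt.trans_le (min_le_right _ _)), rfl⟩ hsub
  have h1 := vsub_mem_vectorSpan ℝ (hle (mem_groebnerCell_self _ _))
    (mem_groebnerCell_self (homogenization J) p)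
  rw [vsub_eq_sub, add_sub_cancel_left] at h1
  exact (Submodule.smul_mem_iff _ hm.ne').mp h1

theorem initialIdeal_eq_of_mem_intrinsicInterior_starCone {w u₀ u v : Fin n → ℝ}
    (hw : w ∈ groebnerCell (homogenization J) u₀)
    (hu : u ∈ intrinsicInterior ℝ (groebnerCell (homogenization J) u₀))
    (hv : v ∈ intrinsicInterior ℝ (starCone w (groebnerCell (homogenization J) u₀))) :
    initialIdeal v (initialIdeal w J) = initialIdeal u J := by
  have hH := isGradedTropical_homogenization hJ
  have h := initialIdealWt_sub_eq hK hH hw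
  rw [← groebnerCell_initialIdealWt hK hH h, intrinsicInterior_groebnerCell
    isDivisible_booleanSemiring (isGradedTropical_initialIdealWt_homWt hK hH w)] at hv
  rw [intrinsicInterior_groebnerCell hK hH] at hu
  rw [initialIdeal_eq_of_mem_groebnerClass hu]
  exact initialIdeal_initialIdeal_eq_of_homogenization (Eq.trans hv h)

theorem vectorSpan_starCone_groebnerCell {w u₀ : Fin n → ℝ}
    (hw : w ∈ groebnerCell (homogenization J) u₀) :
    vectorSpan ℝ (starCone w (groebnerCell (homogenization J) u₀)) =
      vectorSpan ℝ (groebnerCell (homogenization J) u₀) :=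
  vectorSpan_starCone (convex_groebnerCell hK (isGradedTropical_homogenization hJ) u₀) hw

theorem tropMultiplicity_starCone {τ : Set (Fin n → ℝ)} (hτ : τ ∈ groebnerComplex J)
    {w : Fin n → ℝ} (hw : w ∈ τ) {u v : Fin n → ℝ} (hu : u ∈ intrinsicInterior ℝ τ)
    (hv : v ∈ intrinsicInterior ℝ (starCone w τ)) :
    tropMultiplicity (initialIdeal w J) (starCone w τ) v = tropMultiplicity J τ u := by
  obtain ⟨u₀, _, rfl⟩ := hτ
  unfold tropMultiplicity degreeZeroExponents
  rw [initialIdeal_eq_of_mem_intrinsicInterior_starCone hK hJ hw hu hv,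
    vectorSpan_starCone_groebnerCell hK hJ hw]

/-- The maximal cells `ρ` of the Gröbner complex structure of `V(in_w(J))` have the span of the
cones they meet. Both inclusions use that one cell lies in the variety near the common point `v`,
and the variety near `v` in the span of the other cell. -/
theorem vectorSpan_eq_of_maximal {τ : Set (Fin n → ℝ)} (hτ : Maximal (· ∈ groebnerComplex J) τ)
    {w : Fin n → ℝ} (hw : w ∈ τ) {ρ : Set (Fin n → ℝ)}
    (hρ : Maximal (· ∈ groebnerComplex (initialIdeal w J)) ρ) {v : Fin n → ℝ}
    (hvτ : v ∈ intrinsicInterior ℝ (starCone w τ)) (hvρ : v ∈ intrinsicInterior ℝ ρ) :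
    vectorSpan ℝ ρ = vectorSpan ℝ τ := by
  have hH := isGradedTropical_homogenization hJ
  have hB := isDivisible_booleanSemiring
  have hJw := isTropicalIdeal_initialIdeal hK hJ w
  have hHw := isGradedTropical_homogenization hJw
  obtain ⟨u, hu, rfl⟩ := hτ.1
  obtain ⟨p, hp, rfl⟩ := hρ.1
  -- `v` may be taken as the base point of `ρ`
  rw [intrinsicInterior_groebnerCell hB hHw] at hvρ
  rw [← groebnerCell_congr hvρ] at hρ ⊢
  have hvV : v ∈ tropVariety (initialIdeal w J) := mem_tropVariety_of_mem_groebnerClass hvρ hp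
  have huu : u ∈ intrinsicInterior ℝ (groebnerCell (homogenization J) u) := by
    rw [intrinsicInterior_groebnerCell hK hH]
    exact mem_groebnerClass_self _ u
  have hin := initialIdeal_eq_of_mem_intrinsicInterior_starCone hK hJ hw huu hvτ
  apply le_antisymm
  · rw [vectorSpan_eq_span_vsub_set_right ℝ
      (mem_groebnerCell_self (homogenization (initialIdeal w J)) v), Submodule.span_le]
    rintro _ ⟨x, hx, rfl⟩
    -- the initial ideals of `in_w(J)` at `v` and of `J` at `u` agree, hence so do the stars
    refine mem_vectorSpan_of_maximal hK hJ hτ ?_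
    rw [← tropVariety_initialIdeal hK hJ u, ← hin, tropVariety_initialIdeal hB hJw v]
    refine ⟨1, one_pos, fun ε h1 h2 => mem_tropVariety_of_mem_groebnerClass ?_ hvV⟩
    have h3 := groebnerClass_combo_mem hB hHw (mem_groebnerClass_self _ v) hx
      (t := 1 - ε) (by linarith) (by linarith)
    convert h3 using 1
    change v + ε • (x - v) = _
    module
  · rw [← vectorSpan_starCone_groebnerCell hK hJ hw, vectorSpan_eq_span_vsub_set_right ℝ
      (intrinsicInterior_subset hvτ), Submodule.span_le]
    rintro _ ⟨x, hx, rfl⟩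
    refine mem_vectorSpan_of_maximal hB hJw hρ ⟨1, one_pos, fun ε h1 h2 => ?_⟩
    have h := initialIdealWt_sub_eq hK hH hw
    have hL := isGradedTropical_initialIdealWt_homWt hK hH w
    rw [← groebnerCell_initialIdealWt hK hH h] at hx hvτ
    rw [intrinsicInterior_groebnerCell hB hL] at hvτ
    have h3 := groebnerClass_combo_mem hB hL hvτ hx (t := 1 - ε) (by linarith) (by linarith)
    have h4 : v + ε • (x - v) = x + (1 - ε) • (v - x) := by module
    change v + ε • (x - v) ∈ _
    rw [h4]
    exact (mem_tropVariety_congr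
      (initialIdeal_initialIdeal_eq_of_homogenization (Eq.trans h3 h))).mpr hu

theorem tropMultiplicity_eq_of_mem_intrinsicInterior {τ : Set (Fin n → ℝ)}
    (hτ : τ ∈ groebnerComplex J) {w : Fin n → ℝ} (hw : w ∈ τ) {ρ : Set (Fin n → ℝ)}
    (hρ : ρ ∈ groebnerComplex (initialIdeal w J)) {v₀ : Fin n → ℝ}
    (hv₀τ : v₀ ∈ intrinsicInterior ℝ (starCone w τ)) (hv₀ρ : v₀ ∈ intrinsicInterior ℝ ρ)
    (hspan : vectorSpan ℝ ρ = vectorSpan ℝ τ) {u v : Fin n → ℝ}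
    (hu : u ∈ intrinsicInterior ℝ τ) (hv : v ∈ intrinsicInterior ℝ ρ) :
    tropMultiplicity (initialIdeal w J) ρ v = tropMultiplicity J τ u := by
  have hHw := isGradedTropical_homogenization (isTropicalIdeal_initialIdeal hK hJ w)
  obtain ⟨u₀, _, rfl⟩ := hτ
  obtain ⟨p, _, rfl⟩ := hρ
  rw [intrinsicInterior_groebnerCell isDivisible_booleanSemiring hHw] at hv hv₀ρ
  unfold tropMultiplicity degreeZeroExponents
  rw [hspan, ← initialIdeal_eq_of_mem_intrinsicInterior_starCone hK hJ hw hu hv₀τ,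
    initialIdeal_eq_of_mem_groebnerClass hv, initialIdeal_eq_of_mem_groebnerClass hv₀ρ]

end TropicalIdeals

end

theorem propositionp {n : ℕ} (K : Subsemiring TropicalReal) (hK : K = ⊤ ∨ K = booleanSemiring)
    (I : Ideal (Laurent K n)) (hI : IsTropicalIdeal I) (w : Fin n → ℝ) :
    -- initial ideals of initial ideals
    (∀ v : Fin n → ℝ, ∃ ε₀ > (0 : ℝ), ∀ ε : ℝ, 0 < ε → ε < ε₀ →
      initialIdeal v (initialIdeal w I) = initialIdeal (w + ε • v) I) ∧
    -- the variety of the initial ideal is the star of the variety, as a set ...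
    tropVariety (initialIdeal w I) = starCone w (tropVariety I) ∧
    -- ... which is the support of the star of every polyhedral complex with support `V(I)`
    (∀ Γ : Set (Set (Fin n → ℝ)), IsPolyhedralComplex Γ → ⋃₀ Γ = tropVariety I →
      tropVariety (initialIdeal w I) = ⋃₀ polyStar Γ w) ∧
    -- the star of the Gröbner complex structure has the same cones as the Gröbner complex
    -- structure on the variety of the initial ideal
    polyStar (groebnerComplex I) w =
      groebnerComplexOn (initialIdealWt (homWt w) (homogenization I))
        (tropVariety (initialIdeal w I)) ∧
    -- every maximal cone of the star has the weight of the maximal cell it comes from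
    (∀ τ : Set (Fin n → ℝ), Maximal (· ∈ groebnerComplex I) τ → w ∈ τ →
      ∀ u ∈ intrinsicInterior ℝ τ, ∀ v ∈ intrinsicInterior ℝ (starCone w τ),
        tropMultiplicity (initialIdeal w I) (starCone w τ) v = tropMultiplicity I τ u) ∧
    -- and this is also its weight for the Gröbner complex structure which is defined by the
    -- initial ideal alone
    (∀ τ : Set (Fin n → ℝ), Maximal (· ∈ groebnerComplex I) τ → w ∈ τ →
      ∀ ρ : Set (Fin n → ℝ), Maximal (· ∈ groebnerComplex (initialIdeal w I)) ρ →
        (intrinsicInterior ℝ (starCone w τ) ∩ intrinsicInterior ℝ ρ).Nonempty →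
        vectorSpan ℝ ρ = vectorSpan ℝ τ ∧
        ∀ u ∈ intrinsicInterior ℝ τ, ∀ v ∈ intrinsicInterior ℝ ρ,
          tropMultiplicity (initialIdeal w I) ρ v = tropMultiplicity I τ u) := by
  have hD : IsDivisible K := by
    rcases hK with rfl | rfl
    · exact isDivisible_top
    · exact isDivisible_booleanSemiring
  refine ⟨exists_initialIdeal_eq hD hI w, tropVariety_initialIdeal hD hI w, fun Γ hΓ hsupp => ?_,
    polyStar_groebnerComplex hD hI w, fun τ hτ hw u hu v hv =>
    tropMultiplicity_starCone hD hI hτ.1 hw hu hv, ?_⟩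
  · rw [tropVariety_initialIdeal hD hI w, ← hsupp, hΓ.sUnion_polyStar w]
  · rintro τ hτ hw ρ hρ ⟨v₀, hv₀τ, hv₀ρ⟩
    have hspan := vectorSpan_eq_of_maximal hD hI hτ hw hρ hv₀τ hv₀ρ
    refine ⟨hspan, fun u hu v hv => ?_⟩
    exact tropMultiplicity_eq_of_mem_intrinsicInterior hD hI hτ.1 hw hρ.1 hv₀τ hv₀ρ hspan hu hv
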